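/- Let $k$ be an algebraically closed field and let $\mathsf T$ be a $k$-linear triangulated category with suspension $\Sigma$, with finite dimensional $\operatorname{Hom}$ spaces, split idempotents, and a Serre functor $S$ (an autoequivalence with natural isomorphisms $\mathsf T(A,B)\cong \operatorname{Hom}_k(\mathsf T(B,SA),k)$). Put $\tau=\Sigma^{-1}\circ S$. Let $\mathbb X$ be a class of objects of $\mathsf T$, closed under isomorphisms, (finite) direct sums and direct summands, which is precovering and preenveloping. Suppose that $\tau\mathbb X=\mathbb X$, i.e. the objects isomorphic to objects of the form $\tau X$ with $X\in\mathbb X$ are exactly the objects of $\mathbb X$. Let $\mathsf T_{\mathbb X}$ be the quotient category with the same objects as $\mathsf T$ and with $\mathsf T_{\mathbb X}(A,B)=\mathsf T(A,B)/\mathbb X(A,B)$, where $\mathbb X(A,B)$ is the space of morphisms factoring through an object of $\mathbb X$. Choose for each $M$ an $\mathbb X$-preenvelope $M\to X_M$ and a distinguished triangle $M\to X_M\to\sigma M\to\Sigma M$ in $\mathsf T$. This gives an endofunctor $\sigma$ of $\mathsf T_{\mathbb X}$: it sends the class of $\mu:M\to N$ to the class of $s:\sigma M\to\sigma N$, where $(\mu,\xi,s)$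 is any morphism between the chosen triangles. The distinguished triangles of $\mathsf T_{\mathbb X}$ are the diagrams isomorphic to $M\xrightarrow{\underline\mu}N\xrightarrow{\underline\nu}P\xrightarrow{\underline\pi}\sigma M$, where $M\xrightarrow{\mu}N\xrightarrow{\nu}P\to\Sigma M$ is a distinguished triangle of $\mathsf T$ such that every morphism from $M$ to an object of $\mathbb X$ factors through $\mu$, and $(\mathrm{id}_M,n,\pi)$ is a morphism from this triangle to $M\to X_M\to\sigma M\to\Sigma M$. An AR triangle is a distinguished triangle $A\to B\to C\xrightarrow{h}$ with $A,C$ indecomposable and $h\neq0$ such that each morphism to $C$ which is not a split epimorphism factors through $B\to C$. A category has AR triangles if each indecomposable object is the last term of an AR triangle and the first term of an AR triangle. The AR quiver has as vertices the isomorphism classes of indecomposable objects, has $\dim_k\operatorname{rad}(M,N)/\operatorname{rad}^2(M,N)$ arrows from $[M]$ to $[N]$, and has the translation given by $\tau[C]=[A]$ when there is an AR triangle $A\to B\to C\to$. Let $\Gamma$ and $\Gamma'$ be the AR quivers of $\mathsf T$ and $\mathsf T_{\mathbb X}$. A category with AR quiver $\Delta$ is standard if it is $k$-linearly equivalent to $\operatorname{add}k(\Delta)$,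 the additive closure of the mesh category: the path category of $\Delta$ over $k$ modulo the ideal generated by the mesh elements $\sum_{\alpha:x\to y}\alpha\,\rho(\alpha)$, one for each vertex $y$ with $\tau y$ defined. Here $\alpha$ runs through the arrows ending at $y$, and $\alpha\mapsto\rho(\alpha)$ is a chosen polarization, i.e. a bijection from the arrows $x\to y$ to the arrows $\tau y\to x$ for all $x,y$; standard means that the equivalence exists for some polarization. Then the following hold. (i) The functor $\sigma$ is an autoequivalence of $\mathsf T_{\mathbb X}$, and $\mathsf T_{\mathbb X}$, with suspension $\sigma$ and the distinguished triangles above, has AR triangles. (ii) As a translation quiver, $\Gamma'$ is obtained from $\Gamma$ by deleting the vertices corresponding to objects of $\mathbb X$ along with the arrows into or out of such vertices. More precisely, $[M]\mapsto[M]$ is a bijection from the isomorphism classes of indecomposable objects of $\mathsf T$ not in $\mathbb X$ to the isomorphism classes of indecomposable objects of $\mathsf T_{\mathbb X}$, and it preserves the numbers of arrows and the translation. (iii) If $\mathsf T$ is standard, then so is $\mathsf T_{\mathbb X}$. -/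

import Mathlib

open CategoryTheory Limits Pretriangulated

noncomputable section

namespace ARQuot

universe w v u v' u'

/-! ### Two-sided ideals of a `k`-linear category and their quotient categories -/

/-- A two-sided ideal of a `k`-linear category. -/
structure HomIdeal (k : Type w) [Field k] (C : Type u) [Category.{v} C] [Preadditive C]
    [Linear k C] where
  carrier : ∀ A B : C, Submodule k (A ⟶ B)
  comp_left : ∀ {A B D : C} (f : A ⟶ B) {g : B ⟶ D}, g ∈ carrier B D → f ≫ g ∈ carrier A D
  comp_right : ∀ {A B D : C} {f : A ⟶ B} (g : B ⟶ D), f ∈ carrier A B → f ≫ g ∈ carrier A D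

namespace HomIdeal

variable {k : Type w} [Field k] {C : Type u} [Category.{v} C] [Preadditive C] [Linear k C]
  (I : HomIdeal k C)

/-- Two parallel morphisms are related when their difference lies in the ideal. -/
def rel : HomRel C := fun A B f g => f - g ∈ I.carrier A B

instance : Congruence I.rel where
  comp_left f g g' h := by
    have := I.comp_left f h
    rwa [Preadditive.comp_sub] at this
  comp_right g h := by
    have := I.comp_right g h
    rwa [Preadditive.sub_comp] at this
  equivalence := by
    intro A B
    refine ⟨fun f => ?_, fun {f g} h => ?_, fun {f g l} h h' => ?_⟩
    · change f - f ∈ _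
      rw [sub_self]
      exact Submodule.zero_mem _
    · change g - f ∈ _
      rw [← neg_sub]
      exact Submodule.neg_mem _ h
    · change f - l ∈ _
      rw [← sub_add_sub_cancel f g l]
      exact Submodule.add_mem _ h h'

/-- The quotient of a `k`-linear category by an ideal: the same objects, and
`Hom(A, B) / I(A, B)` as morphism spaces. -/
abbrev QuotientCat := CategoryTheory.Quotient I.rel

/-- The quotient functor. -/
abbrev toQuotient : C ⥤ I.QuotientCat := CategoryTheory.Quotient.functor I.rel

lemma rel_add ⦃A B : C⦄ (f₁ f₂ g₁ g₂ : A ⟶ B) (hf : I.rel f₁ f₂) (hg : I.rel g₁ g₂) :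
    I.rel (f₁ + g₁) (f₂ + g₂) := by
  change f₁ + g₁ - (f₂ + g₂) ∈ _
  rw [add_sub_add_comm]
  exact Submodule.add_mem _ hf hg

lemma rel_smul (a : k) ⦃A B : C⦄ (f₁ f₂ : A ⟶ B) (hf : I.rel f₁ f₂) :
    I.rel (a • f₁) (a • f₂) := by
  change a • f₁ - a • f₂ ∈ _
  rw [← smul_sub]
  exact Submodule.smul_mem _ _ hf

instance : Preadditive I.QuotientCat := CategoryTheory.Quotient.preadditive I.rel I.rel_add

instance : I.toQuotient.Additive := CategoryTheory.Quotient.functor_additive I.rel I.rel_add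

instance : Linear k I.QuotientCat := CategoryTheory.Quotient.linear k I.rel I.rel_smul

instance [HasBinaryBiproducts C] : HasBinaryBiproducts I.QuotientCat where
  has_binary_biproduct A B :=
    hasBinaryBiproduct_of_total
      (I.toQuotient.mapBinaryBicone (BinaryBiproduct.bicone A.as B.as))
      (congrArg I.toQuotient.map
        (biprod.total : biprod.fst ≫ biprod.inl + biprod.snd ≫ biprod.inr = 𝟙 (A.as ⊞ B.as)))

/-- The ideal generated by a family of morphisms. -/
def generate (R : ∀ A B : C, Set (A ⟶ B)) : HomIdeal k C where
  carrier A B := Submodule.span k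
    {f | ∃ (Y Z : C) (a : A ⟶ Y) (r : Y ⟶ Z) (b : Z ⟶ B), r ∈ R Y Z ∧ f = a ≫ r ≫ b}
  comp_left {A B D} f {g} hg := by
    induction hg using Submodule.span_induction with
    | mem x hx =>
      obtain ⟨Y, Z, a, r, b, hr, rfl⟩ := hx
      exact Submodule.subset_span ⟨Y, Z, f ≫ a, r, b, hr, by simp⟩
    | zero => simp
    | add x y _ _ hx hy => rw [Preadditive.comp_add]; exact Submodule.add_mem _ hx hy
    | smul c x _ hx => rw [Linear.comp_smul]; exact Submodule.smul_mem _ _ hx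
  comp_right {A B D} f g hf := by
    induction hf using Submodule.span_induction with
    | mem x hx =>
      obtain ⟨Y, Z, a, r, b, hr, rfl⟩ := hx
      exact Submodule.subset_span ⟨Y, Z, a, r, b ≫ g, hr, by simp⟩
    | zero => simp
    | add x y _ _ hx hy => rw [Preadditive.add_comp]; exact Submodule.add_mem _ hx hy
    | smul c x _ hx => rw [Linear.smul_comp]; exact Submodule.smul_mem _ _ hx

end HomIdeal

/-! ### The radical and the spaces `Irr` -/

section Radical

variable (k : Type w) [Field k] {C : Type u} [Category.{v} C] [Preadditive C] [Linear k C]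

lemma isIso_one_sub_comm {A B : C} (f : A ⟶ B) (g : B ⟶ A) (h : IsIso (𝟙 A - f ≫ g)) :
    IsIso (𝟙 B - g ≫ f) := by
  refine ⟨𝟙 B + g ≫ inv (𝟙 A - f ≫ g) ≫ f, ?_, ?_⟩
  · have e : (𝟙 A - f ≫ g) ≫ inv (𝟙 A - f ≫ g) = 𝟙 A := IsIso.hom_inv_id _
    have e' : inv (𝟙 A - f ≫ g) = 𝟙 A + f ≫ g ≫ inv (𝟙 A - f ≫ g) := by
      rw [Preadditive.sub_comp, Category.id_comp, Category.assoc, sub_eq_iff_eq_add] at e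
      exact e
    have e'' : g ≫ inv (𝟙 A - f ≫ g) ≫ f = g ≫ f + g ≫ f ≫ g ≫ inv (𝟙 A - f ≫ g) ≫ f := by
      conv_lhs => rw [e']
      simp
    simp only [Preadditive.sub_comp, Preadditive.comp_add, Category.id_comp, Category.comp_id,
      Category.assoc]
    generalize g ≫ inv (𝟙 A - f ≫ g) ≫ f = W at *
    nth_rewrite 1 [e'']
    abel
  · have e : inv (𝟙 A - f ≫ g) ≫ (𝟙 A - f ≫ g) = 𝟙 A := IsIso.inv_hom_id _
    have e' : inv (𝟙 A - f ≫ g) = 𝟙 A + inv (𝟙 A - f ≫ g) ≫ f ≫ g := by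
      rw [Preadditive.comp_sub, Category.comp_id, sub_eq_iff_eq_add] at e
      exact e
    have e'' : g ≫ inv (𝟙 A - f ≫ g) ≫ f
        = g ≫ f + g ≫ inv (𝟙 A - f ≫ g) ≫ f ≫ g ≫ f := by
      conv_lhs => rw [e']
      simp
    simp only [Preadditive.comp_sub, Preadditive.add_comp, Category.id_comp, Category.comp_id,
      Category.assoc]
    rw [e'']
    abel

/-- The (Jacobson) radical of a `k`-linear category: `f : A ⟶ B` is radical when `1 - gf` is
invertible for every `g : B ⟶ A`. -/
def rad (A B : C) : Submodule k (A ⟶ B) where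
  carrier := {f | ∀ g : B ⟶ A, IsIso (𝟙 A - f ≫ g)}
  zero_mem' g := by
    rw [zero_comp, sub_zero]
    infer_instance
  add_mem' {f f'} hf hf' g := by
    have := hf g
    have h2 := isIso_one_sub_comm f' (g ≫ inv (𝟙 A - f ≫ g)) (hf' _)
    rw [Category.assoc] at h2
    have h3 : IsIso (𝟙 A - (inv (𝟙 A - f ≫ g) ≫ f') ≫ g) := isIso_one_sub_comm _ _ h2
    have h4 : 𝟙 A - (f + f') ≫ g
        = (𝟙 A - f ≫ g) ≫ (𝟙 A - (inv (𝟙 A - f ≫ g) ≫ f') ≫ g) := by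
      rw [Preadditive.comp_sub, Category.assoc, IsIso.hom_inv_id_assoc, Category.comp_id,
        Preadditive.add_comp]
      abel
    rw [h4]
    infer_instance
  smul_mem' c f hf g := by
    have := hf (c • g)
    rwa [Linear.comp_smul, ← Linear.smul_comp] at this

/-- The square of the radical: sums of composites of two radical morphisms. -/
def radSq (A B : C) : Submodule k (A ⟶ B) :=
  Submodule.span k {f | ∃ (D : C) (a : A ⟶ D) (b : D ⟶ B),
    a ∈ rad k A D ∧ b ∈ rad k D B ∧ f = a ≫ b}

/-- `Irr(A, B) = rad(A, B) / rad²(A, B)`. -/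
abbrev Irr (A B : C) := rad k A B ⧸ (radSq k A B).submoduleOf (rad k A B)

end Radical

/-! ### Suspension, triangles and Auslander-Reiten triangles -/

/-- A suspension functor together with a class of distinguished triangles
`A ⟶ B ⟶ C ⟶ ΣA`. -/
structure TriangleData (C : Type u) [Category.{v} C] where
  susp : C ⥤ C
  dist : ∀ ⦃X Y Z : C⦄, (X ⟶ Y) → (Y ⟶ Z) → (Z ⟶ susp.obj X) → Prop

/-- The suspension and the distinguished triangles of a triangulated category. -/
def triangulatedData (T : Type u) [Category.{v} T] [Preadditive T] [HasZeroObject T]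
    [HasShift T ℤ] [∀ n : ℤ, (shiftFunctor T n).Additive] [Pretriangulated T] :
    TriangleData T where
  susp := shiftFunctor T (1 : ℤ)
  dist _ _ _ f g h := Triangle.mk f g h ∈ distTriang T

namespace TriangleData

variable {C : Type u} [Category.{v} C] [Preadditive C] [HasBinaryBiproducts C]
  (D : TriangleData C)

/-- Auslander-Reiten triangles: distinguished triangles `A ⟶ B ⟶ C ⟶ ΣA` with indecomposable
end terms and non-zero third morphism, such that each morphism to `C` which is not a split
epimorphism factors through `B ⟶ C`. -/
structure IsARTriangle {X Y Z : C} (f : X ⟶ Y) (g : Y ⟶ Z) (h : Z ⟶ D.susp.obj X) : Prop where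
  dist : D.dist f g h
  indecomposable_left : Indecomposable X
  indecomposable_right : Indecomposable Z
  ne_zero : h ≠ 0
  lift : ∀ ⦃W : C⦄ (t : W ⟶ Z), ¬ IsSplitEpi t → ∃ s : W ⟶ Y, s ≫ g = t

/-- Each indecomposable object is the last term and the first term of an AR triangle. -/
def HasARTriangles : Prop :=
  (∀ Z : C, Indecomposable Z → ∃ (X Y : C) (f : X ⟶ Y) (g : Y ⟶ Z) (h : Z ⟶ D.susp.obj X),
    D.IsARTriangle f g h) ∧
  (∀ X : C, Indecomposable X → ∃ (Y Z : C) (f : X ⟶ Y) (g : Y ⟶ Z) (h : Z ⟶ D.susp.obj X),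
    D.IsARTriangle f g h)

end TriangleData

/-! ### Translation quivers -/

/-- A quiver with a translation `τ` on its vertices. The (partial) map `τ` is recorded through
its graph: `translate x y` says that `x = τ y`. -/
structure TranslationQuiver where
  V : Type u
  Arrow : V → V → Type
  translate : V → V → Prop

namespace TranslationQuiver

instance (Γ : TranslationQuiver.{u}) : Quiver Γ.V := ⟨Γ.Arrow⟩

/-- Delete the vertices satisfying `P`, with all arrows into or out of them. -/
def delete (Γ : TranslationQuiver.{u}) (P : Γ.V → Prop) : TranslationQuiver.{u} where
  V := {x : Γ.V // ¬ P x}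
  Arrow x y := Γ.Arrow x.1 y.1
  translate x y := Γ.translate x.1 y.1

/-- Isomorphisms of translation quivers. -/
structure Iso (Γ : TranslationQuiver.{u}) (Δ : TranslationQuiver.{u'}) where
  vertex : Γ.V ≃ Δ.V
  arrow : ∀ x y : Γ.V, Γ.Arrow x y ≃ Δ.Arrow (vertex x) (vertex y)
  translate_iff : ∀ x y : Γ.V, Γ.translate x y ↔ Δ.translate (vertex x) (vertex y)

/-- A polarization: for `z = τ y`, a bijection from the arrows `x ⟶ y` to the arrows
`z ⟶ x`. (There is exactly one when the quiver has no multiple arrows.) -/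
structure Polarization (Γ : TranslationQuiver.{u}) where
  equiv : ∀ {z y : Γ.V}, Γ.translate z y → ∀ x : Γ.V, Γ.Arrow x y ≃ Γ.Arrow z x

variable (k : Type w) [Field k] {Γ : TranslationQuiver.{u}}

/-- The `k`-linear path category of a quiver. -/
abbrev PathCat (Γ : TranslationQuiver.{u}) := Free k (Paths Γ.V)

/-- A vertex as an object of the path category. -/
abbrev PathCat.of (x : Γ.V) : PathCat k Γ := Free.of k ((Paths.of Γ.V).obj x)

/-- The path `z ⟶ x ⟶ y` consisting of the arrows `b` and `a`. -/
def path₂ {z x y : Γ.V} (b : z ⟶ x) (a : x ⟶ y) : PathCat.of k z ⟶ PathCat.of k y :=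
  (Free.embedding k (Paths Γ.V)).map ((Paths.of Γ.V).map b ≫ (Paths.of Γ.V).map a)

/-- The mesh element at a pair `z = τ y`: the sum over all arrows `a : x ⟶ y` of the
paths `z ⟶ x ⟶ y` formed by `σ(a)` and `a`. -/
def Polarization.mesh (p : Γ.Polarization) {z y : Γ.V} (h : Γ.translate z y) :
    PathCat.of k z ⟶ PathCat.of k y :=
  ∑ᶠ a : (Σ x : Γ.V, Γ.Arrow x y), path₂ k (p.equiv h a.1 a.2) a.2

/-- The mesh ideal: the ideal of the path category generated by the mesh elements. -/
def Polarization.meshIdeal (p : Γ.Polarization) : HomIdeal k (PathCat k Γ) :=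
  HomIdeal.generate fun Z Y =>
    {r | ∃ h : Γ.translate (show Γ.V from Z) (show Γ.V from Y), r = p.mesh k h}

/-- The mesh category `k(Γ)`. -/
abbrev Polarization.MeshCat (p : Γ.Polarization) := (p.meshIdeal k).QuotientCat

end TranslationQuiver

section Additive

variable (k : Type w) [Field k] {C : Type u} [Category.{v} C] [Preadditive C] [Linear k C]

/-- The additive closure `Mat_ C` of a `k`-linear category is `k`-linear, entrywise. -/
instance matLinear : Linear k (Mat_ C) where
  homModule M N :=
    { smul := fun r f i j => r • f i j
      one_smul := fun f => by funext i j; exact one_smul k (f i j)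
      mul_smul := fun r s f => by funext i j; exact mul_smul r s (f i j)
      smul_zero := fun r => by funext i j; exact smul_zero (A := (M.X i ⟶ N.X j)) r
      smul_add := fun r f g => by funext i j; exact smul_add r (f i j) (g i j)
      add_smul := fun r s f => by funext i j; exact add_smul r s (f i j)
      zero_smul := fun f => by funext i j; exact zero_smul k (f i j) }
  smul_comp M N K r f g := by
    funext i l
    change ∑ j, (r • f i j) ≫ g j l = r • ∑ j, f i j ≫ g j l
    simp [Finset.smul_sum]
  comp_smul M N K f r g := by
    funext i l
    change ∑ j, f i j ≫ (r • g j l) = r • ∑ j, f i j ≫ g j l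
    simp [Finset.smul_sum]

end Additive

/-! ### The Auslander-Reiten quiver -/

section ARQuiver

variable (k : Type w) [Field k] {C : Type u} [Category.{v} C] [Preadditive C] [Linear k C]
  [HasBinaryBiproducts C]

/-- Isomorphism of indecomposable objects. -/
instance indecSetoid (C : Type u) [Category.{v} C] [Preadditive C] [HasBinaryBiproducts C] :
    Setoid {M : C // Indecomposable M} where
  r M N := Nonempty (M.1 ≅ N.1)
  iseqv := ⟨fun _ => ⟨Iso.refl _⟩, fun ⟨e⟩ => ⟨e.symm⟩, fun ⟨e⟩ ⟨e'⟩ => ⟨e.trans e'⟩⟩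

/-- Isomorphism classes of indecomposable objects. -/
abbrev IndecClass (C : Type u) [Category.{v} C] [Preadditive C] [HasBinaryBiproducts C] : Type u :=
  _root_.Quotient (indecSetoid C)

/-- A representative of an isomorphism class. -/
def IndecClass.rep (x : IndecClass C) : C := (_root_.Quotient.out x).1

/-- The Auslander-Reiten quiver: the vertices are the isomorphism classes of indecomposable
objects, there are `dim Irr(M, N)` arrows from the vertex of `M` to the vertex of `N`, and
`[M] = τ [N]` when there is an AR triangle `M ⟶ E ⟶ N ⟶ ΣM`. -/
def ARQuiver (D : TriangleData C) : TranslationQuiver.{u} where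
  V := IndecClass C
  Arrow x y := Fin (Module.finrank k (Irr k x.rep y.rep))
  translate x y := ∃ (Y : C) (f : x.rep ⟶ Y) (g : Y ⟶ y.rep) (h : y.rep ⟶ D.susp.obj x.rep),
    D.IsARTriangle f g h

/-- The category is standard: it is equivalent, as a `k`-linear category, to `add k(Γ)`, the
additive closure of the mesh category of its AR quiver `Γ`. -/
def IsStandard (D : TriangleData C) : Prop :=
  ∃ (p : (ARQuiver k D).Polarization) (F : C ⥤ Mat_ (p.MeshCat k)),
    F.Additive ∧ F.Linear k ∧ F.IsEquivalence

end ARQuiver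

/-! ### Serre functors -/

/-- A Serre functor: an autoequivalence `S` with isomorphisms `T(A, B) ≅ T(B, SA)^∨` which are
natural in `A` and `B`. -/
structure SerreFunctor (k : Type w) [Field k] (T : Type u) [Category.{v} T] [Preadditive T]
    [Linear k T] where
  S : T ≌ T
  duality : ∀ A B : T, (A ⟶ B) ≃ₗ[k] Module.Dual k (B ⟶ S.functor.obj A)
  natural_left : ∀ {A' A B : T} (a : A' ⟶ A) (f : A ⟶ B) (g : B ⟶ S.functor.obj A'),
    duality A' B (a ≫ f) g = duality A B f (g ≫ S.functor.map a)
  natural_right : ∀ {A B B' : T} (f : A ⟶ B) (b : B ⟶ B') (g : B' ⟶ S.functor.obj A),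
    duality A B' (f ≫ b) g = duality A B f (b ≫ g)

/-- The Auslander-Reiten translation `τ = Σ⁻¹ ∘ S`. -/
def SerreFunctor.translation {k : Type w} [Field k] {T : Type u} [Category.{v} T] [Preadditive T]
    [Linear k T] [HasShift T ℤ] (S : SerreFunctor k T) : T ⥤ T :=
  S.S.functor ⋙ shiftFunctor T (-1 : ℤ)

/-! ### Preenvelopes, precovers and the quotient category `T_X` -/

section Quotient

variable {T : Type u} [Category.{v} T]

/-- `f : M ⟶ N` is an `X`-monomorphism: each morphism from `M` to an object of `X` factors
through `f`. -/
def IsXMono (X : ObjectProperty T) {M N : T} (f : M ⟶ N) : Prop :=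
  ∀ ⦃Z : T⦄, X Z → ∀ g : M ⟶ Z, ∃ g' : N ⟶ Z, f ≫ g' = g

/-- `f : M ⟶ N` is an `X`-epimorphism: each morphism from an object of `X` to `N` factors
through `f`. -/
def IsXEpi (X : ObjectProperty T) {M N : T} (f : M ⟶ N) : Prop :=
  ∀ ⦃Z : T⦄, X Z → ∀ g : Z ⟶ N, ∃ g' : Z ⟶ M, g' ≫ f = g

/-- Each object has an `X`-preenvelope. -/
def IsPreenveloping (X : ObjectProperty T) : Prop :=
  ∀ M : T, ∃ (Z : T) (i : M ⟶ Z), X Z ∧ IsXMono X i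

/-- Each object has an `X`-precover. -/
def IsPrecovering (X : ObjectProperty T) : Prop :=
  ∀ M : T, ∃ (Z : T) (p : Z ⟶ M), X Z ∧ IsXEpi X p

variable [Preadditive T] [HasZeroObject T] [HasShift T ℤ]
  [∀ n : ℤ, (shiftFunctor T n).Additive] [Pretriangulated T]

/-- A choice, for each object `M`, of an `X`-preenvelope `M ⟶ X_M` and of a distinguished
triangle `M ⟶ X_M ⟶ σM ⟶ ΣM`. -/
structure EnvelopeChoice (X : ObjectProperty T) where
  env : T → T
  sigma : T → T
  ι : ∀ M : T, M ⟶ env M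
  π : ∀ M : T, env M ⟶ sigma M
  δ : ∀ M : T, sigma M ⟶ M⟦(1 : ℤ)⟧
  prop_env : ∀ M : T, X (env M)
  isXMono : ∀ M : T, IsXMono X (ι M)
  distinguished : ∀ M : T, Triangle.mk (ι M) (π M) (δ M) ∈ distTriang T

/-- Such choices exist when `X` is preenveloping. -/
lemma EnvelopeChoice.nonempty {X : ObjectProperty T} (hX : IsPreenveloping X) : Nonempty (EnvelopeChoice X) := by
  choose env ι h using hX
  choose σ π δ h' using fun M => distinguished_cocone_triangle (ι M)
  exact ⟨⟨env, σ, ι, π, δ, fun M => (h M).1, fun M => (h M).2, h'⟩⟩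

namespace EnvelopeChoice

variable {X : ObjectProperty T} (E : EnvelopeChoice X)

/-- A morphism `μ : M ⟶ N` extends to a morphism of the chosen triangles. -/
lemma exists_map {M N : T} (μ : M ⟶ N) : ∃ s : E.sigma M ⟶ E.sigma N,
    (∃ ξ : E.env M ⟶ E.env N, E.ι M ≫ ξ = μ ≫ E.ι N ∧ E.π M ≫ s = ξ ≫ E.π N) ∧
    E.δ M ≫ μ⟦(1 : ℤ)⟧' = s ≫ E.δ N := by
  obtain ⟨ξ, hξ⟩ := E.isXMono M (E.prop_env N) (μ ≫ E.ι N)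
  obtain ⟨s, h₁, h₂⟩ := complete_distinguished_triangle_morphism _ _ (E.distinguished M)
    (E.distinguished N) μ ξ hξ
  exact ⟨s, ⟨ξ, hξ, h₁⟩, h₂⟩

/-- The morphism `s : σM ⟶ σN` attached to `μ : M ⟶ N`. -/
def map {M N : T} (μ : M ⟶ N) : E.sigma M ⟶ E.sigma N := (E.exists_map μ).choose

lemma map_δ {M N : T} (μ : M ⟶ N) : E.map μ ≫ E.δ N = E.δ M ≫ μ⟦(1 : ℤ)⟧' :=
  (E.exists_map μ).choose_spec.2.symm

end EnvelopeChoice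

variable (k : Type w) [Field k] [Linear k T]
  (X : ObjectProperty T) [X.IsStableUnderRetracts] [X.IsClosedUnderFiniteCoproducts]

/-- The ideal of morphisms which factor through an object of `X`. -/
def factorIdeal : HomIdeal k T where
  carrier A B :=
    { carrier := {f | ∃ (Z : T) (a : A ⟶ Z) (b : Z ⟶ B), X Z ∧ a ≫ b = f}
      zero_mem' := ⟨⊥_ T, 0, 0, X.prop_initial, by simp⟩
      add_mem' := by
        rintro f g ⟨Z, a, b, hZ, rfl⟩ ⟨Z', a', b', hZ', rfl⟩
        refine ⟨Z ⊞ Z', biprod.lift a a', biprod.desc b b', ?_, by simp⟩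
        exact X.prop_of_iso (biprod.isoCoprod Z Z').symm (X.prop_coprod Z Z' hZ hZ')
      smul_mem' := by
        rintro c f ⟨Z, a, b, hZ, rfl⟩
        exact ⟨Z, c • a, b, hZ, by simp⟩ }
  comp_left := by
    rintro A B D f g ⟨Z, a, b, hZ, rfl⟩
    exact ⟨Z, f ≫ a, b, hZ, by simp⟩
  comp_right := by
    rintro A B D f g ⟨Z, a, b, hZ, rfl⟩
    exact ⟨Z, a, b ≫ g, hZ, by simp⟩

/-- The quotient category `T_X`. -/
abbrev QuotCat := (factorIdeal k X).QuotientCat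

/-- The quotient functor `T ⥤ T_X`. -/
abbrev quot : T ⥤ QuotCat k X := (factorIdeal k X).toQuotient

namespace EnvelopeChoice

variable {X} (E : EnvelopeChoice X)

lemma quot_eq_of_comp_δ {M N : T} {s s' : M ⟶ E.sigma N} (h : s ≫ E.δ N = s' ≫ E.δ N) :
    (quot k X).map s = (quot k X).map s' := by
  refine CategoryTheory.Quotient.sound _ ?_
  obtain ⟨t, ht⟩ := Triangle.coyoneda_exact₃ _ (E.distinguished N) (s - s')
    (show (s - s') ≫ E.δ N = 0 by rw [Preadditive.sub_comp, h, sub_self])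
  exact ⟨E.env N, t, E.π N, E.prop_env N, ht.symm⟩

/-- The functor `T ⥤ T_X` which is `M ↦ σM` on objects and `μ ↦ s` on morphisms. -/
def suspAux : T ⥤ QuotCat k X where
  obj M := (quot k X).obj (E.sigma M)
  map μ := (quot k X).map (E.map μ)
  map_id M := by
    exact (E.quot_eq_of_comp_δ k (s' := 𝟙 _) (by simp [E.map_δ])).trans
      ((quot k X).map_id _)
  map_comp μ ν := by
    exact (E.quot_eq_of_comp_δ k (s' := E.map μ ≫ E.map ν) (by
      rw [E.map_δ, Category.assoc, E.map_δ, ← Category.assoc, E.map_δ]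
      simp)).trans ((quot k X).map_comp _ _)

/-- The endofunctor `σ` of `T_X`. -/
def susp : QuotCat k X ⥤ QuotCat k X :=
  CategoryTheory.Quotient.lift _ (E.suspAux k) (by
    rintro M N μ μ' ⟨Z, a, b, hZ, hab⟩
    refine E.quot_eq_of_comp_δ k ?_
    rw [E.map_δ, E.map_δ, ← sub_eq_zero, ← Preadditive.comp_sub, ← Functor.map_sub, ← hab]
    obtain ⟨a', rfl⟩ := E.isXMono M hZ a
    have h0 : E.δ M ≫ (E.ι M)⟦(1 : ℤ)⟧' = 0 :=
      comp_distTriang_mor_zero₃₁ _ (E.distinguished M)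
    rw [Category.assoc, Functor.map_comp, ← Category.assoc, h0, zero_comp])

/-- The distinguished triangles of `T_X`: up to isomorphism, the diagrams
`M ⟶ N ⟶ P ⟶ σM` given by the classes of `μ`, `ν` and `ϖ`, where `μ` is an `X`-monomorphism,
`M ⟶ N ⟶ P ⟶ ΣM` is a distinguished triangle of `T`, and `(1, n, ϖ)` is a morphism from it to the
chosen triangle `M ⟶ X_M ⟶ σM ⟶ ΣM`. -/
def IsDist ⦃A B C : QuotCat k X⦄ (f : A ⟶ B) (g : B ⟶ C) (h : C ⟶ (E.susp k).obj A) : Prop :=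
  ∃ (M N P : T) (μ : M ⟶ N) (ν : N ⟶ P) (d : P ⟶ M⟦(1 : ℤ)⟧) (n : N ⟶ E.env M)
    (ϖ : P ⟶ E.sigma M),
    IsXMono X μ ∧ Triangle.mk μ ν d ∈ distTriang T ∧
    μ ≫ n = E.ι M ∧ ν ≫ ϖ = n ≫ E.π M ∧ ϖ ≫ E.δ M = d ∧
    ∃ (eA : A ≅ (quot k X).obj M) (eB : B ≅ (quot k X).obj N) (eC : C ≅ (quot k X).obj P),
      f ≫ eB.hom = eA.hom ≫ (quot k X).map μ ∧
      g ≫ eC.hom = eB.hom ≫ (quot k X).map ν ∧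
      h ≫ (E.susp k).map eA.hom =
        eC.hom ≫ (show (quot k X).obj P ⟶ (E.susp k).obj ((quot k X).obj M) from
          (quot k X).map ϖ)

/-- The suspension and the distinguished triangles of `T_X`. -/
def quotData : TriangleData (QuotCat k X) where
  susp := E.susp k
  dist := E.IsDist k

end EnvelopeChoice

end Quotient

end ARQuot

end

/-!
# Auslander–Reiten theory of a quotient of a triangulated category

*The role of `τX = X`.* For a distinguished triangle `M ⟶ N ⟶ P ⟶ ΣM`, Serre duality shows that
`M ⟶ N` is an `X`-monomorphism if and only if `N ⟶ P` is an `X`-epimorphism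
(`SerreFunctor.isXMono_iff_isXEpi`). So the morphisms `X_M ⟶ σM` are `X`-precovers. It follows
that `σ` is full and faithful, and, starting from precovers, that it is essentially surjective
(`EnvelopeChoice.susp_isEquivalence`). The full structure of a triangulated category on the quotient
is not needed: the comparison of AR triangles only uses that the third morphism of a distinguished
triangle is a weak cokernel of the second one (`TriangleData.IsWeaklyExact`).

*AR triangles.* Indecomposable objects of `T` have local endomorphism rings. An AR triangle of `T`
ending at `Z` is obtained from a linear form on `End Z` which vanishes on the radical
(`SerreFunctor.exists_isARTriangle`); its first term is `τZ`. If the end terms are not in `X`, its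
first morphism is an `X`-monomorphism, being left almost split, and the triangle induces an AR
triangle of the quotient (`EnvelopeChoice.isARPair_quot`). Since `τX = X`, and since the first term
of an AR triangle is determined by the last one, all AR triangles of the quotient arise in this way
(`EnvelopeChoice.isARPair_quot_iff`). A morphism between indecomposable objects outside `X` which
factors through `X` lies in `rad²`, so the numbers of arrows do not change (`finrank_irr_quot`).

*Standardness.* That `T` is standard is restated as the existence of a presentation: a full linear
functor `G` from the path category to `T`, with kernel the mesh ideal, whose values on vertices
generate `T` under finite biproducts (`IsPresentation`). The equivalence with `add k(Γ)` is an
abstract one, so `G` may permute the vertices of the AR quiver; this is why the quiver has to be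
recovered from `G`. The mesh ideal is homogeneous, so in a Hom-finite category long paths vanish,
and the radical and its square are spanned by the paths of length at least `1` and at least `2`.
Hence the vertices give the indecomposable objects up to isomorphism, and the arrows have the
expected multiplicities. Meshes give AR triangles: if some arrow ends at `y`, the relation `τy = z`
in the quiver means that there is an AR triangle from `G z` to `G y`
(`IsPresentation.isARPair_of_translate`). If no arrow ends at `y`, the mesh at `y` is zero and the
translation there does not matter. So the AR quiver of the quotient embeds into that of `T` as the
full subquiver of those vertices whose image under `G` is not in `X` (`exists_fullEmbedding`), and the
polarization restricts to it.

It remains to compare the mesh ideals. A morphism between vertices factors through `X` if and only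
if it is a combination of paths through vertices in `X` (`IsPresentation.factorsThrough_map_iff`).
Paths inside the subquiver are linearly independent modulo paths which leave it, and modulo the
latter each mesh element of `Γ` between vertices of the subquiver is the mesh element of the
subquiver. Hence the mesh ideal of the subquiver is the preimage of the sum of the mesh ideal of `Γ`
and of the ideal of paths leaving the subquiver (`FullEmbedding.mem_meshIdeal_iff`), which is the
kernel of the composite functor to the quotient category (`IsPresentation.quot`).
-/

noncomputable section

namespace ARQuot

universe w v u v' u'

/-! ### Objects with local endomorphism ring and the radical -/

section LocalObjects

variable {C : Type u} [Category.{v} C]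

lemma isSplitMono_of_isIso_comp {A B D : C} (f : A ⟶ B) (g : B ⟶ D) [IsIso (f ≫ g)] :
    IsSplitMono f :=
  ⟨⟨⟨g ≫ inv (f ≫ g), by rw [← Category.assoc, IsIso.hom_inv_id]⟩⟩⟩

lemma isSplitEpi_of_isIso_comp {A B D : C} (f : A ⟶ B) (g : B ⟶ D) [IsIso (f ≫ g)] :
    IsSplitEpi g :=
  ⟨⟨⟨inv (f ≫ g) ≫ f, by rw [Category.assoc, IsIso.inv_hom_id]⟩⟩⟩

variable [Preadditive C]

/-- An object with local endomorphism ring. -/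
structure IsLocalObj (A : C) : Prop where
  id_ne_zero : 𝟙 A ≠ 0
  isIso_or : ∀ f : A ⟶ A, IsIso f ∨ IsIso (𝟙 A - f)

/-- In a local ring the only idempotents are `0` and `1`. -/
lemma IsLocalObj.eq_zero_or_eq_id {A : C} (hA : IsLocalObj A) (e : A ⟶ A) (he : e ≫ e = e) :
    e = 0 ∨ e = 𝟙 A := by
  rcases hA.isIso_or e with h | h
  · right
    rw [← cancel_epi e, he, Category.comp_id]
  · left
    rw [← cancel_epi (𝟙 A - e), comp_zero, Preadditive.sub_comp, Category.id_comp, he, sub_self]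

lemma IsLocalObj.of_iso {A B : C} (e : A ≅ B) (hA : IsLocalObj A) : IsLocalObj B where
  id_ne_zero h := hA.id_ne_zero (by
    rw [← e.hom_inv_id, ← Category.comp_id e.hom, h, comp_zero, zero_comp])
  isIso_or f := by
    rcases hA.isIso_or (e.hom ≫ f ≫ e.inv) with h | h
    · left
      have : f = e.inv ≫ (e.hom ≫ f ≫ e.inv) ≫ e.hom := by simp
      rw [this]
      infer_instance
    · right
      have : 𝟙 B - f = e.inv ≫ (𝟙 A - e.hom ≫ f ≫ e.inv) ≫ e.hom := by simp
      rw [this]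
      infer_instance

lemma IsLocalObj.indecomposable [HasBinaryBiproducts C] {A : C} (hA : IsLocalObj A) :
    Indecomposable A := by
  refine ⟨fun h => hA.id_ne_zero (h.eq_of_src _ _), fun Y Z i => ?_⟩
  have hYZ := hA.of_iso i
  rcases hYZ.eq_zero_or_eq_id (biprod.fst ≫ biprod.inl) (by simp) with h | h
  · left
    rw [IsZero.iff_id_eq_zero]
    have := congrArg (fun t => biprod.inl ≫ t ≫ biprod.fst) h
    simpa using this
  · right
    rw [IsZero.iff_id_eq_zero]
    have := congrArg (fun t => biprod.inr ≫ t ≫ biprod.snd) h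
    simpa using this.symm

lemma IsLocalObj.isIso_of_isSplitMono {A B : C} (hA : IsLocalObj A) (hB : IsLocalObj B)
    (f : A ⟶ B) [IsSplitMono f] : IsIso f := by
  rcases hB.eq_zero_or_eq_id (retraction f ≫ f) (by simp) with h | h
  · refine absurd ?_ hA.id_ne_zero
    have := congrArg (fun t => f ≫ t ≫ retraction f) h
    simpa using this
  · exact ⟨retraction f, by simp, h⟩

lemma IsLocalObj.isIso_of_isSplitEpi {A B : C} (hA : IsLocalObj A) (hB : IsLocalObj B)
    (f : A ⟶ B) [IsSplitEpi f] : IsIso f := by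
  have := hB.isIso_of_isSplitMono hA (section_ f)
  have h : f = inv (section_ f) := by
    rw [← cancel_epi (section_ f), IsIso.hom_inv_id, IsSplitEpi.id]
  rw [h]
  infer_instance

/-- `1 - f` is invertible when `f` is nilpotent. -/
lemma isIso_one_sub_of_isNilpotent {A : C} (f : A ⟶ A)
    (hf : IsNilpotent (R := End A) f) : IsIso (𝟙 A - f) :=
  (isUnit_iff_isIso _).1 hf.isUnit_one_sub

variable (k : Type w) [Field k] [Linear k C]

lemma rad_comp_right {A B D : C} {f : A ⟶ B} (hf : f ∈ rad k A B) (g : B ⟶ D) :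
    f ≫ g ∈ rad k A D := fun t => by
  rw [Category.assoc]
  exact hf _

lemma rad_comp_left {A B D : C} (f : A ⟶ B) {g : B ⟶ D} (hg : g ∈ rad k B D) :
    f ≫ g ∈ rad k A D := fun t => by
  rw [Category.assoc]
  refine isIso_one_sub_comm _ _ ?_
  rw [Category.assoc]
  exact hg _

lemma comp_mem_radSq {A B D : C} {f : A ⟶ B} {g : B ⟶ D} (hf : f ∈ rad k A B)
    (hg : g ∈ rad k B D) : f ≫ g ∈ radSq k A D :=
  Submodule.subset_span ⟨B, f, g, hf, hg, rfl⟩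

lemma radSq_comp_right {A B D : C} {f : A ⟶ B} (hf : f ∈ radSq k A B) (g : B ⟶ D) :
    f ≫ g ∈ radSq k A D := by
  induction hf using Submodule.span_induction with
  | mem x hx =>
    obtain ⟨E, a, b, ha, hb, rfl⟩ := hx
    rw [Category.assoc]
    exact comp_mem_radSq k ha (rad_comp_right k hb g)
  | zero => simp
  | add x y _ _ hx hy => rw [Preadditive.add_comp]; exact Submodule.add_mem _ hx hy
  | smul c x _ hx => rw [Linear.smul_comp]; exact Submodule.smul_mem _ _ hx

lemma radSq_comp_left {A B D : C} (f : A ⟶ B) {g : B ⟶ D} (hg : g ∈ radSq k B D) :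
    f ≫ g ∈ radSq k A D := by
  induction hg using Submodule.span_induction with
  | mem x hx =>
    obtain ⟨E, a, b, ha, hb, rfl⟩ := hx
    rw [← Category.assoc]
    exact comp_mem_radSq k (rad_comp_left k f ha) hb
  | zero => simp
  | add x y _ _ hx hy => rw [Preadditive.comp_add]; exact Submodule.add_mem _ hx hy
  | smul c x _ hx => rw [Linear.comp_smul]; exact Submodule.smul_mem _ _ hx

variable {k}

lemma IsLocalObj.not_isIso_of_mem_rad {A : C} (hA : IsLocalObj A) {f : A ⟶ A}
    (hf : f ∈ rad k A A) : ¬ IsIso f := fun h => hA.id_ne_zero (by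
  have := hf (inv f)
  rw [IsIso.hom_inv_id, sub_self] at this
  rw [← cancel_epi (0 : A ⟶ A), zero_comp, zero_comp])

lemma IsLocalObj.mem_rad_iff_not_isSplitMono {A B : C} (hA : IsLocalObj A) {f : A ⟶ B} :
    f ∈ rad k A B ↔ ¬ IsSplitMono f := by
  refine ⟨fun hf h => ?_, fun h g => ?_⟩
  · refine hA.not_isIso_of_mem_rad (rad_comp_right k hf (retraction f)) ?_
    rw [IsSplitMono.id]
    infer_instance
  · rcases hA.isIso_or (f ≫ g) with h' | h'
    · exact absurd (isSplitMono_of_isIso_comp f g) h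
    · exact h'

lemma IsLocalObj.mem_rad_iff_not_isSplitEpi {A B : C} (hB : IsLocalObj B) {f : A ⟶ B} :
    f ∈ rad k A B ↔ ¬ IsSplitEpi f := by
  refine ⟨fun hf h => ?_, fun h g => ?_⟩
  · refine hB.not_isIso_of_mem_rad (rad_comp_left k (section_ f) hf) ?_
    rw [IsSplitEpi.id]
    infer_instance
  · rcases hB.isIso_or (g ≫ f) with h' | h'
    · exact absurd (isSplitEpi_of_isIso_comp g f) h
    · exact isIso_one_sub_comm _ _ h'

end LocalObjects

section Irr

variable (k : Type w) [Field k] {C : Type u} [Category.{v} C] [Preadditive C] [Linear k C]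
  {D : Type u'} [Category.{v'} D] [Preadditive D] [Linear k D]

/-- A surjective linear map which detects `rad` and `rad²` identifies the spaces `Irr`. -/
lemma finrank_irr_eq_of_surjective {A B : C} {A' B' : D} (φ : (A ⟶ B) →ₗ[k] (A' ⟶ B'))
    (hφ : Function.Surjective φ) (h₁ : ∀ f, φ f ∈ rad k A' B' ↔ f ∈ rad k A B)
    (h₂ : ∀ f, φ f ∈ radSq k A' B' ↔ f ∈ radSq k A B) :
    Module.finrank k (Irr k A B) = Module.finrank k (Irr k A' B') := by
  let ψ : rad k A B →ₗ[k] Irr k A' B' :=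
    (Submodule.mkQ _).comp (φ.restrict fun f hf => (h₁ f).2 hf)
  have hψ : Function.Surjective ψ := by
    intro x
    obtain ⟨⟨f', hf'⟩, rfl⟩ := Submodule.mkQ_surjective _ x
    obtain ⟨f, rfl⟩ := hφ f'
    exact ⟨⟨f, (h₁ f).1 hf'⟩, rfl⟩
  have hk : (radSq k A B).submoduleOf (rad k A B) = LinearMap.ker ψ := by
    ext ⟨f, hf⟩
    rw [LinearMap.mem_ker, LinearMap.comp_apply, Submodule.mkQ_apply,
      Submodule.Quotient.mk_eq_zero]
    exact (h₂ f).symm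
  exact ((Submodule.quotEquivOfEq _ _ hk).trans
    (ψ.quotKerEquivOfSurjective hψ)).finrank_eq

lemma finrank_irr_congr {A B A' B' : C} (e : A ≅ A') (e' : B ≅ B') :
    Module.finrank k (Irr k A B) = Module.finrank k (Irr k A' B') := by
  refine finrank_irr_eq_of_surjective k
    ((Linear.leftComp k B' e.inv).comp (Linear.rightComp k A e'.hom))
    (fun f => ⟨e.hom ≫ f ≫ e'.inv, by simp⟩) (fun f => ⟨fun h => ?_, fun h => ?_⟩)
    (fun f => ⟨fun h => ?_, fun h => ?_⟩)
  · have := rad_comp_left k e.hom (rad_comp_right k h e'.inv)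
    simpa using this
  · exact rad_comp_left k e.inv (rad_comp_right k h e'.hom)
  · have := radSq_comp_left k e.hom (radSq_comp_right k h e'.inv)
    simpa using this
  · exact radSq_comp_left k e.inv (radSq_comp_right k h e'.hom)

end Irr

/-! ### Krull–Schmidt categories -/

section Fitting

open Polynomial

/-- An element of a finite-dimensional algebra without non-trivial idempotents is nilpotent or
invertible. -/
lemma isNilpotent_or_isUnit {k : Type w} [Field k] {R : Type v} [Ring R] [Algebra k R]
    [Module.Finite k R] (hR : ∀ e : R, e * e = e → e = 0 ∨ e = 1) (f : R) :
    IsNilpotent f ∨ IsUnit f := by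
  -- the minimal polynomial is `X ^ n * q` with `q` prime to `X`
  obtain ⟨q, hq, hX⟩ := (minpoly k f).exists_eq_pow_rootMultiplicity_mul_and_not_dvd
    (minpoly.ne_zero (Algebra.IsIntegral.isIntegral f)) 0
  set n := (minpoly k f).rootMultiplicity 0
  rw [C_0, sub_zero] at hq hX
  have hcop : IsCoprime (X ^ (n + 1)) q :=
    (((irreducible_X (R := k)).coprime_iff_not_dvd).2 hX).pow_left
  obtain ⟨a, b, hab⟩ := hcop
  have h0 : f ^ n * aeval f q = 0 := by
    have := congrArg (aeval f) hq
    rw [minpoly.aeval, map_mul, map_pow, aeval_X] at this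
    exact this.symm
  have hab' : aeval f a * f ^ (n + 1) + aeval f b * aeval f q = 1 := by
    have := congrArg (aeval f) hab
    simpa using this
  have hcomm : ∀ p q : k[X], aeval f p * aeval f q = aeval f q * aeval f p := fun p q => by
    rw [← map_mul, mul_comm, map_mul]
  have hpow : ∀ (m : ℕ) (p : k[X]), f ^ m * aeval f p = aeval f p * f ^ m := fun m p => by
    simpa using hcomm (X ^ m) p
  -- the idempotent which projects onto the part where `f` is invertible
  set e := aeval f a * f ^ (n + 1) with he
  have hbq : aeval f b * aeval f q = 1 - e := by
    rw [← hab']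
    abel
  have hee : e * (1 - e) = 0 := by
    rw [← hbq, he, hcomm b q, mul_assoc, ← mul_assoc (f ^ (n + 1)), pow_succ', mul_assoc f, h0,
      mul_zero, zero_mul, mul_zero]
  rcases hR e (by rw [mul_sub, mul_one, sub_eq_zero] at hee; exact hee.symm) with h | h
  · left
    refine ⟨n, ?_⟩
    rw [← mul_one (f ^ n), ← hab', h, zero_add, hcomm b q, ← mul_assoc, h0, zero_mul]
  · right
    rw [isUnit_iff_exists]
    refine ⟨aeval f a * f ^ n, ?_, ?_⟩
    · have := hpow 1 a
      rw [pow_one] at this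
      rw [← mul_assoc, this, mul_assoc, ← pow_succ', ← he, h]
    · rw [mul_assoc, ← pow_succ, ← he, h]

end Fitting

section KrullSchmidt

variable {C : Type u} [Category.{v} C] [Preadditive C]

/-- An endomorphism ring which is finite-dimensional and without non-trivial idempotents
is local. -/
lemma isLocalObj_of_idempotents (k : Type w) [Field k] [Linear k C]
    [∀ A B : C, Module.Finite k (A ⟶ B)] {A : C} (hA : 𝟙 A ≠ 0)
    (h : ∀ e : A ⟶ A, e ≫ e = e → e = 0 ∨ e = 𝟙 A) : IsLocalObj A where
  id_ne_zero := hA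
  isIso_or f := by
    have : Module.Finite k (End A) := inferInstanceAs (Module.Finite k (A ⟶ A))
    rcases isNilpotent_or_isUnit (k := k) (R := End A) h f with h | h
    · exact Or.inr (isIso_one_sub_of_isNilpotent f h)
    · exact Or.inl ((isUnit_iff_isIso _).1 h)

variable [HasBinaryBiproducts C]

lemma _root_.CategoryTheory.Indecomposable.isLocalObj (k : Type w) [Field k] [Linear k C]
    [∀ A B : C, Module.Finite k (A ⟶ B)] [IsIdempotentComplete C] {A : C}
    (hA : Indecomposable A) : IsLocalObj A := by
  refine isLocalObj_of_idempotents k (fun h => hA.1 ((IsZero.iff_id_eq_zero _).2 h)) fun e he => ?_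
  obtain ⟨Y, i, r, hir, hri⟩ := IsIdempotentComplete.idempotents_split A e he
  obtain ⟨Z, j, s, hjs, hsj⟩ := IsIdempotentComplete.idempotents_split A (𝟙 A - e)
    (Idempotents.idem_of_id_sub_idem e he)
  have his : i ≫ s = 0 := by
    have h : i ≫ s = (i ≫ r) ≫ i ≫ s ≫ j ≫ s := by simp [hir, hjs]
    rw [h, Category.assoc, reassoc_of% hri, reassoc_of% hsj]
    simp [reassoc_of% he]
  have hjr : j ≫ r = 0 := by
    have h : j ≫ r = (j ≫ s) ≫ j ≫ r ≫ i ≫ r := by simp [hir, hjs]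
    rw [h, Category.assoc, reassoc_of% hsj, reassoc_of% hri]
    simp [reassoc_of% he]
  rcases hA.2 Y Z
    { hom := biprod.lift r s
      inv := biprod.desc i j
      hom_inv_id := by rw [biprod.lift_desc, hri, hsj]; abel
      inv_hom_id := by ext <;> simp [hir, hjs, his, hjr] } with h | h
  · left
    rw [← hri, h.eq_of_tgt r 0, zero_comp]
  · right
    rw [h.eq_of_tgt s 0, zero_comp] at hsj
    exact (sub_eq_zero.1 hsj.symm).symm

/-- Every object of a Hom-finite category is a finite biproduct of indecomposable objects, in
the form of an induction principle. -/
lemma induction_indecomposable (k : Type w) [Field k] [Linear k C]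
    [∀ A B : C, Module.Finite k (A ⟶ B)] {P : C → Prop} (hiso : ∀ {A B : C}, (A ≅ B) → P A → P B)
    (hzero : ∀ A : C, IsZero A → P A) (hind : ∀ A : C, Indecomposable A → P A)
    (hbiprod : ∀ A B : C, P A → P B → P (A ⊞ B)) (A : C) : P A := by
  -- in a decomposition `A ≅ Y ⊞ Z`, the dimensions of `End Y` and `End Z` are smaller
  induction hn : Module.finrank k (A ⟶ A) using Nat.strong_induction_on generalizing A with
  | _ n ih =>
  by_cases h0 : IsZero A
  · exact hzero A h0
  by_cases h1 : Indecomposable A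
  · exact hind A h1
  have h2 : ¬ ∀ Y Z, (A ≅ Y ⊞ Z) → IsZero Y ∨ IsZero Z := fun h => h1 ⟨h0, h⟩
  push Not at h2
  obtain ⟨Y, Z, e, hY, hZ⟩ := h2
  let φ : ((Y ⟶ Y) × (Z ⟶ Z)) →ₗ[k] (A ⟶ A) :=
    { toFun := fun f => e.hom ≫ biprod.map f.1 f.2 ≫ e.inv
      map_add' := fun f g => by
        have : biprod.map (f.1 + g.1) (f.2 + g.2) = biprod.map f.1 f.2 + biprod.map g.1 g.2 := by
          ext <;> simp
        simp [this]
      map_smul' := fun c f => by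
        have : biprod.map (c • f.1) (c • f.2) = c • biprod.map f.1 f.2 := by
          ext <;> simp
        simp [this] }
  have hφ : Function.Injective φ := by
    rintro ⟨f, f'⟩ ⟨g, g'⟩ h
    have h' : biprod.map f f' = biprod.map g g' := by
      have : e.hom ≫ biprod.map f f' ≫ e.inv = e.hom ≫ biprod.map g g' ≫ e.inv := h
      rwa [cancel_epi, cancel_mono] at this
    refine Prod.ext ?_ ?_
    · simpa using congrArg (fun t => biprod.inl ≫ t ≫ biprod.fst) h'
    · simpa using congrArg (fun t => biprod.inr ≫ t ≫ biprod.snd) h'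
  have hle := LinearMap.finrank_le_finrank_of_injective hφ
  rw [Module.finrank_prod] at hle
  have hpos : ∀ B : C, ¬ IsZero B → 0 < Module.finrank k (B ⟶ B) := fun B hB =>
    Module.finrank_pos_iff_exists_ne_zero.2
      ⟨𝟙 B, fun h => hB ((IsZero.iff_id_eq_zero _).2 h)⟩
  have h3 := hpos Y hY
  have h4 := hpos Z hZ
  exact hiso e.symm (hbiprod Y Z (ih _ (by omega) Y rfl) (ih _ (by omega) Z rfl))

/-- Up to isomorphism, an object has only finitely many indecomposable retracts. -/
lemma finite_retracts (k : Type w) [Field k] [Linear k C]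
    [∀ A B : C, Module.Finite k (A ⟶ B)] [IsIdempotentComplete C] (B : C) :
    {x : IndecClass C | ∃ (i : x.rep ⟶ B) (r : B ⟶ x.rep), i ≫ r = 𝟙 _}.Finite := by
  have hloc : ∀ x : IndecClass C, IsLocalObj x.rep := fun x =>
    (_root_.Quotient.out x).2.isLocalObj k
  refine induction_indecomposable k
    (P := fun B => {x : IndecClass C | ∃ (i : x.rep ⟶ B) (r : B ⟶ x.rep), i ≫ r = 𝟙 _}.Finite)
    ?_ ?_ ?_ ?_ B
  · rintro A B e h
    refine h.subset ?_
    rintro x ⟨i, r, hir⟩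
    exact ⟨i ≫ e.inv, e.hom ≫ r, by simpa using hir⟩
  · intro A hA
    convert Set.finite_empty
    rw [Set.eq_empty_iff_forall_notMem]
    rintro x ⟨i, r, hir⟩
    exact (hloc x).id_ne_zero (by rw [← hir, hA.eq_of_tgt i 0, zero_comp])
  · intro A hA
    refine Set.Subsingleton.finite ?_
    have key : ∀ x : IndecClass C, (∃ (i : x.rep ⟶ A) (r : A ⟶ x.rep), i ≫ r = 𝟙 _) →
        x = _root_.Quotient.mk _ ⟨A, hA⟩ := by
      rintro x ⟨i, r, hir⟩
      have : IsSplitMono i := ⟨⟨⟨r, hir⟩⟩⟩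
      have hi := (hloc x).isIso_of_isSplitMono (hA.isLocalObj k) i
      rw [← Quotient.out_eq x]
      exact Quotient.sound ⟨@asIso _ _ _ _ i hi⟩
    intro x hx y hy
    rw [key x hx, key y hy]
  · intro A B hA hB
    refine (hA.union hB).subset ?_
    rintro x ⟨i, r, hir⟩
    have h : 𝟙 x.rep = (i ≫ biprod.fst) ≫ (biprod.inl ≫ r) + (i ≫ biprod.snd) ≫ biprod.inr ≫ r := by
      rw [← hir]
      calc i ≫ r = i ≫ (biprod.fst ≫ biprod.inl + biprod.snd ≫ biprod.inr) ≫ r := by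
            rw [biprod.total, Category.id_comp]
        _ = _ := by
            simp only [Preadditive.add_comp, Preadditive.comp_add, Category.assoc]
    rcases (hloc x).isIso_or ((i ≫ biprod.fst) ≫ (biprod.inl ≫ r)) with h' | h'
    · left
      exact ⟨i ≫ biprod.fst, (biprod.inl ≫ r) ≫ inv ((i ≫ biprod.fst) ≫ (biprod.inl ≫ r)), by
        rw [← Category.assoc, IsIso.hom_inv_id]⟩
    · right
      rw [h, add_sub_cancel_left] at h'
      exact ⟨i ≫ biprod.snd, (biprod.inr ≫ r) ≫ inv ((i ≫ biprod.snd) ≫ (biprod.inr ≫ r)), by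
        rw [← Category.assoc, IsIso.hom_inv_id]⟩

end KrullSchmidt

/-! ### Auslander–Reiten triangles -/

section ARTriangles

/-- The few properties of distinguished triangles which control Auslander–Reiten triangles: the
suspension is full and additive, distinguished triangles are stable under isomorphisms of the end
terms, and the third morphism of a distinguished triangle is a weak cokernel of the second one. -/
structure TriangleData.IsWeaklyExact {C : Type u} [Category.{v} C] [Preadditive C]
    (D : TriangleData C) : Prop where
  full : D.susp.Full
  additive : D.susp.Additive
  dist_iso : ∀ {X X' Y Z Z' : C} {f : X ⟶ Y} {g : Y ⟶ Z} {h : Z ⟶ D.susp.obj X}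
    (e : X ≅ X') (e' : Z ≅ Z'), D.dist f g h →
      D.dist (e.inv ≫ f) (g ≫ e'.hom) (e'.inv ≫ h ≫ D.susp.map e.hom)
  comp_zero : ∀ {X Y Z : C} {f : X ⟶ Y} {g : Y ⟶ Z} {h : Z ⟶ D.susp.obj X},
    D.dist f g h → g ≫ h = 0
  weakCokernel : ∀ {X Y Z : C} {f : X ⟶ Y} {g : Y ⟶ Z} {h : Z ⟶ D.susp.obj X},
    D.dist f g h → ∀ {W : C} (t : Z ⟶ W), g ≫ t = 0 → ∃ s : D.susp.obj X ⟶ W, h ≫ s = t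

namespace TriangleData

variable {C : Type u} [Category.{v} C] [Preadditive C] [HasBinaryBiproducts C]
  {D : TriangleData C}

lemma _root_.CategoryTheory.Indecomposable.of_iso {A B : C} (e : A ≅ B) (hA : Indecomposable A) :
    Indecomposable B :=
  ⟨fun h => hA.1 (h.of_iso e), fun Y Z i => hA.2 Y Z (e.trans i)⟩

lemma IsARTriangle.of_iso (hD : D.IsWeaklyExact) {X X' Y Z Z' : C} {f : X ⟶ Y} {g : Y ⟶ Z}
    {h : Z ⟶ D.susp.obj X} (H : D.IsARTriangle f g h) (e : X ≅ X') (e' : Z ≅ Z') :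
    D.IsARTriangle (e.inv ≫ f) (g ≫ e'.hom) (e'.inv ≫ h ≫ D.susp.map e.hom) where
  dist := hD.dist_iso e e' H.dist
  indecomposable_left := H.indecomposable_left.of_iso e
  indecomposable_right := H.indecomposable_right.of_iso e'
  ne_zero h0 := H.ne_zero (by
    rw [← cancel_epi e'.inv, ← cancel_mono (D.susp.map e.hom), Category.assoc, h0]
    simp)
  lift W t ht := by
    obtain ⟨s, hs⟩ := H.lift (t ≫ e'.inv) (fun h => ht (by
      have : t = (t ≫ e'.inv) ≫ e'.hom := by simp
      rw [this]
      infer_instance))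
    exact ⟨s, by rw [← Category.assoc, hs, Category.assoc, e'.inv_hom_id, Category.comp_id]⟩

lemma IsARTriangle.not_isSplitEpi (hD : D.IsWeaklyExact) {X Y Z : C} {f : X ⟶ Y} {g : Y ⟶ Z}
    {h : Z ⟶ D.susp.obj X} (H : D.IsARTriangle f g h) : ¬ IsSplitEpi g := fun _ =>
  H.ne_zero (by rw [← cancel_epi g, hD.comp_zero H.dist, comp_zero])

/-- The third morphisms of two AR triangles with the same last term factor through each other. -/
lemma IsARTriangle.exists_comp_susp_map (hD : D.IsWeaklyExact) {X Y X' Y' Z : C} {f : X ⟶ Y}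
    {g : Y ⟶ Z} {h : Z ⟶ D.susp.obj X} (H : D.IsARTriangle f g h) {f' : X' ⟶ Y'} {g' : Y' ⟶ Z}
    {h' : Z ⟶ D.susp.obj X'} (H' : D.IsARTriangle f' g' h') :
    ∃ a : X ⟶ X', h ≫ D.susp.map a = h' := by
  obtain ⟨s, hs⟩ := H'.lift g (H.not_isSplitEpi hD)
  obtain ⟨t, ht⟩ := hD.weakCokernel H.dist h' (by
    rw [← hs, Category.assoc, hD.comp_zero H'.dist, comp_zero])
  have := hD.full
  obtain ⟨a, rfl⟩ := D.susp.map_surjective t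
  exact ⟨a, ht⟩

/-- The first term of an AR triangle is determined by the last one. -/
lemma IsARTriangle.nonempty_iso (hD : D.IsWeaklyExact) {X Y X' Y' Z : C} {f : X ⟶ Y}
    {g : Y ⟶ Z} {h : Z ⟶ D.susp.obj X} (H : D.IsARTriangle f g h) {f' : X' ⟶ Y'} {g' : Y' ⟶ Z}
    {h' : Z ⟶ D.susp.obj X'} (H' : D.IsARTriangle f' g' h') (hX : IsLocalObj X)
    (hX' : IsLocalObj X') : Nonempty (X ≅ X') := by
  obtain ⟨a, ha⟩ := H.exists_comp_susp_map hD H'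
  obtain ⟨b, hb⟩ := H'.exists_comp_susp_map hD H
  have := hD.additive
  have h1 : IsIso (a ≫ b) := by
    refine (hX.isIso_or (a ≫ b)).resolve_right fun h2 => H.ne_zero ?_
    rw [← cancel_mono (D.susp.map (𝟙 X - a ≫ b)), zero_comp, Functor.map_sub,
      Preadditive.comp_sub, Functor.map_comp, reassoc_of% ha, hb]
    simp
  have := isSplitMono_of_isIso_comp a b
  have := hX.isIso_of_isSplitMono hX' a
  exact ⟨asIso a⟩

end TriangleData

lemma SerreFunctor.eq_zero_of_duality {k : Type w} [Field k] {C : Type u} [Category.{v} C]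
    [Preadditive C] [Linear k C] (S : SerreFunctor k C) {A B : C}
    (x : B ⟶ S.S.functor.obj A) (h : ∀ f : A ⟶ B, S.duality A B f x = 0) : x = 0 := by
  rw [← Module.forall_dual_apply_eq_zero_iff k]
  intro φ
  obtain ⟨f, rfl⟩ := (S.duality A B).surjective φ
  exact h f

variable {T : Type u} [Category.{v} T] [Preadditive T] [HasZeroObject T] [HasShift T ℤ]
  [∀ n : ℤ, (shiftFunctor T n).Additive] [Pretriangulated T]

section Distinguished

variable {X Y Z W : T} {f : X ⟶ Y} {g : Y ⟶ Z} {h : Z ⟶ X⟦(1 : ℤ)⟧}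

lemma comp_eq_zero₁₂ (H : Triangle.mk f g h ∈ distTriang T) : f ≫ g = 0 :=
  comp_distTriang_mor_zero₁₂ _ H

lemma comp_eq_zero₂₃ (H : Triangle.mk f g h ∈ distTriang T) : g ≫ h = 0 :=
  comp_distTriang_mor_zero₂₃ _ H

lemma comp_eq_zero₃₁ (H : Triangle.mk f g h ∈ distTriang T) : h ≫ f⟦(1 : ℤ)⟧' = 0 :=
  comp_distTriang_mor_zero₃₁ _ H

lemma exists_lift₁ (H : Triangle.mk f g h ∈ distTriang T) (t : W ⟶ X⟦(1 : ℤ)⟧)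
    (ht : t ≫ f⟦(1 : ℤ)⟧' = 0) : ∃ s : W ⟶ Z, s ≫ h = t := by
  obtain ⟨s, hs⟩ := Triangle.coyoneda_exact₁ _ H t ht
  exact ⟨s, hs.symm⟩

lemma exists_lift₂ (H : Triangle.mk f g h ∈ distTriang T) (t : W ⟶ Y) (ht : t ≫ g = 0) :
    ∃ s : W ⟶ X, s ≫ f = t := by
  obtain ⟨s, hs⟩ := Triangle.coyoneda_exact₂ _ H t ht
  exact ⟨s, hs.symm⟩

lemma exists_lift₃ (H : Triangle.mk f g h ∈ distTriang T) (t : W ⟶ Z) (ht : t ≫ h = 0) :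
    ∃ s : W ⟶ Y, s ≫ g = t := by
  obtain ⟨s, hs⟩ := Triangle.coyoneda_exact₃ _ H t ht
  exact ⟨s, hs.symm⟩

/-- A morphism from the first term of a distinguished triangle extends along the first morphism
when its suspension is annihilated by the third one. -/
lemma exists_desc₁ (H : Triangle.mk f g h ∈ distTriang T) (t : X ⟶ W)
    (ht : h ≫ t⟦(1 : ℤ)⟧' = 0) : ∃ s : Y ⟶ W, f ≫ s = t := by
  obtain ⟨s, hs⟩ := Triangle.yoneda_exact₃ _ (rot_of_distTriang _ H) (t⟦(1 : ℤ)⟧') ht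
  obtain ⟨s, rfl⟩ : ∃ s' : Y ⟶ W, s'⟦(1 : ℤ)⟧' = s := (shiftFunctor T (1 : ℤ)).map_surjective s
  have hs' : t⟦(1 : ℤ)⟧' = (-f⟦(1 : ℤ)⟧') ≫ s⟦(1 : ℤ)⟧' := hs
  refine ⟨-s, (shiftFunctor T (1 : ℤ)).map_injective ?_⟩
  rw [hs']
  simp

lemma exists_desc₂ (H : Triangle.mk f g h ∈ distTriang T) (t : Y ⟶ W) (ht : f ≫ t = 0) :
    ∃ s : Z ⟶ W, g ≫ s = t := by
  obtain ⟨s, hs⟩ := Triangle.yoneda_exact₂ _ H t ht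
  exact ⟨s, hs.symm⟩

lemma exists_desc₃ (H : Triangle.mk f g h ∈ distTriang T) (t : Z ⟶ W) (ht : g ≫ t = 0) :
    ∃ s : X⟦(1 : ℤ)⟧ ⟶ W, h ≫ s = t := by
  obtain ⟨s, hs⟩ := Triangle.yoneda_exact₃ _ H t ht
  exact ⟨s, hs.symm⟩

variable {X' Y' Z' : T} {f' : X' ⟶ Y'} {g' : Y' ⟶ Z'} {h' : Z' ⟶ X'⟦(1 : ℤ)⟧}

lemma exists_morphism₁ (H : Triangle.mk f g h ∈ distTriang T)
    (H' : Triangle.mk f' g' h' ∈ distTriang T) (b : Y ⟶ Y') (c : Z ⟶ Z') (w : g ≫ c = b ≫ g') :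
    ∃ a : X ⟶ X', f ≫ b = a ≫ f' ∧ h ≫ a⟦(1 : ℤ)⟧' = c ≫ h' :=
  complete_distinguished_triangle_morphism₁ _ _ H H' b c w

lemma exists_morphism₃ (H : Triangle.mk f g h ∈ distTriang T)
    (H' : Triangle.mk f' g' h' ∈ distTriang T) (a : X ⟶ X') (b : Y ⟶ Y') (w : f ≫ b = a ≫ f') :
    ∃ c : Z ⟶ Z', g ≫ c = b ≫ g' ∧ h ≫ a⟦(1 : ℤ)⟧' = c ≫ h' :=
  complete_distinguished_triangle_morphism _ _ H H' a b w

lemma distinguished_of_iso (H : Triangle.mk f g h ∈ distTriang T) (e : X ≅ X') (e' : Z ≅ Z') :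
    Triangle.mk (e.inv ≫ f) (g ≫ e'.hom) (e'.inv ≫ h ≫ e.hom⟦(1 : ℤ)⟧') ∈ distTriang T := by
  refine isomorphic_distinguished (Triangle.mk f g h) H _ ?_
  refine Triangle.isoMk _ _ e.symm (Iso.refl _) e'.symm ?_ ?_ ?_
  · exact Category.comp_id _
  · change (g ≫ e'.hom) ≫ e'.inv = 𝟙 Y ≫ g
    simp
  · change (e'.inv ≫ h ≫ e.hom⟦(1 : ℤ)⟧') ≫ e.inv⟦(1 : ℤ)⟧' = e'.inv ≫ h
    rw [Category.assoc, Category.assoc, ← Functor.map_comp]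
    simp

end Distinguished

lemma triangulatedData_isWeaklyExact : (triangulatedData T).IsWeaklyExact where
  full := inferInstanceAs (shiftFunctor T (1 : ℤ)).Full
  additive := inferInstanceAs (shiftFunctor T (1 : ℤ)).Additive
  dist_iso e e' H := distinguished_of_iso H e e'
  comp_zero H := comp_eq_zero₂₃ H
  weakCokernel H _ t ht := exists_desc₃ H t ht

section

variable {X Y Z : T} {f : X ⟶ Y} {g : Y ⟶ Z} {h : Z ⟶ X⟦(1 : ℤ)⟧}

/-- The first morphism of an AR triangle is left almost split. If `Z ⟶ ΣX ⟶ ΣW` is not zero, a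
triangle on this composite maps to the AR triangle, which yields `b : W ⟶ X` with
`h ≫ Σ(u ≫ b) = h`; then `u ≫ b` is invertible. -/
lemma TriangleData.IsARTriangle.exists_extension (H : (triangulatedData T).IsARTriangle f g h)
    (hX : IsLocalObj X) {W : T} (u : X ⟶ W) (hu : ¬ IsSplitMono u) : ∃ v : Y ⟶ W, f ≫ v = u := by
  have hne : h ≠ 0 := H.ne_zero
  refine exists_desc₁ H.dist u ?_
  by_contra h0
  obtain ⟨E, i, p, hE⟩ := distinguished_cocone_triangle₂ (h ≫ u⟦(1 : ℤ)⟧')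
  have hp := comp_eq_zero₂₃ hE
  obtain ⟨s, hs⟩ := H.lift p (fun _ => h0 (by rw [← cancel_epi p, hp, comp_zero]))
  obtain ⟨b, -, hb⟩ := exists_morphism₁ hE H.dist s (𝟙 Z) (by rw [Category.comp_id, hs])
  have hb' : (h ≫ u⟦(1 : ℤ)⟧') ≫ b⟦(1 : ℤ)⟧' = h := hb.trans (Category.id_comp _)
  rcases hX.isIso_or (u ≫ b) with h1 | h1
  · exact hu (isSplitMono_of_isIso_comp u b)
  · refine hne ?_
    rw [← cancel_mono ((𝟙 X - u ≫ b)⟦(1 : ℤ)⟧'), zero_comp, Functor.map_sub, Preadditive.comp_sub,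
      Functor.map_comp, ← Category.assoc, hb']
    simp

/-- In an AR triangle the first morphism vanishes if and only if the second one does: then the
third morphism is an isomorphism. -/
lemma TriangleData.IsARTriangle.left_eq_zero_iff (H : (triangulatedData T).IsARTriangle f g h)
    (hZ : IsLocalObj Z) (hX : IsLocalObj (X⟦(1 : ℤ)⟧)) : f = 0 ↔ g = 0 := by
  constructor
  · intro h0
    obtain ⟨s, hs⟩ := exists_lift₁ H.dist (𝟙 _) (by rw [h0]; simp)
    have : IsSplitEpi h := ⟨⟨⟨s, hs⟩⟩⟩
    have := hZ.isIso_of_isSplitEpi hX h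
    rw [← cancel_mono h, comp_eq_zero₂₃ H.dist, zero_comp]
  · intro h0
    obtain ⟨s, hs⟩ := exists_desc₃ H.dist (𝟙 _) (by rw [h0, zero_comp])
    have : IsSplitMono h := ⟨⟨⟨s, hs⟩⟩⟩
    have := hZ.isIso_of_isSplitMono hX h
    refine (shiftFunctor T (1 : ℤ)).map_injective ?_
    rw [← cancel_epi h, comp_eq_zero₃₁ H.dist]
    simp

end

section Existence

variable {k : Type w} [Field k] [Linear k T]

/-- Existence of AR triangles: a linear form on the local ring `End(Z)` which vanishes on the
radical, but not on the identity, is represented through Serre duality by a morphism `Z ⟶ SZ`,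
which is the third morphism of an AR triangle. -/
lemma SerreFunctor.exists_isARTriangle [∀ A B : T, Module.Finite k (A ⟶ B)]
    (S : SerreFunctor k T) {X Z : T} (hX : Indecomposable X) (hZ : IsLocalObj Z)
    (e : S.S.functor.obj Z ≅ X⟦(1 : ℤ)⟧) :
    ∃ (Y : T) (f : X ⟶ Y) (g : Y ⟶ Z) (h : Z ⟶ X⟦(1 : ℤ)⟧),
      (triangulatedData T).IsARTriangle f g h := by
  have hid : 𝟙 Z ∉ rad k Z Z := fun h => hZ.not_isIso_of_mem_rad h inferInstance
  obtain ⟨φ, hφ1, hφ⟩ := Submodule.exists_le_ker_of_notMem hid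
  obtain ⟨x, hx⟩ := (Module.evalEquiv k (Z ⟶ S.S.functor.obj Z)).surjective
    (φ ∘ₗ (S.duality Z Z).symm.toLinearMap)
  have hx' : ∀ f : Z ⟶ Z, S.duality Z Z f x = φ f := fun f => by
    have := LinearMap.congr_fun hx (S.duality Z Z f)
    simpa using this
  obtain ⟨Y, f, g, H⟩ := distinguished_cocone_triangle₂ (x ≫ e.hom)
  refine ⟨Y, f, g, x ≫ e.hom, ⟨H, hX, hZ.indecomposable, fun h0 => hφ1 ?_, fun W t ht => ?_⟩⟩
  · have h1 : x ≫ e.hom = 0 := h0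
    have : x = 0 := by rw [← cancel_mono e.hom, h1, zero_comp]
    rw [← hx', this, map_zero]
  · have h0 : t ≫ x = 0 := by
      refine S.eq_zero_of_duality _ fun f => ?_
      rw [← S.natural_right, hx']
      exact hφ (rad_comp_left k f (hZ.mem_rad_iff_not_isSplitEpi.2 ht))
    exact exists_lift₃ H t (by rw [reassoc_of% h0, zero_comp])

end Existence

end ARTriangles

/-! ### The quotient category -/

lemma HomIdeal.toQuotient_map_eq_iff {k : Type w} [Field k] {C : Type u} [Category.{v} C]
    [Preadditive C] [Linear k C] (I : HomIdeal k C) {A B : C} {f g : A ⟶ B} :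
    I.toQuotient.map f = I.toQuotient.map g ↔ f - g ∈ I.carrier A B :=
  CategoryTheory.Quotient.functor_map_eq_iff _ _ _

lemma HomIdeal.toQuotient_map_eq_zero_iff {k : Type w} [Field k] {C : Type u} [Category.{v} C]
    [Preadditive C] [Linear k C] (I : HomIdeal k C) {A B : C} {f : A ⟶ B} :
    I.toQuotient.map f = 0 ↔ f ∈ I.carrier A B := by
  rw [← Functor.map_zero, I.toQuotient_map_eq_iff, sub_zero]

instance {k : Type w} [Field k] {C : Type u} [Category.{v} C]
    [Preadditive C] [Linear k C] (I : HomIdeal k C) : I.toQuotient.Linear k :=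
  CategoryTheory.Quotient.linear_functor k I.rel I.rel_smul

/-- `f` factors through an object of `X`. -/
def FactorsThrough {T : Type u} [Category.{v} T] (X : ObjectProperty T) {A B : T} (f : A ⟶ B) :
    Prop :=
  ∃ (Z : T) (a : A ⟶ Z) (b : Z ⟶ B), X Z ∧ a ≫ b = f

section Retracts

variable {T : Type u} [Category.{v} T] {X : ObjectProperty T} [X.IsStableUnderRetracts]

lemma prop_of_isIso_of_factorsThrough {M : T}
    {f : M ⟶ M} (hf : FactorsThrough X f) (h : IsIso f) : X M := by
  obtain ⟨Z, a, b, hZ, rfl⟩ := hf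
  exact X.prop_of_retract ⟨a, b ≫ inv (a ≫ b), by rw [← Category.assoc, IsIso.hom_inv_id]⟩ hZ

variable [Preadditive T] {k : Type w} [Field k] [Linear k T]

lemma mem_rad_of_prop_right {M Z : T} (hM : IsLocalObj M) (hX : ¬ X M) (hZ : X Z) (a : M ⟶ Z) :
    a ∈ rad k M Z :=
  hM.mem_rad_iff_not_isSplitMono.2 fun _ => hX (X.prop_of_retract ⟨a, retraction a, by simp⟩ hZ)

lemma mem_rad_of_prop_left {M Z : T} (hM : IsLocalObj M) (hX : ¬ X M) (hZ : X Z) (a : Z ⟶ M) :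
    a ∈ rad k Z M :=
  hM.mem_rad_iff_not_isSplitEpi.2 fun _ => hX (X.prop_of_retract ⟨section_ a, a, by simp⟩ hZ)

/-- Between indecomposable objects outside `X`, morphisms factoring through `X` belong to `rad²`;
hence passing to the quotient category does not change the spaces `Irr`. -/
lemma FactorsThrough.mem_radSq {M N : T} (hM : IsLocalObj M) (hN : IsLocalObj N) (hMX : ¬ X M)
    (hNX : ¬ X N) {f : M ⟶ N} (hf : FactorsThrough X f) : f ∈ radSq k M N := by
  obtain ⟨Z, a, b, hZ, rfl⟩ := hf
  exact comp_mem_radSq k (mem_rad_of_prop_right hM hMX hZ a) (mem_rad_of_prop_left hN hNX hZ b)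

end Retracts

section QuotientCategory

variable {T : Type u} [Category.{v} T] [Preadditive T] [HasZeroObject T] [HasShift T ℤ]
  [∀ n : ℤ, (shiftFunctor T n).Additive] [Pretriangulated T]
  {k : Type w} [Field k] [Linear k T]
  {X : ObjectProperty T} [X.IsStableUnderRetracts] [X.IsClosedUnderFiniteCoproducts]

lemma quot_map_eq_iff {A B : T} {f g : A ⟶ B} :
    (quot k X).map f = (quot k X).map g ↔ FactorsThrough X (f - g) :=
  (factorIdeal k X).toQuotient_map_eq_iff

lemma quot_map_eq_zero_iff {A B : T} {f : A ⟶ B} :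
    (quot k X).map f = 0 ↔ FactorsThrough X f :=
  (factorIdeal k X).toQuotient_map_eq_zero_iff

lemma isZero_quot_iff {M : T} : IsZero ((quot k X).obj M) ↔ X M := by
  rw [IsZero.iff_id_eq_zero, ← CategoryTheory.Functor.map_id, quot_map_eq_zero_iff]
  exact ⟨fun h => prop_of_isIso_of_factorsThrough h inferInstance,
    fun h => ⟨M, 𝟙 M, 𝟙 M, h, Category.comp_id _⟩⟩

lemma isLocalObj_quot {M : T} (hM : IsLocalObj M) (hX : ¬ X M) :
    IsLocalObj ((quot k X).obj M) where
  id_ne_zero h := hX ((isZero_quot_iff (k := k)).1 ((IsZero.iff_id_eq_zero _).2 h))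
  isIso_or f := by
    obtain ⟨f, rfl⟩ := (quot k X).map_surjective f
    rw [← CategoryTheory.Functor.map_id, ← Functor.map_sub]
    rcases hM.isIso_or f with h | h
    · exact Or.inl inferInstance
    · exact Or.inr inferInstance

lemma isIso_of_isIso_quot_map {M : T} (hM : IsLocalObj M) (hX : ¬ X M) (f : M ⟶ M)
    (hf : IsIso ((quot k X).map f)) : IsIso f := by
  obtain ⟨g, hg⟩ := (quot k X).map_surjective (inv ((quot k X).map f))
  have h : FactorsThrough X (𝟙 M - f ≫ g) := by
    rw [← quot_map_eq_iff (k := k)]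
    simp [hg]
  have h1 : IsIso (f ≫ g) := (hM.isIso_or (f ≫ g)).resolve_right fun h' =>
    hX (prop_of_isIso_of_factorsThrough h h')
  have := isSplitMono_of_isIso_comp f g
  exact hM.isIso_of_isSplitMono hM f

lemma quot_map_mem_rad_iff_left {M N : T} (hM : IsLocalObj M) (hX : ¬ X M) (f : M ⟶ N) :
    (quot k X).map f ∈ rad k ((quot k X).obj M) ((quot k X).obj N) ↔ f ∈ rad k M N := by
  rw [hM.mem_rad_iff_not_isSplitMono, (isLocalObj_quot hM hX).mem_rad_iff_not_isSplitMono,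
    not_iff_not]
  refine ⟨fun h => ?_, fun h => inferInstance⟩
  obtain ⟨g, hg⟩ := (quot k X).map_surjective (retraction ((quot k X).map f))
  have := isIso_of_isIso_quot_map (k := k) hM hX (f ≫ g) (by
    rw [Functor.map_comp, hg, IsSplitMono.id]
    infer_instance)
  exact isSplitMono_of_isIso_comp f g

lemma quot_map_mem_rad_iff_right {M N : T} (hN : IsLocalObj N) (hX : ¬ X N) (f : M ⟶ N) :
    (quot k X).map f ∈ rad k ((quot k X).obj M) ((quot k X).obj N) ↔ f ∈ rad k M N := by
  rw [hN.mem_rad_iff_not_isSplitEpi, (isLocalObj_quot hN hX).mem_rad_iff_not_isSplitEpi,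
    not_iff_not]
  refine ⟨fun h => ?_, fun h => inferInstance⟩
  obtain ⟨g, hg⟩ := (quot k X).map_surjective (section_ ((quot k X).map f))
  have := isIso_of_isIso_quot_map (k := k) hN hX (g ≫ f) (by
    rw [Functor.map_comp, hg, IsSplitEpi.id]
    infer_instance)
  exact isSplitEpi_of_isIso_comp g f

/-- Isomorphic images in the quotient category come from isomorphic local objects. -/
lemma nonempty_iso_of_quot_iso {M N : T} (hM : IsLocalObj M) (hN : IsLocalObj N) (hX : ¬ X M)
    (e : (quot k X).obj M ≅ (quot k X).obj N) : Nonempty (M ≅ N) := by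
  obtain ⟨f, hf⟩ := (quot k X).map_surjective e.hom
  obtain ⟨g, hg⟩ := (quot k X).map_surjective e.inv
  have := isIso_of_isIso_quot_map (k := k) hM hX (f ≫ g) (by
    rw [Functor.map_comp, hf, hg, e.hom_inv_id]
    infer_instance)
  have := isSplitMono_of_isIso_comp f g
  have := hM.isIso_of_isSplitMono hN f
  exact ⟨asIso f⟩

lemma finrank_irr_quot {M N : T} (hM : IsLocalObj M) (hN : IsLocalObj N) (hMX : ¬ X M)
    (hNX : ¬ X N) : Module.finrank k (Irr k M N) =
      Module.finrank k (Irr k ((quot k X).obj M) ((quot k X).obj N)) := by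
  refine finrank_irr_eq_of_surjective k ((quot k X).mapLinearMap k)
    (quot k X).map_surjective (quot_map_mem_rad_iff_left hM hMX) fun f => ?_
  rw [Functor.coe_mapLinearMap]
  constructor
  · intro h
    obtain ⟨f', hf', hff'⟩ : ∃ f' ∈ radSq k M N, (quot k X).map f' = (quot k X).map f := by
      generalize (quot k X).map f = t at h
      induction h using Submodule.span_induction with
      | mem t ht =>
        obtain ⟨D, a, b, ha, hb, rfl⟩ := ht
        obtain ⟨a, rfl⟩ := (quot k X).map_surjective (Y := D.as) a
        obtain ⟨b, rfl⟩ := (quot k X).map_surjective (X := D.as) b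
        exact ⟨a ≫ b, comp_mem_radSq k ((quot_map_mem_rad_iff_left hM hMX a).1 ha)
          ((quot_map_mem_rad_iff_right hN hNX b).1 hb), Functor.map_comp _ _ _⟩
      | zero => exact ⟨0, Submodule.zero_mem _, Functor.map_zero _ _ _⟩
      | add s t _ _ hs ht =>
        obtain ⟨s, hs, rfl⟩ := hs
        obtain ⟨t, ht, rfl⟩ := ht
        exact ⟨s + t, Submodule.add_mem _ hs ht, Functor.map_add _⟩
      | smul c s _ hs =>
        obtain ⟨s, hs, rfl⟩ := hs
        exact ⟨c • s, Submodule.smul_mem _ _ hs, Functor.map_smul _ _ _⟩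
    have h1 := (quot_map_eq_iff.1 hff'.symm).mem_radSq (k := k) hM hN hMX hNX
    have := Submodule.add_mem _ h1 hf'
    rwa [sub_add_cancel] at this
  · intro h
    induction h using Submodule.span_induction with
    | mem t ht =>
      obtain ⟨D, a, b, ha, hb, rfl⟩ := ht
      rw [Functor.map_comp]
      exact comp_mem_radSq k ((quot_map_mem_rad_iff_left hM hMX a).2 ha)
        ((quot_map_mem_rad_iff_right hN hNX b).2 hb)
    | zero => rw [Functor.map_zero]; exact Submodule.zero_mem _
    | add s t _ _ hs ht => rw [Functor.map_add]; exact Submodule.add_mem _ hs ht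
    | smul c s _ hs => rw [Functor.map_smul]; exact Submodule.smul_mem _ _ hs

/-- Every indecomposable object of the quotient category is the image of one of `T`. -/
lemma exists_indecomposable_of_quot [∀ A B : T, Module.Finite k (A ⟶ B)]
    (A : QuotCat k X) (hA : Indecomposable A) :
    ∃ M : T, Indecomposable M ∧ ¬ X M ∧ Nonempty ((quot k X).obj M ≅ A) := by
  suffices H : ∀ M : T, Indecomposable ((quot k X).obj M) →
      ∃ N : T, Indecomposable N ∧ ¬ X N ∧ Nonempty ((quot k X).obj N ≅ (quot k X).obj M) from
    H A.as hA
  refine induction_indecomposable k ?_ ?_ ?_ ?_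
  · rintro M N e h hN
    obtain ⟨L, hL, hLX, ⟨i⟩⟩ := h (hN.of_iso ((quot k X).mapIso e.symm))
    exact ⟨L, hL, hLX, ⟨i.trans ((quot k X).mapIso e)⟩⟩
  · intro M hM h
    exact absurd ((quot k X).map_isZero hM) h.1
  · intro M hM h
    exact ⟨M, hM, fun hX => h.1 (isZero_quot_iff.2 hX), ⟨Iso.refl _⟩⟩
  · intro M N hM hN h
    have := preservesBinaryBiproduct_of_preservesBiproduct (quot k X) M N
    have e : (quot k X).obj (M ⊞ N) ≅ (quot k X).obj M ⊞ (quot k X).obj N :=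
      (quot k X).mapBiprod M N
    rcases h.2 _ _ e with h0 | h0
    · have i : (quot k X).obj N ≅ (quot k X).obj (M ⊞ N) :=
        (isoZeroBiprod h0).trans e.symm
      obtain ⟨L, hL, hLX, ⟨j⟩⟩ := hN (h.of_iso i.symm)
      exact ⟨L, hL, hLX, ⟨j.trans i⟩⟩
    · have i : (quot k X).obj M ≅ (quot k X).obj (M ⊞ N) :=
        (isoBiprodZero h0).trans e.symm
      obtain ⟨L, hL, hLX, ⟨j⟩⟩ := hM (h.of_iso i.symm)
      exact ⟨L, hL, hLX, ⟨j.trans i⟩⟩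

end QuotientCategory

/-! ### Invariance under the translation -/

section Translation

namespace SerreFunctor

variable {T : Type u} [Category.{v} T] [Preadditive T] [HasShift T ℤ]
  {k : Type w} [Field k] [Linear k T] (S : SerreFunctor k T) {X : ObjectProperty T}

/-- The suspension of `τM` is `SM`. -/
def shiftTranslationIso (M : T) : S.S.functor.obj M ≅ (S.translation.obj M)⟦(1 : ℤ)⟧ :=
  ((shiftFunctorCompIsoId T (-1 : ℤ) 1 (by simp)).app (S.S.functor.obj M)).symm

lemma exists_prop_serre_iso (hτ : X.map S.translation = X) {Z : T} (hZ : X Z) :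
    ∃ Y : T, X Y ∧ Nonempty (S.S.functor.obj Y ≅ Z⟦(1 : ℤ)⟧) := by
  rw [← hτ] at hZ
  obtain ⟨Y, hY, ⟨e⟩⟩ := hZ
  exact ⟨Y, hY, ⟨S.shiftTranslationIso Y ≪≫ (shiftFunctor T (1 : ℤ)).mapIso e⟩⟩

lemma prop_translation (hτ : X.map S.translation = X) {Z : T} (hZ : X Z) :
    X (S.translation.obj Z) := by
  have := X.prop_map_obj S.translation hZ
  rwa [hτ] at this

lemma prop_iff_of_serre_iso [X.IsStableUnderRetracts] (hτ : X.map S.translation = X) {A P : T}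
    (e : S.S.functor.obj P ≅ A⟦(1 : ℤ)⟧) : X A ↔ X P := by
  constructor
  · intro hA
    obtain ⟨Y, hY, ⟨e'⟩⟩ := S.exists_prop_serre_iso hτ hA
    exact X.prop_of_iso (S.S.functor.preimageIso (e' ≪≫ e.symm)) hY
  · intro hP
    exact X.prop_of_iso ((shiftFunctor T (1 : ℤ)).preimageIso
      ((S.shiftTranslationIso P).symm ≪≫ e)) (S.prop_translation hτ hP)

variable [HasZeroObject T] [∀ n : ℤ, (shiftFunctor T n).Additive] [Pretriangulated T]

/-- In a distinguished triangle `M ⟶ N ⟶ P ⟶ ΣM`, the first morphism is an `X`-monomorphism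
if and only if the second one is an `X`-epimorphism. As `τX = X`, the objects `ΣZ` with `Z` in `X` are
the objects `SY` with `Y` in `X`; by Serre duality both conditions say that `d : P ⟶ ΣM` is
annihilated by the pairing with all `Y ⟶ P` and all `ΣM ⟶ SY`. -/
lemma isXMono_iff_isXEpi [X.IsStableUnderRetracts] (hτ : X.map S.translation = X) {M N P : T}
    {μ : M ⟶ N} {ν : N ⟶ P} {d : P ⟶ M⟦(1 : ℤ)⟧} (H : Triangle.mk μ ν d ∈ distTriang T) :
    IsXMono X μ ↔ IsXEpi X ν := by
  constructor
  · intro h Y hY t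
    refine exists_lift₃ H t ((S.duality Y _).injective ?_)
    ext g
    rw [S.natural_right, map_zero, LinearMap.zero_apply]
    obtain ⟨g', hg'⟩ := (shiftFunctor T (1 : ℤ)).map_surjective
      (g ≫ (S.shiftTranslationIso Y).hom)
    obtain ⟨v, hv⟩ := h (S.prop_translation hτ hY) g'
    have h0 : d ≫ g'⟦(1 : ℤ)⟧' = 0 := by
      rw [← hv, Functor.map_comp, ← Category.assoc, comp_eq_zero₃₁ H, zero_comp]
    have h1 : d ≫ g = 0 := by
      rw [← cancel_mono (S.shiftTranslationIso Y).hom, Category.assoc, ← hg', h0, zero_comp]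
    rw [h1, map_zero]
  · intro h Z hZ g
    refine exists_desc₁ H g ?_
    obtain ⟨Y, hY, ⟨e⟩⟩ := S.exists_prop_serre_iso hτ hZ
    rw [← cancel_mono e.inv, zero_comp, Category.assoc]
    refine S.eq_zero_of_duality _ fun t => ?_
    obtain ⟨s, rfl⟩ := h hY t
    rw [← S.natural_right, Category.assoc, comp_eq_zero₂₃ H, comp_zero, map_zero,
      LinearMap.zero_apply]

end SerreFunctor

end Translation

section Local

variable {C : Type u} [Category.{v} C] [Preadditive C] {D : Type u'} [Category.{v'} D]
  [Preadditive D]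

lemma IsLocalObj.map_of_fullyFaithful (k : Type w) [Field k] [Linear k D]
    [∀ A B : D, Module.Finite k (A ⟶ B)] (F : C ⥤ D) [F.Full] [F.Faithful]
    [F.PreservesZeroMorphisms] {A : C} (hA : IsLocalObj A) : IsLocalObj (F.obj A) := by
  refine isLocalObj_of_idempotents k (fun h => hA.id_ne_zero (F.map_injective ?_)) fun e he => ?_
  · rw [F.map_id, h, F.map_zero]
  · obtain ⟨e, rfl⟩ := F.map_surjective e
    rw [← F.map_comp] at he
    rcases hA.eq_zero_or_eq_id e (F.map_injective he) with h | h
    · exact Or.inl (by rw [h, F.map_zero])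
    · exact Or.inr (by rw [h, F.map_id])

end Local

/-! ### The suspension of the quotient category -/

namespace EnvelopeChoice

variable {T : Type u} [Category.{v} T] [Preadditive T] [HasZeroObject T] [HasShift T ℤ]
  [∀ n : ℤ, (shiftFunctor T n).Additive] [Pretriangulated T]
  {X : ObjectProperty T} (E : EnvelopeChoice X)

/-- The weak cokernel property of the distinguished triangles of the quotient category, stated
in terms of representatives in `T`. -/
lemma exists_factorization {M N P W : T} {μ : M ⟶ N} {ν : N ⟶ P} {d : P ⟶ M⟦(1 : ℤ)⟧}
    {n : N ⟶ E.env M} {ϖ : P ⟶ E.sigma M} (H : Triangle.mk μ ν d ∈ distTriang T)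
    (hn : μ ≫ n = E.ι M) (hϖ : ν ≫ ϖ = n ≫ E.π M) (hd : ϖ ≫ E.δ M = d) (w : P ⟶ W)
    (hw : FactorsThrough X (ν ≫ w)) :
    ∃ s : E.sigma M ⟶ W, FactorsThrough X (ϖ ≫ s - w) := by
  obtain ⟨Z, α, β, hZ, hαβ⟩ := hw
  -- correct `w` by a morphism through `Z`, so that `ν ≫ w` factors through `n`
  obtain ⟨ξ, hξ⟩ := E.isXMono M hZ (μ ≫ α)
  obtain ⟨ζ, hζ⟩ := exists_desc₂ H (α - n ≫ ξ) (by
    rw [Preadditive.comp_sub, ← Category.assoc, hn, hξ, sub_self])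
  have h1 : ν ≫ (w - ζ ≫ β) = n ≫ ξ ≫ β := by
    rw [Preadditive.comp_sub, reassoc_of% hζ, ← hαβ, Preadditive.sub_comp, Category.assoc]
    abel
  obtain ⟨s, hs⟩ := exists_desc₂ (E.distinguished M) (ξ ≫ β) (by
    rw [← hn, Category.assoc, ← h1, ← Category.assoc, comp_eq_zero₁₂ H, zero_comp])
  obtain ⟨e, he⟩ := exists_desc₃ H (w - ζ ≫ β - ϖ ≫ s) (by
    rw [Preadditive.comp_sub, h1, ← hs, reassoc_of% hϖ, sub_self])
  refine ⟨s + E.δ M ≫ e, Z, -ζ, β, hZ, ?_⟩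
  rw [Preadditive.comp_add, reassoc_of% hd, he, Preadditive.neg_comp]
  abel

variable {k : Type w} [Field k] [Linear k T] {S : SerreFunctor k T}
  [X.IsStableUnderRetracts] [X.IsClosedUnderFiniteCoproducts]

instance susp_additive : (E.susp k).Additive where
  map_add {A B f g} := by
    obtain ⟨f, rfl⟩ := (quot k X).map_surjective (X := A.as) (Y := B.as) f
    obtain ⟨g, rfl⟩ := (quot k X).map_surjective (X := A.as) (Y := B.as) g
    have h : (quot k X).map (E.map (f + g)) = (quot k X).map (E.map f + E.map g) := by
      refine E.quot_eq_of_comp_δ k ?_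
      simp [map_δ]
    rw [Functor.map_add] at h
    rw [← Functor.map_add]
    exact h

/-- The functor `σ` is full: a morphism `s : σM ⟶ σN` lifts to the envelopes because
`X_N ⟶ σN` is an `X`-epimorphism. -/
lemma susp_full (hτ : X.map S.translation = X) : (E.susp k).Full where
  map_surjective {A B} s := by
    obtain ⟨s, rfl⟩ := (quot k X).map_surjective (X := E.sigma A.as) (Y := E.sigma B.as) s
    obtain ⟨ξ, hξ⟩ := (S.isXMono_iff_isXEpi hτ (E.distinguished B.as)).1 (E.isXMono B.as)
      (E.prop_env A.as) (E.π A.as ≫ s)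
    obtain ⟨μ, -, hμ⟩ := exists_morphism₁ (E.distinguished A.as) (E.distinguished B.as) ξ s hξ.symm
    exact ⟨(quot k X).map μ, E.quot_eq_of_comp_δ k (by rw [map_δ, hμ])⟩

lemma susp_faithful (hτ : X.map S.translation = X) : (E.susp k).Faithful := by
  suffices h : ∀ {A B : QuotCat k X} (f : A ⟶ B), (E.susp k).map f = 0 → f = 0 from
    ⟨fun {A B f g} hfg => sub_eq_zero.1 (h _ (by rw [Functor.map_sub, hfg, sub_self]))⟩
  intro A B f hf
  obtain ⟨f, rfl⟩ := (quot k X).map_surjective (X := A.as) (Y := B.as) f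
  have hf' : (quot k X).map (E.map f) = 0 := hf
  rw [quot_map_eq_zero_iff] at hf'
  obtain ⟨Z, a, b, hZ, hab⟩ := hf'
  obtain ⟨b, rfl⟩ := (S.isXMono_iff_isXEpi hτ (E.distinguished B.as)).1 (E.isXMono B.as) hZ b
  have h0 : E.δ A.as ≫ f⟦(1 : ℤ)⟧' = 0 := by
    rw [← map_δ, ← hab, Category.assoc, Category.assoc, comp_eq_zero₂₃ (E.distinguished B.as),
      comp_zero, comp_zero]
  obtain ⟨g, hg⟩ := exists_desc₁ (E.distinguished A.as) f h0
  exact quot_map_eq_zero_iff.2 ⟨_, E.ι A.as, g, E.prop_env _, hg⟩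

/-- Every object is isomorphic to some `σM` in the quotient category: `M` is the first term of a
distinguished triangle on a precover. -/
lemma susp_essSurj (hτ : X.map S.translation = X) (hcov : IsPrecovering X) :
    (E.susp k).EssSurj where
  mem_essImage A := by
    obtain ⟨Z, p, hZ, hp⟩ := hcov A.as
    obtain ⟨M, i, d, H⟩ := distinguished_cocone_triangle₁ p
    have hi : IsXMono X i := (S.isXMono_iff_isXEpi hτ H).2 hp
    obtain ⟨a, ha⟩ := hi (E.prop_env M) (E.ι M)
    obtain ⟨b, hb⟩ := E.isXMono M hZ i
    obtain ⟨s, -, hs⟩ := exists_morphism₃ H (E.distinguished M) (𝟙 M) a (by simp [ha])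
    obtain ⟨t, -, ht⟩ := exists_morphism₃ (E.distinguished M) H (𝟙 M) b (by simp [hb])
    rw [CategoryTheory.Functor.map_id, Category.comp_id] at hs ht
    refine ⟨(quot k X).obj M, ⟨⟨(quot k X).map t, (quot k X).map s, ?_, ?_⟩⟩⟩
    · have h : (quot k X).map (t ≫ s) = (quot k X).map (𝟙 _) :=
        E.quot_eq_of_comp_δ k (by rw [Category.assoc, ← hs, ← ht, Category.id_comp])
      rw [Functor.map_comp, CategoryTheory.Functor.map_id] at h
      exact h
    · have h : (quot k X).map (s ≫ t) = (quot k X).map (𝟙 A.as) := by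
        rw [quot_map_eq_iff]
        obtain ⟨w, hw⟩ := exists_lift₃ H (s ≫ t - 𝟙 A.as) (by
          rw [Preadditive.sub_comp, Category.assoc, ← ht, ← hs, Category.id_comp, sub_self])
        exact ⟨Z, w, p, hZ, hw⟩
      rw [Functor.map_comp, CategoryTheory.Functor.map_id] at h
      exact h

lemma susp_isEquivalence (hτ : X.map S.translation = X) (hcov : IsPrecovering X) :
    (E.susp k).IsEquivalence where
  full := E.susp_full hτ
  faithful := E.susp_faithful hτ
  essSurj := E.susp_essSurj hτ hcov

section Distinguished

variable {E} {A A' B C C' : QuotCat k X} {f : A ⟶ B} {g : B ⟶ C} {h : C ⟶ (E.susp k).obj A}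

lemma IsDist.of_iso (H : E.IsDist k f g h) (e : A ≅ A') (e' : C ≅ C') :
    E.IsDist k (e.inv ≫ f) (g ≫ e'.hom) (e'.inv ≫ h ≫ (E.susp k).map e.hom) := by
  obtain ⟨M, N, P, μ, ν, d, n, ϖ, hμ, hdist, hn, hϖ, hd, eA, eB, eC, h1, h2, h3⟩ := H
  refine ⟨M, N, P, μ, ν, d, n, ϖ, hμ, hdist, hn, hϖ, hd, e.symm ≪≫ eA, eB, e'.symm ≪≫ eC,
    ?_, ?_, ?_⟩
  · simp [h1]
  · simp [h2]
  · have h4 : (E.susp k).map e.hom ≫ (E.susp k).map e.inv = 𝟙 _ := by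
      rw [← Functor.map_comp, e.hom_inv_id, CategoryTheory.Functor.map_id]
    rw [Iso.trans_hom, Iso.symm_hom, Functor.map_comp, Category.assoc, Category.assoc,
      reassoc_of% h4, h3, Iso.trans_hom, Iso.symm_hom, Category.assoc]

lemma IsDist.comp_eq_zero (H : E.IsDist k f g h) : g ≫ h = 0 := by
  obtain ⟨M, N, P, μ, ν, d, n, ϖ, hμ, hdist, hn, hϖ, hd, eA, eB, eC, h1, h2, h3⟩ := H
  have h0 : (quot k X).map ν ≫ (quot k X).map ϖ = 0 := by
    rw [← Functor.map_comp, hϖ, quot_map_eq_zero_iff]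
    exact ⟨_, n, E.π M, E.prop_env M, rfl⟩
  rw [← cancel_mono ((E.susp k).map eA.hom), zero_comp, Category.assoc, h3, reassoc_of% h2]
  exact (congrArg (fun t => eB.hom ≫ t) h0).trans comp_zero

lemma IsDist.weakCokernel (H : E.IsDist k f g h) {W : QuotCat k X} (t : C ⟶ W)
    (ht : g ≫ t = 0) : ∃ s : (E.susp k).obj A ⟶ W, h ≫ s = t := by
  obtain ⟨M, N, P, μ, ν, d, n, ϖ, hμ, hdist, hn, hϖ, hd, eA, eB, eC, h1, h2, h3⟩ := H
  obtain ⟨w, hw⟩ := (quot k X).map_surjective (Y := W.as) (eC.inv ≫ t)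
  have h0 : (quot k X).map (ν ≫ w) = 0 := by
    rw [Functor.map_comp, hw, ← cancel_epi eB.hom, ← Category.assoc, ← h2, comp_zero,
      Category.assoc, eC.hom_inv_id_assoc]
    exact ht
  obtain ⟨s, hs⟩ := E.exists_factorization hdist hn hϖ hd w (quot_map_eq_zero_iff.1 h0)
  rw [← quot_map_eq_iff (k := k), Functor.map_comp, hw] at hs
  obtain ⟨s', hs'⟩ : ∃ s' : (E.susp k).obj ((quot k X).obj M) ⟶ W,
      (show (quot k X).obj P ⟶ (E.susp k).obj ((quot k X).obj M) from
        (quot k X).map ϖ) ≫ s' = eC.inv ≫ t := ⟨(quot k X).map s, hs⟩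
  exact ⟨(E.susp k).map eA.hom ≫ s', (Category.assoc _ _ _).symm.trans
    ((congrArg (fun t => t ≫ s') h3).trans ((Category.assoc _ _ _).trans
      ((congrArg (fun t => eC.hom ≫ t) hs').trans (eC.hom_inv_id_assoc _))))⟩

end Distinguished

lemma quotData_isWeaklyExact (hτ : X.map S.translation = X) :
    (E.quotData k).IsWeaklyExact where
  full := E.susp_full hτ
  additive := E.susp_additive
  dist_iso e e' H := H.of_iso e e'
  comp_zero H := H.comp_eq_zero
  weakCokernel H _ t ht := H.weakCokernel t ht

end EnvelopeChoice

/-! ### Auslander–Reiten triangles in the quotient category -/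

/-- There is an AR triangle with first term `A` and last term `B`, that is, `A = τB`. -/
def TriangleData.IsARPair {C : Type u} [Category.{v} C] [Preadditive C] [HasBinaryBiproducts C]
    (D : TriangleData C) (A B : C) : Prop :=
  ∃ (Y : C) (f : A ⟶ Y) (g : Y ⟶ B) (h : B ⟶ D.susp.obj A), D.IsARTriangle f g h

namespace TriangleData.IsARPair

variable {C : Type u} [Category.{v} C] [Preadditive C] [HasBinaryBiproducts C]
  {D : TriangleData C}

lemma of_iso (hD : D.IsWeaklyExact) {A B A' B' : C} (H : D.IsARPair A B) (e : A ≅ A')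
    (e' : B ≅ B') : D.IsARPair A' B' := by
  obtain ⟨Y, f, g, h, H⟩ := H
  exact ⟨_, _, _, _, H.of_iso hD e e'⟩

lemma nonempty_iso (hD : D.IsWeaklyExact) {A A' B : C} (H : D.IsARPair A B)
    (H' : D.IsARPair A' B) (hA : IsLocalObj A) (hA' : IsLocalObj A') : Nonempty (A ≅ A') := by
  obtain ⟨Y, f, g, h, H⟩ := H
  obtain ⟨Y', f', g', h', H'⟩ := H'
  exact H.nonempty_iso hD H' hA hA'

end TriangleData.IsARPair

section ARPairs

variable {T : Type u} [Category.{v} T] [Preadditive T] [HasZeroObject T] [HasShift T ℤ]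
  [∀ n : ℤ, (shiftFunctor T n).Additive] [Pretriangulated T]
  {k : Type w} [Field k] [Linear k T]

section

variable {S : SerreFunctor k T} {X : ObjectProperty T} [X.IsStableUnderRetracts]
  [X.IsClosedUnderFiniteCoproducts] (E : EnvelopeChoice X)

/-- An AR triangle of `T` whose end terms do not belong to `X` induces an AR triangle of the
quotient category. -/
lemma EnvelopeChoice.isARPair_quot (hτ : X.map S.translation = X) {A P : T} (hA : IsLocalObj A)
    (hP : IsLocalObj P) (hAX : ¬ X A) (hPX : ¬ X P) (H : (triangulatedData T).IsARPair A P) :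
    (E.quotData k).IsARPair ((quot k X).obj A) ((quot k X).obj P) := by
  obtain ⟨B, f, g, h, H⟩ := H
  have hne : h ≠ 0 := H.ne_zero
  have hf : IsXMono X f := fun Z hZ u => H.exists_extension hA u fun _ =>
    hAX (X.prop_of_retract ⟨u, retraction u, by simp⟩ hZ)
  obtain ⟨n, hn⟩ := hf (E.prop_env A) (E.ι A)
  obtain ⟨ϖ, hϖ, hd⟩ := exists_morphism₃ H.dist (E.distinguished A) (𝟙 A) n (by simp [hn])
  rw [CategoryTheory.Functor.map_id] at hd
  replace hd : h = ϖ ≫ E.δ A := (Category.comp_id _).symm.trans hd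
  refine ⟨(quot k X).obj B, (quot k X).map f, (quot k X).map g, (quot k X).map ϖ,
    ⟨?_, (isLocalObj_quot hA hAX).indecomposable, (isLocalObj_quot hP hPX).indecomposable, ?_, ?_⟩⟩
  · refine ⟨A, B, P, f, g, h, n, ϖ, hf, H.dist, hn, hϖ, hd.symm, Iso.refl _, Iso.refl _,
      Iso.refl _, by simp, by simp, ?_⟩
    simp only [Iso.refl_hom, CategoryTheory.Functor.map_id]
    exact (Category.comp_id _).trans (Category.id_comp _).symm
  · intro h0
    have h0' : (quot k X).map ϖ = 0 := h0
    rw [quot_map_eq_zero_iff] at h0'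
    obtain ⟨Z, a, b, hZ, rfl⟩ := h0'
    obtain ⟨b, rfl⟩ := (S.isXMono_iff_isXEpi hτ (E.distinguished A)).1 (E.isXMono A) hZ b
    have h1 : (a ≫ b ≫ E.π A) ≫ E.δ A = 0 := by
      rw [Category.assoc, Category.assoc, comp_eq_zero₂₃ (E.distinguished A), comp_zero, comp_zero]
    exact hne (hd.trans h1)
  · intro W t ht
    obtain ⟨t, rfl⟩ := (quot k X).map_surjective (X := W.as) t
    obtain ⟨s, rfl⟩ := H.lift t fun _ => ht inferInstance
    exact ⟨(quot k X).map s, (Functor.map_comp _ _ _).symm⟩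

end

variable [∀ A B : T, Module.Finite k (A ⟶ B)]

lemma SerreFunctor.isLocalObj_translation (S : SerreFunctor k T) {Z : T} (hZ : IsLocalObj Z) :
    IsLocalObj (S.translation.obj Z) := by
  have h : IsLocalObj (S.S.functor.obj Z) := hZ.map_of_fullyFaithful k _
  exact h.map_of_fullyFaithful k (shiftFunctor T (-1 : ℤ))

lemma SerreFunctor.isARPair_translation (S : SerreFunctor k T) {Z : T} (hZ : IsLocalObj Z) :
    (triangulatedData T).IsARPair (S.translation.obj Z) Z :=
  S.exists_isARTriangle (S.isLocalObj_translation hZ).indecomposable hZ (S.shiftTranslationIso Z)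

lemma SerreFunctor.exists_isARPair_left (S : SerreFunctor k T) {A : T} (hA : IsLocalObj A) :
    ∃ Z : T, IsLocalObj Z ∧ (triangulatedData T).IsARPair A Z := by
  have h1 : IsLocalObj (A⟦(1 : ℤ)⟧) := hA.map_of_fullyFaithful k _
  have h2 : IsLocalObj (S.S.inverse.obj (A⟦(1 : ℤ)⟧)) := h1.map_of_fullyFaithful k _
  exact ⟨_, h2, S.exists_isARTriangle hA.indecomposable h2 (S.S.counitIso.app (A⟦(1 : ℤ)⟧))⟩

variable {S : SerreFunctor k T} {X : ObjectProperty T} [X.IsStableUnderRetracts]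

lemma prop_iff_of_isARPair (hτ : X.map S.translation = X) {A P : T}
    (hA : IsLocalObj A) (hP : IsLocalObj P) (H : (triangulatedData T).IsARPair A P) :
    X A ↔ X P := by
  have h := S.isARPair_translation hP
  have hloc := S.isLocalObj_translation hP
  obtain ⟨e⟩ := h.nonempty_iso triangulatedData_isWeaklyExact H hloc hA
  exact S.prop_iff_of_serre_iso hτ
    (S.shiftTranslationIso P ≪≫ (shiftFunctor T (1 : ℤ)).mapIso e)

variable [X.IsClosedUnderFiniteCoproducts] (E : EnvelopeChoice X)

/-- Outside `X`, the AR translations of `T` and of the quotient category agree. -/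
lemma EnvelopeChoice.isARPair_quot_iff (hτ : X.map S.translation = X) {A P : T}
    (hA : IsLocalObj A) (hP : IsLocalObj P) (hAX : ¬ X A) (hPX : ¬ X P) :
    (E.quotData k).IsARPair ((quot k X).obj A) ((quot k X).obj P) ↔
      (triangulatedData T).IsARPair A P := by
  refine ⟨fun H => ?_, E.isARPair_quot hτ hA hP hAX hPX⟩
  have h := S.isARPair_translation hP
  have hloc := S.isLocalObj_translation hP
  have hX : ¬ X (S.translation.obj P) := fun h' =>
    hPX ((prop_iff_of_isARPair hτ hloc hP h).1 h')
  obtain ⟨e⟩ := (E.isARPair_quot hτ hloc hP hX hPX h).nonempty_iso (E.quotData_isWeaklyExact hτ) H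
    (isLocalObj_quot hloc hX) (isLocalObj_quot hA hAX)
  obtain ⟨i⟩ := nonempty_iso_of_quot_iso hloc hA hX e
  exact h.of_iso triangulatedData_isWeaklyExact i (Iso.refl _)

variable [IsIdempotentComplete T]

/-- An indecomposable object of the quotient category comes from an indecomposable object of `T`
outside `X`. An AR triangle of `T` which ends or starts there has both end terms outside `X`, as
`τX = X`, so it survives in the quotient category. -/
lemma EnvelopeChoice.hasARTriangles (hτ : X.map S.translation = X) :
    (E.quotData k).HasARTriangles := by
  constructor
  · intro Z hZ
    obtain ⟨P, hP, hPX, ⟨e⟩⟩ := exists_indecomposable_of_quot Z hZ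
    have hP := hP.isLocalObj k
    have h := S.isARPair_translation hP
    have hloc := S.isLocalObj_translation hP
    have hX : ¬ X (S.translation.obj P) := fun h' =>
      hPX ((prop_iff_of_isARPair hτ hloc hP h).1 h')
    exact ⟨_, (E.isARPair_quot hτ hloc hP hX hPX h).of_iso (E.quotData_isWeaklyExact hτ)
      (Iso.refl _) e⟩
  · intro A hA
    obtain ⟨M, hM, hMX, ⟨e⟩⟩ := exists_indecomposable_of_quot A hA
    have hM := hM.isLocalObj k
    obtain ⟨P, hP, h⟩ := S.exists_isARPair_left hM
    have hPX : ¬ X P := fun h' => hMX ((prop_iff_of_isARPair hτ hM hP h).2 h')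
    obtain ⟨Y, f, g, l, H⟩ := (E.isARPair_quot hτ hM hP hMX hPX h).of_iso
      (E.quotData_isWeaklyExact hτ) e (Iso.refl _)
    exact ⟨Y, _, f, g, l, H⟩

/-! ### The Auslander–Reiten quiver of the quotient category -/

lemma IndecClass.isLocalObj {C : Type u} [Category.{v} C] [Preadditive C] [HasBinaryBiproducts C]
    (k : Type w) [Field k] [Linear k C] [∀ A B : C, Module.Finite k (A ⟶ B)]
    [IsIdempotentComplete C] (x : IndecClass C) : IsLocalObj x.rep :=
  (_root_.Quotient.out x).2.isLocalObj k

lemma IndecClass.indecomposable {C : Type u} [Category.{v} C] [Preadditive C]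
    [HasBinaryBiproducts C] (x : IndecClass C) : Indecomposable x.rep :=
  (_root_.Quotient.out x).2

lemma IndecClass.ext {C : Type u} [Category.{v} C] [Preadditive C] [HasBinaryBiproducts C]
    {x y : IndecClass C} (e : x.rep ≅ y.rep) : x = y := by
  rw [← Quotient.out_eq x, ← Quotient.out_eq y]
  exact Quotient.sound ⟨e⟩

/-- The class of an indecomposable object. -/
def IndecClass.mk {C : Type u} [Category.{v} C] [Preadditive C] [HasBinaryBiproducts C]
    (A : C) (hA : Indecomposable A) : IndecClass C :=
  _root_.Quotient.mk _ ⟨A, hA⟩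

lemma IndecClass.nonempty_rep_mk_iso {C : Type u} [Category.{v} C] [Preadditive C]
    [HasBinaryBiproducts C] (A : C) (hA : Indecomposable A) :
    Nonempty ((IndecClass.mk A hA).rep ≅ A) :=
  Quotient.mk_out (s := indecSetoid C) ⟨A, hA⟩

/-- The AR quiver of the quotient category is obtained by deleting the vertices in `X`. -/
theorem EnvelopeChoice.exists_iso_delete (hτ : X.map S.translation = X) :
    ∃ e : ((ARQuiver k (triangulatedData T)).delete fun x : IndecClass T => X x.rep).Iso
        (ARQuiver k (E.quotData k)),
      ∀ x : {x : IndecClass T // ¬ X x.rep},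
        Nonempty (IndecClass.rep (C := QuotCat k X) (e.vertex x) ≅
          (quot k X).obj x.1.rep) := by
  let φ : {x : IndecClass T // ¬ X x.rep} → IndecClass (QuotCat k X) := fun x =>
    IndecClass.mk ((quot k X).obj x.1.rep)
      (isLocalObj_quot (x.1.isLocalObj k) x.2).indecomposable
  have i : ∀ x : {x : IndecClass T // ¬ X x.rep},
      Nonempty ((φ x).rep ≅ (quot k X).obj x.1.rep) := fun x => IndecClass.nonempty_rep_mk_iso _ _
  have hφ : Function.Bijective φ := by
    constructor
    · intro x y hxy
      obtain ⟨e⟩ := i x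
      obtain ⟨e'⟩ := i y
      obtain ⟨j⟩ := nonempty_iso_of_quot_iso (x.1.isLocalObj k) (y.1.isLocalObj k) x.2
        (e.symm ≪≫ eqToIso (by rw [hxy]) ≪≫ e')
      exact Subtype.ext (IndecClass.ext j)
    · intro y
      obtain ⟨M, hM, hMX, ⟨e⟩⟩ := exists_indecomposable_of_quot y.rep y.indecomposable
      obtain ⟨j⟩ := IndecClass.nonempty_rep_mk_iso M hM
      have hX : ¬ X (IndecClass.mk M hM).rep := fun h => hMX (X.prop_of_iso j h)
      obtain ⟨e'⟩ := i ⟨IndecClass.mk M hM, hX⟩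
      exact ⟨⟨_, hX⟩, IndecClass.ext (e' ≪≫ (quot k X).mapIso j ≪≫ e)⟩
  refine ⟨⟨Equiv.ofBijective φ hφ, fun x y => finCongr ?_, fun x y => ?_⟩, i⟩
  · obtain ⟨e⟩ := i x
    obtain ⟨e'⟩ := i y
    exact (finrank_irr_quot (X := X) (x.1.isLocalObj k) (y.1.isLocalObj k) x.2 y.2).trans
      (finrank_irr_congr k e e').symm
  · obtain ⟨e⟩ := i x
    obtain ⟨e'⟩ := i y
    refine (E.isARPair_quot_iff hτ (x.1.isLocalObj k) (y.1.isLocalObj k) x.2 y.2).symm.trans ?_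
    exact ⟨fun h => TriangleData.IsARPair.of_iso (E.quotData_isWeaklyExact hτ) h e.symm e'.symm,
      fun h => TriangleData.IsARPair.of_iso (E.quotData_isWeaklyExact hτ) h e e'⟩

end ARPairs

/-! ### The path category and the mesh ideal -/

namespace TranslationQuiver

variable (k : Type w) [Field k] {Γ : TranslationQuiver.{u}}

/-- A path as a morphism of the `k`-linear path category. -/
def pathHom {x y : Γ.V} (p : Quiver.Path x y) : PathCat.of k x ⟶ PathCat.of k y :=
  (Free.embedding k (Paths Γ.V)).map (X := (Paths.of Γ.V).obj x) (Y := (Paths.of Γ.V).obj y) p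

/-- An arrow as a morphism of the `k`-linear path category. -/
def arrowHom {x y : Γ.V} (a : Γ.Arrow x y) : PathCat.of k x ⟶ PathCat.of k y :=
  pathHom k (Quiver.Hom.toPath (show x ⟶ y from a))

variable {k}

lemma pathHom_nil (x : Γ.V) : pathHom k (Quiver.Path.nil : Quiver.Path x x) = 𝟙 (PathCat.of k x) :=
  (Free.embedding k (Paths Γ.V)).map_id _

lemma pathHom_comp {x y z : Γ.V} (p : Quiver.Path x y) (q : Quiver.Path y z) :
    pathHom k (p.comp q) = pathHom k p ≫ pathHom k q :=
  (Free.embedding k (Paths Γ.V)).map_comp (X := (Paths.of Γ.V).obj x)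
    (Y := (Paths.of Γ.V).obj y) (Z := (Paths.of Γ.V).obj z) p q

lemma pathHom_cons {x y z : Γ.V} (p : Quiver.Path x y) (a : Γ.Arrow y z) :
    pathHom k (p.cons a) = pathHom k p ≫ arrowHom k a :=
  pathHom_comp p (Quiver.Hom.toPath (show y ⟶ z from a))

lemma path₂_eq {z x y : Γ.V} (b : Γ.Arrow z x) (a : Γ.Arrow x y) :
    path₂ k b a = arrowHom k b ≫ arrowHom k a :=
  (Free.embedding k (Paths Γ.V)).map_comp _ _

section PathLift

variable {M : Type*} [AddCommGroup M] [Module k M]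

/-- The linear map on a morphism space of the path category with prescribed values on paths. -/
def pathLift {x y : Γ.V} (φ : Quiver.Path x y → M) : (PathCat.of k x ⟶ PathCat.of k y) →ₗ[k] M :=
  Finsupp.linearCombination k φ

lemma pathLift_pathHom {x y : Γ.V} (φ : Quiver.Path x y → M) (p : Quiver.Path x y) :
    pathLift (k := k) φ (pathHom k p) = φ p :=
  (Finsupp.linearCombination_single k (1 : k) p).trans (one_smul k _)

end PathLift

lemma span_pathHom (x y : Γ.V) :
    Submodule.span k (Set.range fun p : Quiver.Path x y => pathHom k p) = ⊤ := by
  refine (eq_top_iff (a := Submodule.span k (Set.range fun p : Quiver.Path x y =>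
    pathHom k p))).2 fun f _ => ?_
  have h : ∀ f : Quiver.Path x y →₀ k,
      f ∈ Submodule.span k (Set.range fun p : Quiver.Path x y => Finsupp.single p (1 : k)) :=
    fun f => by
      induction f using Finsupp.induction_linear with
      | zero => exact Submodule.zero_mem _
      | add f g hf hg => exact Submodule.add_mem _ hf hg
      | single p c =>
        rw [← mul_one c, ← smul_eq_mul, ← Finsupp.smul_single]
        exact Submodule.smul_mem _ _ (Submodule.subset_span ⟨p, rfl⟩)
  exact h f

/-- A submodule containing all paths contains all morphisms. -/
lemma mem_of_pathHom_mem {x y : Γ.V} (N : Submodule k (PathCat.of k x ⟶ PathCat.of k y))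
    (h : ∀ p : Quiver.Path x y, pathHom k p ∈ N) (f : PathCat.of k x ⟶ PathCat.of k y) : f ∈ N := by
  have h1 : Submodule.span k (Set.range fun p : Quiver.Path x y => pathHom k p) ≤ N :=
    Submodule.span_le.2 (by rintro _ ⟨p, rfl⟩; exact h p)
  rw [span_pathHom] at h1
  exact h1 Submodule.mem_top

lemma linearMap_ext {x y : Γ.V} {M : Type*} [AddCommGroup M] [Module k M]
    {φ ψ : (PathCat.of k x ⟶ PathCat.of k y) →ₗ[k] M}
    (h : ∀ p : Quiver.Path x y, φ (pathHom k p) = ψ (pathHom k p)) : φ = ψ :=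
  LinearMap.ext fun f => mem_of_pathHom_mem (LinearMap.eqLocus φ ψ) h f

lemma mem_of_pathHom_comp_mem {x y z : Γ.V} (N : Submodule k (PathCat.of k x ⟶ PathCat.of k z))
    {g : PathCat.of k y ⟶ PathCat.of k z} (h : ∀ p : Quiver.Path x y, pathHom k p ≫ g ∈ N)
    (f : PathCat.of k x ⟶ PathCat.of k y) : f ≫ g ∈ N :=
  mem_of_pathHom_mem (N.comap (Linear.rightComp k _ g)) h f

lemma mem_of_comp_pathHom_mem {x y z : Γ.V} (N : Submodule k (PathCat.of k x ⟶ PathCat.of k z))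
    {f : PathCat.of k x ⟶ PathCat.of k y} (h : ∀ p : Quiver.Path y z, f ≫ pathHom k p ∈ N)
    (g : PathCat.of k y ⟶ PathCat.of k z) : f ≫ g ∈ N :=
  mem_of_pathHom_mem (N.comap (Linear.leftComp k _ f)) h g

/-! ### The filtration of the path category by length -/

section Length

variable (k)

/-- The span of the paths whose length satisfies `P`. -/
def spanLength (P : ℕ → Prop) (x y : Γ.V) : Submodule k (PathCat.of k x ⟶ PathCat.of k y) :=
  Submodule.span k {f | ∃ p : Quiver.Path x y, P p.length ∧ f = pathHom k p}

variable {k}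

lemma pathHom_mem_spanLength {P : ℕ → Prop} {x y : Γ.V} (p : Quiver.Path x y) (h : P p.length) :
    pathHom k p ∈ spanLength k P x y :=
  Submodule.subset_span ⟨p, h, rfl⟩

lemma arrowHom_mem_spanLength {P : ℕ → Prop} {x y : Γ.V} (a : Γ.Arrow x y) (h : P 1) :
    arrowHom k a ∈ spanLength k P x y :=
  pathHom_mem_spanLength _ h

lemma comp_mem_spanLength {P Q R : ℕ → Prop} (hPQ : ∀ m n, P m → Q n → R (m + n)) {x y z : Γ.V}
    {f : PathCat.of k x ⟶ PathCat.of k y} {g : PathCat.of k y ⟶ PathCat.of k z}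
    (hf : f ∈ spanLength k P x y) (hg : g ∈ spanLength k Q y z) :
    f ≫ g ∈ spanLength k R x z := by
  have h1 : ∀ p : Quiver.Path x y, P p.length → pathHom k p ≫ g ∈ spanLength k R x z := by
    intro p hp
    have h2 : spanLength k Q y z ≤
        (spanLength k R x z).comap (Linear.leftComp k (PathCat.of k z) (pathHom k p)) := by
      refine Submodule.span_le.2 ?_
      rintro _ ⟨q, hq, rfl⟩
      refine Submodule.subset_span ⟨p.comp q, ?_, (pathHom_comp p q).symm⟩
      rw [Quiver.Path.length_comp]
      exact hPQ _ _ hp hq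
    exact h2 hg
  have h3 : spanLength k P x y ≤
      (spanLength k R x z).comap (Linear.rightComp k (PathCat.of k x) g) := by
    refine Submodule.span_le.2 ?_
    rintro _ ⟨p, hp, rfl⟩
    exact h1 p hp
  exact h3 hf

lemma mem_spanLength_of_forall {P : ℕ → Prop} {x y : Γ.V}
    (h : ∀ p : Quiver.Path x y, P p.length) (f : PathCat.of k x ⟶ PathCat.of k y) :
    f ∈ spanLength k P x y :=
  mem_of_pathHom_mem _ (fun p => pathHom_mem_spanLength p (h p)) f

lemma mesh_mem_spanLength (p : Γ.Polarization) {z y : Γ.V} (h : Γ.translate z y) {P : ℕ → Prop}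
    (h2 : P 2) : p.mesh k h ∈ spanLength k P z y := by
  refine finsum_induction (fun f => f ∈ spanLength k P z y) (Submodule.zero_mem _)
    (fun _ _ => Submodule.add_mem _) fun a => ?_
  rw [path₂_eq]
  exact comp_mem_spanLength (P := fun n => n = 1) (Q := fun n => n = 1)
    (by rintro _ _ rfl rfl; exact h2) (arrowHom_mem_spanLength _ rfl)
    (arrowHom_mem_spanLength _ rfl)

/-- The mesh ideal is spanned by the elements `a ≫ m ≫ b` with paths `a`, `b` and mesh elements
`m`. -/
lemma meshIdeal_le (p : Γ.Polarization) {x y : Γ.V}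
    (N : Submodule k (PathCat.of k x ⟶ PathCat.of k y))
    (h : ∀ (z y' : Γ.V) (t : Γ.translate z y') (a : Quiver.Path x z) (b : Quiver.Path y' y),
      pathHom k a ≫ p.mesh k t ≫ pathHom k b ∈ N) :
    (p.meshIdeal k).carrier (PathCat.of k x) (PathCat.of k y) ≤ N := by
  refine Submodule.span_le.2 ?_
  rintro _ ⟨Z, Y, a, _, b, ⟨t, rfl⟩, rfl⟩
  have key : ∀ (z y' : Γ.V) (t : Γ.translate z y') (a : PathCat.of k x ⟶ PathCat.of k z)
      (b : PathCat.of k y' ⟶ PathCat.of k y), a ≫ p.mesh k t ≫ b ∈ N := fun z y' t a b => by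
    refine mem_of_pathHom_comp_mem N (fun a => ?_) a
    have h1 := mem_of_comp_pathHom_mem N (f := pathHom k a ≫ p.mesh k t) (fun b => by
      rw [Category.assoc]
      exact h _ _ t a b) b
    rwa [Category.assoc] at h1
  exact key Z Y t a b

lemma mesh_mem_meshIdeal (p : Γ.Polarization) {z y : Γ.V} (t : Γ.translate z y) :
    p.mesh k t ∈ (p.meshIdeal k).carrier (PathCat.of k z) (PathCat.of k y) :=
  Submodule.subset_span ⟨_, _, 𝟙 _, _, 𝟙 _, ⟨t, rfl⟩, ((Category.id_comp _).trans (Category.comp_id _)).symm⟩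

lemma meshIdeal_le_spanLength (p : Γ.Polarization) (x y : Γ.V) :
    (p.meshIdeal k).carrier (PathCat.of k x) (PathCat.of k y) ≤
      spanLength k (fun n => 2 ≤ n) x y := by
  refine meshIdeal_le p _ fun z y' t a b => ?_
  refine comp_mem_spanLength (P := fun n => 0 ≤ n) (Q := fun n => 2 ≤ n)
    (fun m n _ h => by omega) (pathHom_mem_spanLength _ (Nat.zero_le _)) ?_
  exact comp_mem_spanLength (P := fun n => 2 ≤ n) (Q := fun n => 0 ≤ n)
    (fun m n h _ => by omega) (mesh_mem_spanLength p t le_rfl)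
    (pathHom_mem_spanLength _ (Nat.zero_le _))

variable (k) in
/-- The projection onto the span of the paths of length `d`. -/
def lengthProj (d : ℕ) (x y : Γ.V) :
    (PathCat.of k x ⟶ PathCat.of k y) →ₗ[k] (PathCat.of k x ⟶ PathCat.of k y) :=
  pathLift fun p => if p.length = d then pathHom k p else 0

lemma lengthProj_pathHom (d : ℕ) {x y : Γ.V} (p : Quiver.Path x y) :
    lengthProj k d x y (pathHom k p) = if p.length = d then pathHom k p else 0 :=
  pathLift_pathHom _ _

lemma lengthProj_of_mem_spanLength {d n : ℕ} {x y : Γ.V} {f : PathCat.of k x ⟶ PathCat.of k y}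
    (hf : f ∈ spanLength k (fun m => m = n) x y) :
    lengthProj k d x y f = if n = d then f else 0 := by
  have h : spanLength k (fun m => m = n) x y ≤ LinearMap.eqLocus (lengthProj k d x y)
      (if n = d then LinearMap.id else 0) := by
    refine Submodule.span_le.2 ?_
    rintro _ ⟨p, rfl, rfl⟩
    change lengthProj k d x y (pathHom k p) = _
    rw [lengthProj_pathHom]
    split_ifs <;> rfl
  have h1 : lengthProj k d x y f = (if n = d then LinearMap.id else 0 :
      (PathCat.of k x ⟶ PathCat.of k y) →ₗ[k] (PathCat.of k x ⟶ PathCat.of k y)) f := h hf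
  rw [h1]
  split_ifs <;> rfl

/-- The mesh ideal is homogeneous with respect to the length of paths. -/
lemma lengthProj_mem_meshIdeal (p : Γ.Polarization) (d : ℕ) {x y : Γ.V}
    {f : PathCat.of k x ⟶ PathCat.of k y}
    (hf : f ∈ (p.meshIdeal k).carrier (PathCat.of k x) (PathCat.of k y)) :
    lengthProj k d x y f ∈ (p.meshIdeal k).carrier (PathCat.of k x) (PathCat.of k y) := by
  have h : (p.meshIdeal k).carrier (PathCat.of k x) (PathCat.of k y) ≤
      ((p.meshIdeal k).carrier (PathCat.of k x) (PathCat.of k y)).comap (lengthProj k d x y) := by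
    refine meshIdeal_le p _ fun z y' t a b => ?_
    have h1 : pathHom k a ≫ p.mesh k t ≫ pathHom k b ∈
        spanLength k (fun m => m = a.length + (2 + b.length)) x y :=
      comp_mem_spanLength (P := fun m => m = a.length) (Q := fun m => m = 2 + b.length)
        (by rintro _ _ rfl rfl; rfl) (pathHom_mem_spanLength _ rfl)
        (comp_mem_spanLength (P := fun m => m = 2) (Q := fun m => m = b.length)
          (by rintro _ _ rfl rfl; rfl) (mesh_mem_spanLength p t rfl)
          (pathHom_mem_spanLength _ rfl))
    rw [Submodule.mem_comap, lengthProj_of_mem_spanLength h1]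
    split_ifs
    · exact (p.meshIdeal k).comp_left _ ((p.meshIdeal k).comp_right _ (mesh_mem_meshIdeal p t))
    · exact Submodule.zero_mem _
  exact h hf

open Classical in
variable (k) in
/-- The coefficient of a path. -/
def pathCoeff {x y : Γ.V} (p : Quiver.Path x y) : (PathCat.of k x ⟶ PathCat.of k y) →ₗ[k] k :=
  pathLift fun q => if q = p then 1 else 0

open Classical in
lemma pathCoeff_pathHom {x y : Γ.V} (p q : Quiver.Path x y) :
    pathCoeff k p (pathHom k q) = if q = p then 1 else 0 :=
  pathLift_pathHom _ _

lemma pathCoeff_eq_zero {P : ℕ → Prop} {x y : Γ.V} {p : Quiver.Path x y} (hp : ¬ P p.length)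
    {f : PathCat.of k x ⟶ PathCat.of k y} (hf : f ∈ spanLength k P x y) : pathCoeff k p f = 0 := by
  have h : spanLength k P x y ≤ LinearMap.ker (pathCoeff k p) := by
    refine Submodule.span_le.2 ?_
    rintro _ ⟨q, hq, rfl⟩
    change pathCoeff k p (pathHom k q) = 0
    rw [pathCoeff_pathHom, if_neg]
    rintro rfl
    exact hp hq
  exact h hf

lemma eq_zero_of_pathCoeff {x y : Γ.V} {f : PathCat.of k x ⟶ PathCat.of k y}
    (h : ∀ q : Quiver.Path x y, pathCoeff k q f = 0) : f = 0 := by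
  classical
  have h1 : ∀ (q : Quiver.Path x y) (f : Quiver.Path x y →₀ k),
      Finsupp.linearCombination k (fun r => if r = q then (1 : k) else 0) f = f q := by
    intro q f
    rw [Finsupp.linearCombination_apply, Finsupp.sum]
    simpa using fun h => h.symm
  exact Finsupp.ext (fun q => (h1 q f).symm.trans (h q))

/-- An endomorphism in the path category is the sum of a scalar and of paths of positive
length. -/
lemma exists_sub_smul_mem_spanLength (x : Γ.V) (f : PathCat.of k x ⟶ PathCat.of k x) :
    ∃ c : k, f - c • 𝟙 (PathCat.of k x) ∈ spanLength k (fun n => 1 ≤ n) x x := by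
  refine ⟨pathCoeff k Quiver.Path.nil f, ?_⟩
  refine mem_of_pathHom_mem ((spanLength k (fun n => 1 ≤ n) x x).comap (LinearMap.id -
    (LinearMap.toSpanSingleton k _ (𝟙 (PathCat.of k x))).comp
      (pathCoeff k (Quiver.Path.nil : Quiver.Path x x)))) (fun p => ?_) f
  change pathHom k p - pathCoeff k Quiver.Path.nil (pathHom k p) • 𝟙 (PathCat.of k x) ∈
    spanLength k (fun n => 1 ≤ n) x x
  rw [pathCoeff_pathHom]
  split_ifs with h
  · rw [h, pathHom_nil, one_smul, sub_self]
    exact Submodule.zero_mem _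
  · rw [zero_smul, sub_zero]
    refine pathHom_mem_spanLength p (Nat.one_le_iff_ne_zero.2 fun h0 => h ?_)
    exact Quiver.Path.eq_nil_of_length_zero p h0

lemma mem_spanLength_of_ne {x y : Γ.V} (hxy : x ≠ y) (f : PathCat.of k x ⟶ PathCat.of k y) :
    f ∈ spanLength k (fun n => 1 ≤ n) x y :=
  mem_spanLength_of_forall (fun p => Nat.one_le_iff_ne_zero.2 fun h =>
    hxy (Quiver.Path.eq_of_length_zero p h)) f

/-- Modulo paths of length at least two, a combination of paths of positive length is a
combination of arrows. -/
lemma exists_sub_arrows_mem_spanLength {x y : Γ.V} {f : PathCat.of k x ⟶ PathCat.of k y}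
    (hf : f ∈ spanLength k (fun n => 1 ≤ n) x y) :
    ∃ c : Γ.Arrow x y →₀ k, f - Finsupp.linearCombination k (fun a => arrowHom k a) c ∈
      spanLength k (fun n => 2 ≤ n) x y := by
  induction hf using Submodule.span_induction with
  | mem f hf =>
    obtain ⟨p, hp, rfl⟩ := hf
    by_cases h2 : 2 ≤ p.length
    · exact ⟨0, by simpa using pathHom_mem_spanLength p h2⟩
    · cases p with
      | nil => simp at hp
      | cons q a =>
        cases q with
        | nil =>
          refine ⟨Finsupp.single a 1, ?_⟩
          rw [Finsupp.linearCombination_single, one_smul]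
          have : pathHom k ((Quiver.Path.nil : Quiver.Path x x).cons a) = arrowHom k a := rfl
          rw [this, sub_self]
          exact Submodule.zero_mem _
        | cons q b => simp at h2
  | zero => exact ⟨0, by simp⟩
  | add f g _ _ hf hg =>
    obtain ⟨c, hc⟩ := hf
    obtain ⟨d, hd⟩ := hg
    refine ⟨c + d, ?_⟩
    rw [map_add, add_sub_add_comm]
    exact Submodule.add_mem _ hc hd
  | smul r f _ hf =>
    obtain ⟨c, hc⟩ := hf
    refine ⟨r • c, ?_⟩
    rw [map_smul, ← smul_sub]
    exact Submodule.smul_mem _ _ hc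

open Classical in
lemma pathCoeff_linearCombination {x y : Γ.V} (c : Γ.Arrow x y →₀ k) (a : Γ.Arrow x y) :
    pathCoeff k (Quiver.Hom.toPath (show x ⟶ y from a))
      (Finsupp.linearCombination k (fun a => arrowHom k a) c) = c a := by
  rw [← LinearMap.comp_apply]
  have h : (pathCoeff k (Quiver.Hom.toPath (show x ⟶ y from a))).comp
      (Finsupp.linearCombination k (fun a => arrowHom k a)) = Finsupp.lapply a := by
    ext b
    change pathCoeff k (Quiver.Hom.toPath (show x ⟶ y from a))
      (Finsupp.linearCombination k (fun a => arrowHom k a) (Finsupp.single b 1)) =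
        Finsupp.single b (1 : k) a
    rw [Finsupp.linearCombination_single, one_smul, arrowHom, pathCoeff_pathHom,
      Finsupp.single_apply]
    refine if_congr ⟨fun h => ?_, fun h => by rw [h]⟩ rfl rfl
    exact eq_of_heq (Quiver.Path.hom_heq_of_cons_eq_cons h)
  rw [h]
  rfl

end Length

end TranslationQuiver

/-! ### Additive closures -/

section FiniteBiproducts

variable {D : Type u'} [Category.{v'} D] [Preadditive D] [HasFiniteBiproducts D]

/-- A property which is stable under isomorphisms, zero objects and binary biproducts is stable
under finite biproducts. -/
lemma prop_biproduct [HasBinaryBiproducts D] {P : D → Prop} (hiso : ∀ {A B : D}, (A ≅ B) → P A → P B)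
    (hzero : ∀ A : D, IsZero A → P A) (hbiprod : ∀ A B : D, P A → P B → P (A ⊞ B))
    {J : Type} [Finite J] (f : J → D) (h : ∀ j, P (f j)) : P (⨁ f) := by
  let Q : ObjectProperty D := P
  have : Q.IsClosedUnderIsomorphisms := ⟨fun e hX => hiso e hX⟩
  have : HasZeroObject D := hasZeroObject_of_hasFiniteBiproducts D
  obtain ⟨Z, hZ⟩ := HasZeroObject.zero (C := D)
  have : Q.ContainsZero := ⟨⟨Z, hZ, hzero _ hZ⟩⟩
  have : Q.IsClosedUnderBinaryProducts := by
    refine ⟨?_⟩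
    rintro A ⟨p⟩
    have e : A ≅ p.diag.obj ⟨.left⟩ ⊞ p.diag.obj ⟨.right⟩ :=
      (IsLimit.conePointUniqueUpToIso p.isLimit ((IsLimit.postcomposeHomEquiv
        (diagramIsoPair p.diag).symm _).symm (BinaryBiproduct.isLimit _ _)))
    exact hiso e.symm (hbiprod _ _ (p.prop_diag_obj _) (p.prop_diag_obj _))
  have := ObjectProperty.IsClosedUnderFiniteProducts.mk' (P := Q)
  exact hiso (biproduct.isoProduct f).symm (Q.prop_product h)

variable {C : Type u} [Category.{v} C] [Preadditive C] (F : C ⥤ D) [F.Additive]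

/-- The extension of an additive functor to the additive closure. -/
def matLift : Mat_ C ⥤ D where
  obj M := ⨁ fun i => F.obj (M.X i)
  map f := biproduct.matrix fun i j => F.map (f i j)
  map_id M := by
    classical
    ext i j
    by_cases h : j = i
    · subst h
      simp
    · simp [h, biproduct.ι_π_ne _ h, Mat_.id_apply_of_ne]
  map_comp f g := by
    ext i j
    simp [biproduct.lift_desc]

/-- The inclusion of a summand of `(matLift F).obj M`. -/
def matLiftι (M : Mat_ C) (i : M.ι) : F.obj (M.X i) ⟶ (matLift F).obj M :=
  biproduct.ι (fun i => F.obj (M.X i)) i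

/-- The projection onto a summand of `(matLift F).obj M`. -/
def matLiftπ (M : Mat_ C) (i : M.ι) : (matLift F).obj M ⟶ F.obj (M.X i) :=
  biproduct.π (fun i => F.obj (M.X i)) i

lemma matLift_hom_ext {M N : Mat_ C} {f g : (matLift F).obj M ⟶ (matLift F).obj N}
    (h : ∀ i j, matLiftι F M i ≫ f ≫ matLiftπ F N j = matLiftι F M i ≫ g ≫ matLiftπ F N j) :
    f = g :=
  biproduct.hom_ext' _ _ fun i => biproduct.hom_ext _ _ fun j =>
    (Category.assoc _ _ _).trans ((h i j).trans (Category.assoc _ _ _).symm)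

lemma matLift_components {M N : Mat_ C} (f : M ⟶ N) (i : M.ι) (j : N.ι) :
    matLiftι F M i ≫ (matLift F).map f ≫ matLiftπ F N j = F.map (f i j) := by
  simp [matLift, matLiftι, matLiftπ]

instance : (matLift F).Additive where
  map_add {M N f g} := matLift_hom_ext F fun i j => by
    rw [matLift_components, Preadditive.add_comp, Preadditive.comp_add, matLift_components,
      matLift_components, ← F.map_add]
    rfl

lemma matLift_linear (k : Type w) [Field k] [Linear k C] [Linear k D] [F.Linear k] :
    (matLift F).Linear k where
  map_smul {M N} f c := matLift_hom_ext F fun i j => by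
    rw [matLift_components, Linear.smul_comp, Linear.comp_smul, matLift_components,
      ← F.map_smul]
    rfl

instance [F.Faithful] : (matLift F).Faithful where
  map_injective {M N f g} h := by
    ext i j
    refine F.map_injective ?_
    rw [← matLift_components, h, matLift_components]

instance [F.Full] : (matLift F).Full where
  map_surjective {M N} g :=
    ⟨fun i j => F.preimage (matLiftι F M i ≫ g ≫ matLiftπ F N j), matLift_hom_ext F fun i j =>
      (matLift_components F _ i j).trans (F.map_preimage _)⟩

lemma matLift_essImage (A : C) : (matLift F).essImage (F.obj A) :=
  ⟨(Mat_.embedding C).obj A, ⟨biproductUniqueIso fun _ : PUnit => F.obj A⟩⟩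

end FiniteBiproducts

/-! ### Presentations of standard categories -/

section Presentation

variable {k : Type w} [Field k] {Γ : TranslationQuiver.{u'}} (p : Γ.Polarization)
  {T : Type u} [Category.{v} T] [Preadditive T] [Linear k T] [HasBinaryBiproducts T]

open TranslationQuiver

/-- A functor from the path category which identifies `T` with the additive closure of the mesh
category: it is linear and full, its kernel is the mesh ideal, and the vertices generate `T`
under finite biproducts (this is expressed as an induction principle). -/
structure IsPresentation (G : PathCat k Γ ⥤ T) : Prop where
  additive : G.Additive
  linear : G.Linear k
  full : G.Full
  map_eq_zero_iff : ∀ {x y : PathCat k Γ} (f : x ⟶ y),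
    G.map f = 0 ↔ f ∈ (p.meshIdeal k).carrier x y
  induction : ∀ {P : T → Prop}, (∀ {A B : T}, (A ≅ B) → P A → P B) → (∀ A : T, IsZero A → P A) →
    (∀ x : Γ.V, P (G.obj (PathCat.of k x))) → (∀ A B : T, P A → P B → P (A ⊞ B)) → ∀ A : T, P A

lemma exists_isPresentation (F : T ⥤ Mat_ (p.MeshCat k)) [F.Additive] [F.Linear k]
    [F.IsEquivalence] : ∃ G : PathCat k Γ ⥤ T, IsPresentation p G := by
  have h1 : F.inv.Additive := by
    have : F.asEquivalence.functor.Additive := inferInstanceAs F.Additive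
    exact inferInstanceAs F.asEquivalence.inverse.Additive
  have h2 : F.inv.Linear k := by
    have : F.asEquivalence.functor.Linear k := inferInstanceAs (F.Linear k)
    exact inferInstanceAs (F.asEquivalence.inverse.Linear k)
  have h3 : (Mat_.embedding (p.MeshCat k)).Linear k := ⟨fun _ _ => rfl⟩
  refine ⟨(p.meshIdeal k).toQuotient ⋙ Mat_.embedding _ ⋙ F.inv,
    inferInstance, inferInstance, inferInstance, fun f => ?_, ?_⟩
  · rw [← (p.meshIdeal k).toQuotient_map_eq_zero_iff, Functor.comp_map,
      (Mat_.embedding _ ⋙ F.inv).map_eq_zero_iff]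
  · intro P hiso hzero hgen hbiprod A
    have : HasBinaryBiproducts (Mat_ (p.MeshCat k)) := hasBinaryBiproducts_of_finite_biproducts _
    suffices H : ∀ M : Mat_ (p.MeshCat k), P (F.inv.obj M) from
      hiso (F.asEquivalence.unitIso.app A).symm (H (F.obj A))
    intro M
    refine hiso (F.inv.mapIso (Mat_.isoBiproductEmbedding M).symm) ?_
    refine prop_biproduct (P := fun M => P (F.inv.obj M)) (fun e h => hiso (F.inv.mapIso e) h)
      (fun A hA => hzero _ (F.inv.map_isZero hA)) (fun A B hA hB => ?_) _
      (fun i => hgen (show Γ.V from (M.X i).as))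
    have := preservesBinaryBiproduct_of_preservesBiproduct F.inv A B
    exact hiso (F.inv.mapBiprod A B).symm (hbiprod _ _ hA hB)

lemma IsPresentation.exists_equivalence [HasZeroObject T] {G : PathCat k Γ ⥤ T}
    (hG : IsPresentation p G) :
    ∃ F : T ⥤ Mat_ (p.MeshCat k), F.Additive ∧ F.Linear k ∧ F.IsEquivalence := by
  have := hasFiniteProducts_of_has_binary_and_terminal (C := T)
  have : HasFiniteBiproducts T := HasFiniteBiproducts.of_hasFiniteProducts
  have := hG.additive
  have := hG.linear
  have := hG.full
  let L : p.MeshCat k ⥤ T := CategoryTheory.Quotient.lift _ G fun x y f g h => by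
    rw [← sub_eq_zero, ← Functor.map_sub, hG.map_eq_zero_iff]
    exact h
  have hL : ∀ {x y : PathCat k Γ} (f : x ⟶ y), L.map ((p.meshIdeal k).toQuotient.map f) = G.map f :=
    fun f => rfl
  have hsurj : ∀ {x y : p.MeshCat k} (f : x ⟶ y), ∃ f' : x.as ⟶ y.as,
      (p.meshIdeal k).toQuotient.map f' = f := fun {x y} f =>
    (p.meshIdeal k).toQuotient.map_surjective (X := x.as) (Y := y.as) f
  have hLa : L.Additive := ⟨fun {x y f g} => by
    obtain ⟨f, rfl⟩ := hsurj f
    obtain ⟨g, rfl⟩ := hsurj g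
    rw [← Functor.map_add]
    exact G.map_add⟩
  have hLl : L.Linear k := ⟨fun {x y} f c => by
    obtain ⟨f, rfl⟩ := hsurj f
    rw [← Functor.map_smul]
    exact G.map_smul _ _⟩
  have hLf : L.Full := ⟨fun {x y} f => by
    obtain ⟨f', hf'⟩ := G.map_surjective (X := x.as) (Y := y.as) f
    exact ⟨(p.meshIdeal k).toQuotient.map f', hf'⟩⟩
  have hLi : L.Faithful := ⟨fun {x y f g} h => by
    obtain ⟨f, rfl⟩ := hsurj f
    obtain ⟨g, rfl⟩ := hsurj g
    rw [HomIdeal.toQuotient_map_eq_iff, ← hG.map_eq_zero_iff, Functor.map_sub, sub_eq_zero]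
    exact h⟩
  have hM : (matLift L).EssSurj := ⟨fun A => by
    refine hG.induction (P := fun A => (matLift L).essImage A) ?_ ?_ ?_ ?_ A
    · rintro A B e ⟨M, ⟨i⟩⟩
      exact ⟨M, ⟨i ≪≫ e⟩⟩
    · intro A hA
      have : HasZeroObject (Mat_ (p.MeshCat k)) := hasZeroObject_of_hasFiniteBiproducts _
      obtain ⟨Z, hZ⟩ := HasZeroObject.zero (C := Mat_ (p.MeshCat k))
      exact ⟨Z, ⟨((matLift L).map_isZero hZ).iso hA⟩⟩
    · intro x
      exact matLift_essImage L ((p.meshIdeal k).toQuotient.obj (PathCat.of k x))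
    · rintro A B ⟨M, ⟨i⟩⟩ ⟨N, ⟨j⟩⟩
      have : HasBinaryBiproducts (Mat_ (p.MeshCat k)) := hasBinaryBiproducts_of_finite_biproducts _
      have := preservesBinaryBiproduct_of_preservesBiproduct (matLift L) M N
      exact ⟨M ⊞ N, ⟨(matLift L).mapBiprod M N ≪≫ biprod.mapIso i j⟩⟩⟩
  have hE : (matLift L).IsEquivalence := { }
  have hl : (matLift L).asEquivalence.functor.Linear k := matLift_linear L k
  have ha : (matLift L).asEquivalence.functor.Additive := inferInstanceAs (matLift L).Additive
  refine ⟨(matLift L).inv, inferInstanceAs (matLift L).asEquivalence.inverse.Additive,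
    inferInstanceAs ((matLift L).asEquivalence.inverse.Linear k), inferInstance⟩

end Presentation

/-! ### Vertices, radical and arrows in a presentation -/

namespace IsPresentation

open TranslationQuiver

variable {k : Type w} [Field k] {Γ : TranslationQuiver.{u'}} {p : Γ.Polarization}
  {T : Type u} [Category.{v} T] [Preadditive T] [Linear k T] [HasBinaryBiproducts T]
  {G : PathCat k Γ ⥤ T}

lemma map_eq_map_iff (hG : IsPresentation p G) {x y : PathCat k Γ} {f g : x ⟶ y} :
    G.map f = G.map g ↔ f - g ∈ (p.meshIdeal k).carrier x y := by
  have := hG.additive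
  rw [← hG.map_eq_zero_iff, Functor.map_sub, sub_eq_zero]

lemma exists_map (hG : IsPresentation p G) {x y : Γ.V}
    (f : G.obj (PathCat.of k x) ⟶ G.obj (PathCat.of k y)) :
    ∃ f' : PathCat.of k x ⟶ PathCat.of k y, G.map f' = f :=
  hG.full.map_surjective f

lemma id_ne_zero (hG : IsPresentation p G) (x : Γ.V) : 𝟙 (G.obj (PathCat.of k x)) ≠ 0 := by
  rw [← G.map_id, Ne, hG.map_eq_zero_iff]
  intro h
  have h1 := pathCoeff_eq_zero (P := fun n => 2 ≤ n) (p := (Quiver.Path.nil : Quiver.Path x x))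
    (by simp) (meshIdeal_le_spanLength p x x h)
  rw [← pathHom_nil, pathCoeff_pathHom, if_pos rfl] at h1
  exact one_ne_zero h1

/-- Long paths vanish: paths of different lengths which do not vanish are linearly independent,
because the mesh ideal is homogeneous. -/
lemma exists_map_pathHom_eq_zero [∀ A B : T, Module.Finite k (A ⟶ B)] (hG : IsPresentation p G)
    (x y : Γ.V) : ∃ N : ℕ, ∀ q : Quiver.Path x y, N ≤ q.length → G.map (pathHom k q) = 0 := by
  have := hG.additive
  have := hG.linear
  let D : Set ℕ := {d | ∃ q : Quiver.Path x y, q.length = d ∧ G.map (pathHom k q) ≠ 0}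
  choose q hq hne using fun d : D => d.2
  have hind : LinearIndependent k fun d : D => G.map (pathHom k (q d)) := by
    rw [linearIndependent_iff']
    intro s c hc d hd
    have h1 : ∑ e ∈ s, c e • pathHom k (q e) ∈
        (p.meshIdeal k).carrier (PathCat.of k x) (PathCat.of k y) := by
      rw [← hG.map_eq_zero_iff, Functor.map_sum, ← hc]
      exact Finset.sum_congr rfl fun e _ => G.map_smul _ _
    have h2 := lengthProj_mem_meshIdeal p d.1 h1
    have h3 : lengthProj k d.1 x y (∑ e ∈ s, c e • pathHom k (q e)) = c d • pathHom k (q d) := by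
      rw [map_sum, Finset.sum_eq_single d]
      · rw [map_smul, lengthProj_pathHom, if_pos (hq d)]
      · intro e _ hed
        rw [map_smul, lengthProj_pathHom, if_neg, smul_zero]
        rw [hq e]
        exact fun h => hed (Subtype.ext h)
      · exact fun h => absurd hd h
    rw [h3, ← hG.map_eq_zero_iff, Functor.map_smul] at h2
    exact (smul_eq_zero.1 h2).resolve_right (hne d)
  have hfin : D.Finite := hind.finite
  obtain ⟨N, hN⟩ := hfin.bddAbove
  refine ⟨N + 1, fun r hr => ?_⟩
  by_contra h
  have := hN (show r.length ∈ D from ⟨r, rfl, h⟩)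
  omega

/-- Every object with local endomorphism ring is isomorphic to a vertex. -/
lemma exists_iso_of_isLocalObj (hG : IsPresentation p G) {Z : T} (hZ : IsLocalObj Z) :
    ∃ x : Γ.V, Nonempty (G.obj (PathCat.of k x) ≅ Z) := by
  suffices H : ∀ A : T, Indecomposable A → ∃ x : Γ.V, Nonempty (G.obj (PathCat.of k x) ≅ A) from
    H Z hZ.indecomposable
  refine hG.induction ?_ ?_ ?_ ?_
  · rintro A B e h hB
    obtain ⟨x, ⟨i⟩⟩ := h (hB.of_iso e.symm)
    exact ⟨x, ⟨i ≪≫ e⟩⟩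
  · exact fun A hA h => absurd hA h.1
  · exact fun x _ => ⟨x, ⟨Iso.refl _⟩⟩
  · intro A B hA hB h
    rcases h.2 A B (Iso.refl _) with h0 | h0
    · have i : B ≅ A ⊞ B := isoZeroBiprod h0
      obtain ⟨x, ⟨j⟩⟩ := hB (h.of_iso i.symm)
      exact ⟨x, ⟨j ≪≫ i⟩⟩
    · have i : A ≅ A ⊞ B := isoBiprodZero h0
      obtain ⟨x, ⟨j⟩⟩ := hA (h.of_iso i.symm)
      exact ⟨x, ⟨j ≪≫ i⟩⟩

section Finite

variable [∀ A B : T, Module.Finite k (A ⟶ B)]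

lemma isNilpotent_map (hG : IsPresentation p G) {x : Γ.V} {f : PathCat.of k x ⟶ PathCat.of k x}
    (hf : f ∈ spanLength k (fun n => 1 ≤ n) x x) : IsNilpotent (R := End (G.obj _)) (G.map f) := by
  have := hG.additive
  have := hG.linear
  obtain ⟨N, hN⟩ := hG.exists_map_pathHom_eq_zero x x
  have h1 : ∀ n : ℕ, ∃ g ∈ spanLength k (fun m => n ≤ m) x x,
      (show End (G.obj (PathCat.of k x)) from G.map f) ^ n = G.map g := by
    intro n
    induction n with
    | zero =>
      exact ⟨𝟙 _, by
        rw [← pathHom_nil]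
        exact pathHom_mem_spanLength _ (Nat.zero_le _), by rw [pow_zero, G.map_id]; rfl⟩
    | succ n ih =>
      obtain ⟨g, hg, h⟩ := ih
      refine ⟨f ≫ g, comp_mem_spanLength (fun a b ha hb => ?_) hf hg, ?_⟩
      · have : 1 ≤ a := ha
        have : n ≤ b := hb
        omega
      · rw [pow_succ, h, G.map_comp]
        rfl
  obtain ⟨g, hg, h⟩ := h1 N
  refine ⟨N, h.trans ?_⟩
  have h2 : spanLength k (fun m => N ≤ m) x x ≤ LinearMap.ker (G.mapLinearMap k) := by
    refine Submodule.span_le.2 ?_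
    rintro _ ⟨q, hq, rfl⟩
    exact hN q hq
  exact h2 hg

lemma isIso_map_of_sub_smul_mem (hG : IsPresentation p G) {x : Γ.V}
    {f : PathCat.of k x ⟶ PathCat.of k x} {c : k} (hc : c ≠ 0)
    (hf : f - c • 𝟙 _ ∈ spanLength k (fun n => 1 ≤ n) x x) : IsIso (G.map f) := by
  have := hG.additive
  have := hG.linear
  have h1 := isIso_one_sub_of_isNilpotent _
    (hG.isNilpotent_map (Submodule.smul_mem _ (-c⁻¹) hf))
  have h2 : 𝟙 _ - G.map (-c⁻¹ • (f - c • 𝟙 _)) = c⁻¹ • G.map f := by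
    rw [Functor.map_smul, Functor.map_sub, Functor.map_smul, G.map_id, smul_sub, smul_smul]
    rw [neg_mul, inv_mul_cancel₀ hc, neg_smul, neg_smul, one_smul]
    abel
  rw [h2] at h1
  have h3 : G.map f = (c • 𝟙 _) ≫ (c⁻¹ • G.map f) := by
    rw [Linear.smul_comp, Linear.comp_smul, smul_smul, mul_inv_cancel₀ hc, one_smul,
      Category.id_comp]
  have h4 : IsIso (c • 𝟙 (G.obj (PathCat.of k x))) :=
    ⟨c⁻¹ • 𝟙 _, by simp [smul_smul, hc], by simp [smul_smul, hc]⟩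
  rw [h3]
  infer_instance

lemma isLocalObj (hG : IsPresentation p G) (x : Γ.V) : IsLocalObj (G.obj (PathCat.of k x)) where
  id_ne_zero := hG.id_ne_zero x
  isIso_or f := by
    obtain ⟨f, rfl⟩ := hG.exists_map f
    obtain ⟨c, hc⟩ := exists_sub_smul_mem_spanLength x f
    by_cases h : c = 0
    · rw [h, zero_smul, sub_zero] at hc
      exact Or.inr (isIso_one_sub_of_isNilpotent _ (hG.isNilpotent_map hc))
    · exact Or.inl (hG.isIso_map_of_sub_smul_mem h hc)

/-- The radical is the span of the paths of positive length. -/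
lemma map_mem_rad_iff (hG : IsPresentation p G) {x y : Γ.V}
    (f : PathCat.of k x ⟶ PathCat.of k y) :
    G.map f ∈ rad k (G.obj (PathCat.of k x)) (G.obj (PathCat.of k y)) ↔
      f ∈ spanLength k (fun n => 1 ≤ n) x y := by
  constructor
  · intro h
    by_cases hxy : x = y
    · subst hxy
      obtain ⟨c, hc⟩ := exists_sub_smul_mem_spanLength x f
      by_cases h0 : c = 0
      · rwa [h0, zero_smul, sub_zero] at hc
      · exact absurd (hG.isIso_map_of_sub_smul_mem h0 hc)
          ((hG.isLocalObj x).not_isIso_of_mem_rad h)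
    · exact mem_spanLength_of_ne hxy f
  · intro h g
    obtain ⟨g, rfl⟩ := hG.exists_map g
    rw [← G.map_comp]
    refine isIso_one_sub_of_isNilpotent _ (hG.isNilpotent_map ?_)
    exact comp_mem_spanLength (P := fun n => 1 ≤ n) (Q := fun n => 0 ≤ n)
      (fun m n h _ => by omega) h (mem_spanLength_of_forall (fun _ => Nat.zero_le _) g)

lemma eq_of_iso (hG : IsPresentation p G) {x y : Γ.V}
    (e : G.obj (PathCat.of k x) ≅ G.obj (PathCat.of k y)) : x = y := by
  by_contra hxy
  obtain ⟨f, hf⟩ := hG.exists_map e.hom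
  have h := (hG.map_mem_rad_iff f).2 (mem_spanLength_of_ne hxy f)
  rw [hf, (hG.isLocalObj x).mem_rad_iff_not_isSplitMono] at h
  exact h inferInstance

lemma exists_comp_eq_map (hG : IsPresentation p G) {x y : Γ.V} (D : T) :
    ∀ (a : G.obj (PathCat.of k x) ⟶ D) (b : D ⟶ G.obj (PathCat.of k y)),
      a ∈ rad k _ _ → b ∈ rad k _ _ →
      ∃ f ∈ spanLength k (fun n => 2 ≤ n) x y, G.map f = a ≫ b := by
  have := hG.additive
  refine hG.induction (P := fun D => ∀ (a : G.obj (PathCat.of k x) ⟶ D)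
    (b : D ⟶ G.obj (PathCat.of k y)), a ∈ rad k _ _ → b ∈ rad k _ _ →
      ∃ f ∈ spanLength k (fun n => 2 ≤ n) x y, G.map f = a ≫ b) ?_ ?_ ?_ ?_ D
  · intro A B e h a b ha hb
    obtain ⟨f, hf, h⟩ := h (a ≫ e.inv) (e.hom ≫ b) (rad_comp_right k ha _) (rad_comp_left k _ hb)
    exact ⟨f, hf, by rw [h]; simp⟩
  · intro A hA a b _ _
    exact ⟨0, Submodule.zero_mem _, by rw [hA.eq_of_tgt a 0, zero_comp, Functor.map_zero]⟩
  · intro d a b ha hb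
    obtain ⟨a, rfl⟩ := hG.exists_map a
    obtain ⟨b, rfl⟩ := hG.exists_map b
    rw [hG.map_mem_rad_iff] at ha hb
    exact ⟨a ≫ b, comp_mem_spanLength (P := fun n => 1 ≤ n) (Q := fun n => 1 ≤ n)
      (fun m n h h' => by omega) ha hb, G.map_comp _ _⟩
  · intro A B hA hB a b ha hb
    obtain ⟨f, hf, h⟩ := hA (a ≫ biprod.fst) (biprod.inl ≫ b) (rad_comp_right k ha _)
      (rad_comp_left k _ hb)
    obtain ⟨g, hg, h'⟩ := hB (a ≫ biprod.snd) (biprod.inr ≫ b) (rad_comp_right k ha _)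
      (rad_comp_left k _ hb)
    refine ⟨f + g, Submodule.add_mem _ hf hg, ?_⟩
    rw [Functor.map_add, h, h']
    calc _ = a ≫ (biprod.fst ≫ biprod.inl + biprod.snd ≫ biprod.inr) ≫ b := by
            simp only [Preadditive.add_comp, Preadditive.comp_add, Category.assoc]
      _ = a ≫ b := by rw [biprod.total, Category.id_comp]

/-- The square of the radical is the span of the paths of length at least two. -/
lemma map_mem_radSq_iff (hG : IsPresentation p G) {x y : Γ.V}
    (f : PathCat.of k x ⟶ PathCat.of k y) :
    G.map f ∈ radSq k (G.obj (PathCat.of k x)) (G.obj (PathCat.of k y)) ↔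
      f ∈ spanLength k (fun n => 2 ≤ n) x y := by
  have := hG.additive
  have := hG.linear
  constructor
  · intro h
    obtain ⟨g, hg, hgf⟩ : ∃ g ∈ spanLength k (fun n => 2 ≤ n) x y, G.map g = G.map f := by
      generalize G.map f = t at h
      induction h using Submodule.span_induction with
      | mem t ht =>
        obtain ⟨D, a, b, ha, hb, rfl⟩ := ht
        exact hG.exists_comp_eq_map D a b ha hb
      | zero => exact ⟨0, Submodule.zero_mem _, Functor.map_zero _ _ _⟩
      | add s t _ _ hs ht =>
        obtain ⟨s, hs, rfl⟩ := hs
        obtain ⟨t, ht, rfl⟩ := ht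
        exact ⟨s + t, Submodule.add_mem _ hs ht, Functor.map_add _⟩
      | smul c s _ hs =>
        obtain ⟨s, hs, rfl⟩ := hs
        exact ⟨c • s, Submodule.smul_mem _ _ hs, Functor.map_smul _ _ _⟩
    have h1 := meshIdeal_le_spanLength p x y (hG.map_eq_map_iff.1 hgf.symm)
    have := Submodule.add_mem _ h1 hg
    rwa [sub_add_cancel] at this
  · intro h
    have h1 : spanLength k (fun n => 2 ≤ n) x y ≤ (radSq k (G.obj (PathCat.of k x))
        (G.obj (PathCat.of k y))).comap (G.mapLinearMap k) := by
      refine Submodule.span_le.2 ?_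
      rintro _ ⟨q, hq, rfl⟩
      cases q with
      | nil => simp at hq
      | cons q a =>
        change G.map (pathHom k (q.cons a)) ∈ radSq k (G.obj (PathCat.of k x))
          (G.obj (PathCat.of k y))
        rw [pathHom_cons, G.map_comp]
        rw [Quiver.Path.length_cons] at hq
        exact comp_mem_radSq k
          ((hG.map_mem_rad_iff _).2 (pathHom_mem_spanLength q (by omega)))
          ((hG.map_mem_rad_iff _).2 (arrowHom_mem_spanLength a le_rfl))
    exact h1 h

/-- The arrows form a basis of the space `Irr`. -/
lemma finrank_irr (hG : IsPresentation p G) (x y : Γ.V) [Fintype (Γ.Arrow x y)] :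
    Module.finrank k (Irr k (G.obj (PathCat.of k x)) (G.obj (PathCat.of k y))) =
      Fintype.card (Γ.Arrow x y) := by
  have := hG.additive
  have := hG.linear
  have harr : ∀ c : Γ.Arrow x y →₀ k, Finsupp.linearCombination k (fun a => arrowHom k a) c ∈
      spanLength k (fun n => 1 ≤ n) x y := fun c =>
    Submodule.sum_mem _ fun a _ => Submodule.smul_mem _ _ (arrowHom_mem_spanLength a le_rfl)
  let θ : (Γ.Arrow x y →₀ k) →ₗ[k] rad k (G.obj (PathCat.of k x)) (G.obj (PathCat.of k y)) :=
    ((G.mapLinearMap k).comp (Finsupp.linearCombination k fun a => arrowHom k a)).codRestrict _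
      fun c => (hG.map_mem_rad_iff _).2 (harr c)
  have hθ : ∀ c, ((θ c : rad k (G.obj (PathCat.of k x)) (G.obj (PathCat.of k y))) :
      G.obj (PathCat.of k x) ⟶ G.obj (PathCat.of k y)) =
        G.map (Finsupp.linearCombination k (fun a => arrowHom k a) c) := fun c => rfl
  have hinj : Function.Injective ((Submodule.mkQ ((radSq k _ _).submoduleOf (rad k _ _))).comp θ) := by
    rw [← LinearMap.ker_eq_bot, LinearMap.ker_eq_bot']
    intro c hc
    rw [LinearMap.comp_apply, Submodule.mkQ_apply, Submodule.Quotient.mk_eq_zero] at hc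
    have hc' : G.map (Finsupp.linearCombination k (fun a => arrowHom k a) c) ∈
      radSq k (G.obj (PathCat.of k x)) (G.obj (PathCat.of k y)) := hc
    rw [hG.map_mem_radSq_iff] at hc'
    ext a
    rw [← pathCoeff_linearCombination c a]
    refine pathCoeff_eq_zero (P := fun n => 2 ≤ n) ?_ hc'
    change ¬ 2 ≤ 1
    omega
  have hsurj : Function.Surjective
      ((Submodule.mkQ ((radSq k _ _).submoduleOf (rad k _ _))).comp θ) := by
    intro t
    obtain ⟨⟨f, hf⟩, rfl⟩ := Submodule.mkQ_surjective _ t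
    obtain ⟨f, rfl⟩ := hG.exists_map f
    obtain ⟨c, hc⟩ := exists_sub_arrows_mem_spanLength ((hG.map_mem_rad_iff f).1 hf)
    refine ⟨c, ((Submodule.Quotient.eq _).2 ?_).symm⟩
    change G.map f - G.map _ ∈ radSq k _ _
    rw [← Functor.map_sub, hG.map_mem_radSq_iff]
    exact hc
  rw [← (LinearEquiv.ofBijective _ ⟨hinj, hsurj⟩).finrank_eq, Module.finrank_finsupp_self]

end Finite

end IsPresentation

/-! ### Meshes and AR triangles -/

namespace TranslationQuiver

variable {k : Type w} [Field k] {Γ : TranslationQuiver.{u'}}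

open Classical in
variable (k) in
/-- Splitting off the last arrow of a path: a morphism `∑ u_a ≫ a`, where `a` runs through the
arrows ending at `y`, is sent to the family of the `u_a`; trivial paths are sent to `0`. -/
def splitLast (w y : Γ.V) : (PathCat.of k w ⟶ PathCat.of k y) →ₗ[k]
    ∀ a : (Σ x : Γ.V, Γ.Arrow x y), PathCat.of k w ⟶ PathCat.of k a.1 :=
  pathLift fun q => match q with
    | .nil => 0
    | .cons (b := x) q b => Pi.single (M := fun a : (Σ x : Γ.V, Γ.Arrow x y) =>
        PathCat.of k w ⟶ PathCat.of k a.1) ⟨x, b⟩ (pathHom k q)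

open Classical in
lemma splitLast_comp_arrowHom {w y : Γ.V} (a : Σ x : Γ.V, Γ.Arrow x y)
    (f : PathCat.of k w ⟶ PathCat.of k a.1) :
    splitLast k w y (f ≫ arrowHom k a.2) = Pi.single a f := by
  have h : (splitLast k w y).comp (Linear.rightComp k (PathCat.of k w) (arrowHom k a.2)) =
      LinearMap.single k (fun a : (Σ x : Γ.V, Γ.Arrow x y) =>
        PathCat.of k w ⟶ PathCat.of k a.1) a := by
    refine linearMap_ext fun q => ?_
    change splitLast k w y (pathHom k q ≫ arrowHom k a.2) = Pi.single a (pathHom k q)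
    rw [← pathHom_cons, splitLast, pathLift_pathHom]
  exact LinearMap.congr_fun h f

lemma splitLast_sum {w y : Γ.V} [Fintype (Σ x : Γ.V, Γ.Arrow x y)]
    (f : ∀ a : (Σ x : Γ.V, Γ.Arrow x y), PathCat.of k w ⟶ PathCat.of k a.1) :
    splitLast k w y (∑ a, f a ≫ arrowHom k a.2) = f := by
  classical
  rw [map_sum]
  simp only [splitLast_comp_arrowHom]
  exact Finset.univ_sum_single f

lemma sum_splitLast {w y : Γ.V} [Fintype (Σ x : Γ.V, Γ.Arrow x y)]
    {f : PathCat.of k w ⟶ PathCat.of k y} (hf : f ∈ spanLength k (fun n => 1 ≤ n) w y) :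
    ∑ a, splitLast k w y f a ≫ arrowHom k a.2 = f := by
  classical
  let Ψ : (PathCat.of k w ⟶ PathCat.of k y) →ₗ[k] (PathCat.of k w ⟶ PathCat.of k y) :=
    ∑ a : (Σ x : Γ.V, Γ.Arrow x y), (Linear.rightComp k (PathCat.of k w) (arrowHom k a.2)).comp
      ((LinearMap.proj a).comp (splitLast k w y))
  have hΨ : ∀ g, Ψ g = ∑ a, splitLast k w y g a ≫ arrowHom k a.2 := fun g => by
    rw [LinearMap.sum_apply]
    rfl
  have h : spanLength k (fun n => 1 ≤ n) w y ≤ LinearMap.eqLocus Ψ LinearMap.id := by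
    refine Submodule.span_le.2 ?_
    rintro _ ⟨q, hq, rfl⟩
    change Ψ (pathHom k q) = pathHom k q
    rw [hΨ]
    cases q with
    | nil => simp at hq
    | cons q b =>
      rw [pathHom_cons, splitLast_comp_arrowHom ⟨_, b⟩, Finset.sum_eq_single ⟨_, b⟩,
        Pi.single_eq_same]
      · intro a _ ha
        rw [Pi.single_eq_of_ne ha, zero_comp]
      · exact fun h => absurd (Finset.mem_univ _) h
  exact (hΨ f).symm.trans (h hf)

lemma mesh_eq_sum (p : Γ.Polarization) {z y : Γ.V} (t : Γ.translate z y)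
    [Fintype (Σ x : Γ.V, Γ.Arrow x y)] :
    p.mesh k t = ∑ a : (Σ x : Γ.V, Γ.Arrow x y), arrowHom k (p.equiv t a.1 a.2) ≫ arrowHom k a.2 := by
  rw [Polarization.mesh, finsum_eq_sum_of_fintype]
  exact Finset.sum_congr rfl fun a _ => path₂_eq _ _

/-- A combination `∑ u_a ≫ a` of the arrows `a` ending at `y` lies in the mesh ideal only if,
modulo the mesh ideal, it is a multiple of the mesh ending at `y`. -/
lemma exists_splitLast_sub_mem (p : Γ.Polarization) {z y : Γ.V} (t : Γ.translate z y)
    (huniq : ∀ z', Γ.translate z' y → z' = z) [Finite (Σ x : Γ.V, Γ.Arrow x y)] {w : Γ.V}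
    {c : PathCat.of k w ⟶ PathCat.of k y}
    (hc : c ∈ (p.meshIdeal k).carrier (PathCat.of k w) (PathCat.of k y)) :
    ∃ v : PathCat.of k w ⟶ PathCat.of k z, ∀ a : (Σ x : Γ.V, Γ.Arrow x y),
      splitLast k w y c a - v ≫ arrowHom k (p.equiv t a.1 a.2) ∈
        (p.meshIdeal k).carrier (PathCat.of k w) (PathCat.of k a.1) := by
  classical
  have := Fintype.ofFinite (Σ x : Γ.V, Γ.Arrow x y)
  let N : Submodule k (PathCat.of k w ⟶ PathCat.of k y) :=
    { carrier := {c | ∃ v : PathCat.of k w ⟶ PathCat.of k z, ∀ a : (Σ x : Γ.V, Γ.Arrow x y),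
        splitLast k w y c a - v ≫ arrowHom k (p.equiv t a.1 a.2) ∈
          (p.meshIdeal k).carrier (PathCat.of k w) (PathCat.of k a.1)}
      zero_mem' := ⟨0, fun a => by
        rw [map_zero, zero_comp, Pi.zero_apply, sub_zero]
        exact Submodule.zero_mem _⟩
      add_mem' := by
        rintro c c' ⟨v, hv⟩ ⟨v', hv'⟩
        refine ⟨v + v', fun a => ?_⟩
        rw [map_add, Pi.add_apply, Preadditive.add_comp, add_sub_add_comm]
        exact Submodule.add_mem _ (hv a) (hv' a)
      smul_mem' := by
        rintro r c ⟨v, hv⟩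
        refine ⟨r • v, fun a => ?_⟩
        rw [map_smul, Pi.smul_apply, Linear.smul_comp, ← smul_sub]
        exact Submodule.smul_mem _ _ (hv a) }
  refine meshIdeal_le p N (fun z' y' t' q r => ?_) hc
  cases r with
  | nil =>
    obtain rfl := huniq z' t'
    refine ⟨pathHom k q, fun a => ?_⟩
    have h : pathHom k q ≫ p.mesh k t' ≫ pathHom k Quiver.Path.nil =
        ∑ a : (Σ x : Γ.V, Γ.Arrow x y),
          (pathHom k q ≫ arrowHom k (p.equiv t a.1 a.2)) ≫ arrowHom k a.2 := by
      rw [pathHom_nil, Category.comp_id, mesh_eq_sum, Preadditive.comp_sum]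
      exact Finset.sum_congr rfl fun a _ => (Category.assoc _ _ _).symm
    rw [h, splitLast_sum, sub_self]
    exact Submodule.zero_mem _
  | cons r b =>
    refine ⟨0, fun a => ?_⟩
    rw [pathHom_cons, zero_comp, sub_zero, ← Category.assoc (p.mesh k t'), ← Category.assoc,
      splitLast_comp_arrowHom ⟨_, b⟩]
    by_cases h : a = ⟨_, b⟩
    · subst h
      rw [Pi.single_eq_same]
      exact (p.meshIdeal k).comp_left _ ((p.meshIdeal k).comp_right _ (mesh_mem_meshIdeal p t'))
    · rw [Pi.single_eq_of_ne h]
      exact Submodule.zero_mem _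

end TranslationQuiver

lemma not_isSplitMono_of_comp_map_eq_zero {C : Type u} [Category.{v} C] [Preadditive C]
    {D : Type u'} [Category.{v'} D] [Preadditive D] {F : C ⥤ D} {A B : C} {Z : D} {f : A ⟶ B}
    {h : Z ⟶ F.obj A} (h0 : h ≠ 0) (hf : h ≫ F.map f = 0) : ¬ IsSplitMono f := fun _ =>
  h0 (by
    rw [← Category.comp_id h, ← F.map_id, ← IsSplitMono.id f, F.map_comp, ← Category.assoc, hf,
      zero_comp])

namespace IsPresentation

open TranslationQuiver

section

variable {k : Type w} [Field k] {Γ : TranslationQuiver.{u'}} {p : Γ.Polarization}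
  {T : Type u} [Category.{v} T] [Preadditive T] [Linear k T] [HasBinaryBiproducts T]
  {G : PathCat k Γ ⥤ T}

lemma map_arrowHom_ne_zero (hG : IsPresentation p G) {x y : Γ.V} (a : Γ.Arrow x y) :
    G.map (arrowHom k a) ≠ 0 := by
  classical
  rw [Ne, hG.map_eq_zero_iff]
  intro h
  have h1 := pathCoeff_eq_zero (P := fun n => 2 ≤ n)
    (p := Quiver.Hom.toPath (show x ⟶ y from a)) (by change ¬ 2 ≤ 1; omega)
    (meshIdeal_le_spanLength p x y h)
  rw [arrowHom, pathCoeff_pathHom, if_pos rfl] at h1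
  exact one_ne_zero h1

variable [∀ A B : T, Module.Finite k (A ⟶ B)]

lemma map_arrowHom_mem_rad (hG : IsPresentation p G) {x y : Γ.V} (a : Γ.Arrow x y) :
    G.map (arrowHom k a) ∈ rad k (G.obj (PathCat.of k x)) (G.obj (PathCat.of k y)) :=
  (hG.map_mem_rad_iff _).2 (arrowHom_mem_spanLength a le_rfl)

lemma map_arrowHom_not_mem_radSq (hG : IsPresentation p G) {x y : Γ.V} (a : Γ.Arrow x y) :
    G.map (arrowHom k a) ∉ radSq k (G.obj (PathCat.of k x)) (G.obj (PathCat.of k y)) := by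
  classical
  rw [hG.map_mem_radSq_iff]
  intro h
  have h1 := pathCoeff_eq_zero (P := fun n => 2 ≤ n)
    (p := Quiver.Hom.toPath (show x ⟶ y from a)) (by change ¬ 2 ≤ 1; omega) h
  rw [arrowHom, pathCoeff_pathHom, if_pos rfl] at h1
  exact one_ne_zero h1

/-- Radical morphisms ending at a vertex without incoming arrows vanish. -/
lemma eq_zero_of_isEmpty (hG : IsPresentation p G) {y : Γ.V} (hy : ∀ x, IsEmpty (Γ.Arrow x y))
    {W : T} (g : W ⟶ G.obj (PathCat.of k y)) : g ∈ rad k _ _ → g = 0 := by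
  have := hG.additive
  revert g
  refine hG.induction (P := fun W => ∀ g : W ⟶ G.obj (PathCat.of k y),
    g ∈ rad k _ _ → g = 0) ?_ ?_ ?_ ?_ W
  · intro A B e h g hg
    rw [← cancel_epi e.hom, comp_zero]
    exact h _ (rad_comp_left k _ hg)
  · exact fun A hA g _ => hA.eq_of_src _ _
  · intro x g hg
    obtain ⟨g, rfl⟩ := hG.exists_map g
    rw [hG.map_mem_rad_iff] at hg
    have : IsEmpty (Σ x : Γ.V, Γ.Arrow x y) := ⟨fun a => (hy a.1).elim a.2⟩
    have := Fintype.ofFinite (Σ x : Γ.V, Γ.Arrow x y)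
    rw [← sum_splitLast hg, Finset.univ_eq_empty, Finset.sum_empty, Functor.map_zero]
  · intro A B hA hB g hg
    exact biprod.hom_ext' _ _ ((hA _ (rad_comp_left k _ hg)).trans comp_zero.symm)
      ((hB _ (rad_comp_left k _ hg)).trans comp_zero.symm)

end

section Translation

variable {k : Type w} [Field k] {Γ : TranslationQuiver.{u'}} {p : Γ.Polarization}
  {T : Type u} [Category.{v} T] [Preadditive T] [HasZeroObject T] [HasShift T ℤ]
  [∀ n : ℤ, (shiftFunctor T n).Additive] [Pretriangulated T] [Linear k T]
  [∀ A B : T, Module.Finite k (A ⟶ B)] {G : PathCat k Γ ⥤ T}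

/-- There is no arrow out of `z` if `z` is the translate of a vertex without incoming arrows. -/
lemma isEmpty_arrow_of_isARPair [IsIdempotentComplete T] (hG : IsPresentation p G) {z y : Γ.V}
    (H : (triangulatedData T).IsARPair (G.obj (PathCat.of k z)) (G.obj (PathCat.of k y)))
    (hX : IsLocalObj ((G.obj (PathCat.of k z))⟦(1 : ℤ)⟧))
    (hy : ∀ x, IsEmpty (Γ.Arrow x y)) (x : Γ.V) : IsEmpty (Γ.Arrow z x) := by
  obtain ⟨B, f, g, h, H⟩ := H
  have hg : g = 0 := hG.eq_zero_of_isEmpty hy _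
    ((hG.isLocalObj y).mem_rad_iff_not_isSplitEpi.2
      (H.not_isSplitEpi triangulatedData_isWeaklyExact))
  have hf : f = 0 := (H.left_eq_zero_iff (hG.isLocalObj y) hX).2 hg
  refine ⟨fun b => hG.map_arrowHom_ne_zero b ?_⟩
  obtain ⟨v, hv⟩ := H.exists_extension (hG.isLocalObj z) (G.map (arrowHom k b))
    ((hG.isLocalObj z).mem_rad_iff_not_isSplitMono.1 (hG.map_arrowHom_mem_rad b))
  rw [← hv, hf, zero_comp]

/-- Only finitely many arrows end at a vertex which is the last term of an AR triangle, because
their sources are retracts of the middle term. Hence the `finsum` in the definition of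
the mesh elements is a genuine sum. -/
lemma finite_arrows [IsIdempotentComplete T] (hG : IsPresentation p G) {A : T} {y : Γ.V}
    (H : (triangulatedData T).IsARPair A (G.obj (PathCat.of k y)))
    [hfin : ∀ x : Γ.V, Finite (Γ.Arrow x y)] : Finite (Σ x : Γ.V, Γ.Arrow x y) := by
  obtain ⟨B, f, g, h, H⟩ := H
  have hretract : ∀ x : Γ.V, Nonempty (Γ.Arrow x y) →
      ∃ (i : G.obj (PathCat.of k x) ⟶ B) (r : B ⟶ G.obj (PathCat.of k x)), i ≫ r = 𝟙 _ := by
    rintro x ⟨a⟩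
    obtain ⟨s, hs⟩ := H.lift (G.map (arrowHom k a))
      ((hG.isLocalObj y).mem_rad_iff_not_isSplitEpi.1 (hG.map_arrowHom_mem_rad a))
    by_cases hsm : IsSplitMono s
    · exact ⟨s, retraction s, by simp⟩
    · refine absurd ?_ (hG.map_arrowHom_not_mem_radSq a)
      rw [← hs]
      exact comp_mem_radSq k ((hG.isLocalObj x).mem_rad_iff_not_isSplitMono.2 hsm)
        ((hG.isLocalObj y).mem_rad_iff_not_isSplitEpi.2
          (H.not_isSplitEpi triangulatedData_isWeaklyExact))
  let φ : Γ.V → IndecClass T := fun x => IndecClass.mk _ (hG.isLocalObj x).indecomposable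
  have hφ : ∀ x, Nonempty ((φ x).rep ≅ G.obj (PathCat.of k x)) := fun x =>
    IndecClass.nonempty_rep_mk_iso _ _
  have hinj : Function.Injective φ := fun x x' h => by
    obtain ⟨e⟩ := hφ x
    obtain ⟨e'⟩ := hφ x'
    exact hG.eq_of_iso (e.symm ≪≫ eqToIso (congrArg IndecClass.rep h) ≪≫ e')
  have h1 : {x : Γ.V | Nonempty (Γ.Arrow x y)}.Finite := by
    refine Set.Finite.of_finite_image ((finite_retracts k B).subset ?_) hinj.injOn
    rintro _ ⟨x, hx, rfl⟩
    obtain ⟨e⟩ := hφ x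
    obtain ⟨i, r, hir⟩ := hretract x hx
    exact ⟨e.hom ≫ i, r ≫ e.inv, by simp [reassoc_of% hir]⟩
  have := h1.to_subtype
  have : Finite (Σ x : {x : Γ.V | Nonempty (Γ.Arrow x y)}, Γ.Arrow x.1 y) := inferInstance
  exact Finite.of_surjective
    (fun a : (Σ x : {x : Γ.V | Nonempty (Γ.Arrow x y)}, Γ.Arrow x.1 y) =>
      (⟨a.1.1, a.2⟩ : Σ x : Γ.V, Γ.Arrow x y))
    fun a => ⟨⟨⟨a.1, ⟨a.2⟩⟩, a.2⟩, rfl⟩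

/-- In a presentation the translation of the quiver is the AR translation: if `z = τ y` and some
arrow ends at `y`, the vertices `z` and `y` are the end terms of an AR triangle. The arrows ending
at `y` form a right almost split morphism `α`, and the mesh relation makes the
polarized arrows a weak kernel `β` of it; comparing `(β, α)` with an AR triangle identifies the first
terms. -/
lemma isARPair_of_translate (hG : IsPresentation p G) {z y : Γ.V} (t : Γ.translate z y)
    (huniq : ∀ z', Γ.translate z' y → z' = z) [Finite (Σ x : Γ.V, Γ.Arrow x y)]
    (hy : Nonempty (Σ x : Γ.V, Γ.Arrow x y)) {A : T} (hA : IsLocalObj A)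
    (hA' : IsLocalObj (A⟦(1 : ℤ)⟧))
    (H : (triangulatedData T).IsARPair A (G.obj (PathCat.of k y))) :
    (triangulatedData T).IsARPair (G.obj (PathCat.of k z)) (G.obj (PathCat.of k y)) := by
  classical
  suffices e : Nonempty (A ≅ G.obj (PathCat.of k z)) by
    obtain ⟨e⟩ := e
    exact H.of_iso triangulatedData_isWeaklyExact e (Iso.refl _)
  have := hG.additive
  have := hasFiniteProducts_of_has_binary_and_terminal (C := T)
  have : HasFiniteBiproducts T := HasFiniteBiproducts.of_hasFiniteProducts
  have := Fintype.ofFinite (Σ x : Γ.V, Γ.Arrow x y)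
  obtain ⟨B, f, g, h, H⟩ := H
  let M : (Σ x : Γ.V, Γ.Arrow x y) → T := fun a => G.obj (PathCat.of k a.1)
  let α : ⨁ M ⟶ G.obj (PathCat.of k y) := biproduct.desc fun a => G.map (arrowHom k a.2)
  let β : G.obj (PathCat.of k z) ⟶ ⨁ M :=
    biproduct.lift fun a => G.map (arrowHom k (p.equiv t a.1 a.2))
  have hα : ∀ a, biproduct.ι M a ≫ α = G.map (arrowHom k a.2) := fun a => biproduct.ι_desc _ _
  have hβ : ∀ a, β ≫ biproduct.π M a = G.map (arrowHom k (p.equiv t a.1 a.2)) := fun a =>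
    biproduct.lift_π _ _
  have hcomp : ∀ {W : T} (u : W ⟶ ⨁ M), u ≫ α = ∑ a, (u ≫ biproduct.π M a) ≫ G.map (arrowHom k a.2) := by
    intro W u
    calc u ≫ α = u ≫ (∑ a, biproduct.π M a ≫ biproduct.ι M a) ≫ α := by
          have htotal : ∑ a, biproduct.π M a ≫ biproduct.ι M a = 𝟙 (⨁ M) :=
            IsBilimit.total (biproduct.isBilimit M)
          rw [htotal, Category.id_comp]
      _ = _ := by
          rw [Preadditive.sum_comp, Preadditive.comp_sum]
          exact Finset.sum_congr rfl fun a _ => by rw [Category.assoc, Category.assoc, hα]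
  have hβα : β ≫ α = 0 := by
    rw [hcomp, ← (hG.map_eq_zero_iff (p.mesh k t)).2 (mesh_mem_meshIdeal p t), mesh_eq_sum,
      Functor.map_sum]
    exact Finset.sum_congr rfl fun a _ => by rw [hβ, Functor.map_comp]
  -- `β` is a weak kernel of `α`
  have hker : ∀ {W : T} (u : W ⟶ ⨁ M), u ≫ α = 0 → ∃ v, v ≫ β = u := by
    intro W
    refine hG.induction (P := fun W => ∀ (u : W ⟶ ⨁ M), u ≫ α = 0 → ∃ v, v ≫ β = u) ?_ ?_ ?_ ?_ W
    · intro A B e h u hu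
      obtain ⟨v, hv⟩ := h (e.hom ≫ u) (by rw [Category.assoc, hu, comp_zero])
      exact ⟨e.inv ≫ v, by rw [Category.assoc, hv, Iso.inv_hom_id_assoc]⟩
    · exact fun A hA u _ => ⟨0, hA.eq_of_src _ _⟩
    · intro x u hu
      choose u' hu' using fun a => hG.exists_map (u ≫ biproduct.π M a)
      rw [hcomp, Finset.sum_congr rfl fun a _ => by rw [← hu' a, ← G.map_comp],
        ← Functor.map_sum, hG.map_eq_zero_iff] at hu
      obtain ⟨v, hv⟩ := exists_splitLast_sub_mem p t huniq hu
      refine ⟨G.map v, biproduct.hom_ext _ _ fun a => ?_⟩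
      have hva := hv a
      rw [splitLast_sum, ← hG.map_eq_map_iff] at hva
      rw [Category.assoc, hβ, ← hu' a, hva, Functor.map_comp]
    · intro A B hA hB u hu
      obtain ⟨v, hv⟩ := hA (biprod.inl ≫ u) (by rw [Category.assoc, hu, comp_zero])
      obtain ⟨w, hw⟩ := hB (biprod.inr ≫ u) (by rw [Category.assoc, hu, comp_zero])
      exact ⟨biprod.desc v w, biprod.hom_ext' _ _ (by simp [hv]) (by simp [hw])⟩
  -- radical morphisms to the vertex `y` factor through `α`
  have hlift : ∀ {W : T} (s : W ⟶ G.obj (PathCat.of k y)), s ∈ rad k _ _ → ∃ u, u ≫ α = s := by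
    intro W
    refine hG.induction (P := fun W => ∀ (s : W ⟶ G.obj (PathCat.of k y)), s ∈ rad k _ _ →
      ∃ u, u ≫ α = s) ?_ ?_ ?_ ?_ W
    · intro A B e h s hs
      obtain ⟨u, hu⟩ := h (e.hom ≫ s) (rad_comp_left k _ hs)
      exact ⟨e.inv ≫ u, by rw [Category.assoc, hu, Iso.inv_hom_id_assoc]⟩
    · exact fun A hA s _ => ⟨0, hA.eq_of_src _ _⟩
    · intro x s hs
      obtain ⟨s, rfl⟩ := hG.exists_map s
      rw [hG.map_mem_rad_iff] at hs
      refine ⟨biproduct.lift fun a => G.map (splitLast k x y s a), ?_⟩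
      rw [hcomp, ← congrArg G.map (sum_splitLast hs), Functor.map_sum]
      exact Finset.sum_congr rfl fun a _ => by rw [biproduct.lift_π, Functor.map_comp]
    · intro A B hA hB s hs
      obtain ⟨u, hu⟩ := hA (biprod.inl ≫ s) (rad_comp_left k _ hs)
      obtain ⟨u', hu'⟩ := hB (biprod.inr ≫ s) (rad_comp_left k _ hs)
      exact ⟨biprod.desc u u', biprod.hom_ext' _ _ (by simp [hu]) (by simp [hu'])⟩
  have hα_rad : α ∈ rad k _ _ := by
    rw [← Category.id_comp α, hcomp]
    exact Submodule.sum_mem _ fun a _ => rad_comp_left k _ (hG.map_arrowHom_mem_rad a.2)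
  obtain ⟨s, hs⟩ := hlift g ((hG.isLocalObj y).mem_rad_iff_not_isSplitEpi.2
    (H.not_isSplitEpi triangulatedData_isWeaklyExact))
  obtain ⟨t', ht'⟩ := H.lift α ((hG.isLocalObj y).mem_rad_iff_not_isSplitEpi.1 hα_rad)
  have hfg : f ≫ g = 0 := comp_eq_zero₁₂ H.dist
  obtain ⟨c, hc⟩ := hker (f ≫ s) (by rw [Category.assoc, hs, hfg])
  obtain ⟨e, he⟩ := exists_lift₂ H.dist (β ≫ t') (by rw [Category.assoc, ht', hβα])
  obtain ⟨m, hm⟩ := exists_lift₂ H.dist (𝟙 B - s ≫ t') (by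
    rw [Preadditive.sub_comp, Category.assoc, ht', hs, Category.id_comp, sub_self])
  have hf : f ≠ 0 := by
    intro hf
    have hg := (H.left_eq_zero_iff (hG.isLocalObj y) hA').1 hf
    obtain ⟨a⟩ := hy
    refine hG.map_arrowHom_ne_zero a.2 ?_
    rw [← hα, ← ht', hg, comp_zero, comp_zero]
  have hf_rad : f ∈ rad k _ _ := hA.mem_rad_iff_not_isSplitMono.2
    (not_isSplitMono_of_comp_map_eq_zero H.ne_zero (comp_eq_zero₃₁ H.dist))
  -- `c ≫ e` differs from an invertible endomorphism of `A` by a radical one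
  have key : (𝟙 A - (c ≫ e + f ≫ m)) ≫ f = 0 := by
    rw [Preadditive.sub_comp, Preadditive.add_comp, Category.assoc, Category.assoc, he, hm,
      ← Category.assoc c, hc, Preadditive.comp_sub]
    simp
  have hce : IsIso (c ≫ e + f ≫ m) := by
    refine (hA.isIso_or _).resolve_right fun h1 => hf ?_
    rw [← cancel_epi (𝟙 A - (c ≫ e + f ≫ m)), key, comp_zero]
  have hce : ¬ c ≫ e ∈ rad k A A := fun h1 => hA.not_isIso_of_mem_rad
    (Submodule.add_mem _ h1 (rad_comp_right k hf_rad m)) hce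
  have hc_split : IsSplitMono c := by
    by_contra h1
    exact hce (rad_comp_right k (hA.mem_rad_iff_not_isSplitMono.2 h1) e)
  have := hA.isIso_of_isSplitMono (hG.isLocalObj z) c
  exact ⟨asIso c⟩

end Translation

end IsPresentation
/-! ### Full subquivers and restriction of the mesh ideal -/

namespace TranslationQuiver

/-- An embedding of the underlying quiver of `Γ'` as a full subquiver of `Γ`. Nothing is required
about the translations. -/
structure FullEmbedding (Γ' : TranslationQuiver.{v'}) (Γ : TranslationQuiver.{u'}) where
  vertex : Γ'.V → Γ.V
  injective : Function.Injective vertex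
  arrow : ∀ x y : Γ'.V, Γ'.Arrow x y ≃ Γ.Arrow (vertex x) (vertex y)

namespace FullEmbedding

variable {Γ' : TranslationQuiver.{v'}} {Γ : TranslationQuiver.{u'}} (F : FullEmbedding Γ' Γ)

/-- The underlying morphism of quivers. -/
def prefunctor : Γ'.V ⥤q Γ.V where
  obj := F.vertex
  map {x y} a := F.arrow x y a

/-- The image of a path. -/
def mapPath {x y : Γ'.V} (q : Quiver.Path x y) : Quiver.Path (F.vertex x) (F.vertex y) :=
  F.prefunctor.mapPath q

lemma mapPath_cons {x y z : Γ'.V} (q : Quiver.Path x y) (a : Γ'.Arrow y z) :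
    F.mapPath (q.cons a) = (F.mapPath q).cons (F.arrow y z a) :=
  rfl

lemma mapPath_injective {x y : Γ'.V} {q q' : Quiver.Path x y} (h : F.mapPath q = F.mapPath q') :
    q = q' := by
  induction q with
  | nil =>
    cases q' with
    | nil => rfl
    | cons r b => exact absurd (congrArg Quiver.Path.length h) (Nat.succ_ne_zero _).symm
  | cons q a ih =>
    cases q' with
    | nil => exact absurd (congrArg Quiver.Path.length h) (Nat.succ_ne_zero _)
    | cons r b =>
      rw [mapPath_cons, mapPath_cons] at h
      obtain rfl := F.injective (Quiver.Path.obj_eq_of_cons_eq_cons h)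
      rw [ih (eq_of_heq (Quiver.Path.heq_of_cons_eq_cons h))]
      rw [(F.arrow _ _).injective (eq_of_heq (Quiver.Path.hom_heq_of_cons_eq_cons h))]

lemma mem_range_of_mem_vertices {x y : Γ'.V} (q : Quiver.Path x y) {m : Γ.V}
    (hm : m ∈ (F.mapPath q).vertices) : m ∈ Set.range F.vertex := by
  induction q with
  | nil => exact ⟨x, (List.mem_singleton.1 hm).symm⟩
  | cons q a ih =>
    rcases (Quiver.Path.mem_vertices_cons (F.mapPath q) (F.arrow _ _ a)).1 hm with h | h
    · exact ih h
    · exact ⟨_, h.symm⟩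

/-- A path which starts in the image of the embedding stays in the image, or it passes through a
vertex outside. -/
lemma path_cases {x : Γ'.V} {u : Γ.V} (q : Quiver.Path (F.vertex x) u) :
    (∃ (y : Γ'.V) (h : F.vertex y = u) (q' : Quiver.Path x y), q = h ▸ F.mapPath q') ∨
      ∃ (m : Γ.V) (a : Quiver.Path (F.vertex x) m) (b : Quiver.Path m u),
        m ∉ Set.range F.vertex ∧ q = a.comp b := by
  induction q with
  | nil => exact Or.inl ⟨x, rfl, Quiver.Path.nil, rfl⟩
  | @cons _ u' q a ih =>
    rcases ih with ⟨y, rfl, q', rfl⟩ | ⟨m, b, c, hm, rfl⟩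
    · by_cases h : u' ∈ Set.range F.vertex
      · obtain ⟨y', rfl⟩ := h
        refine Or.inl ⟨y', rfl, q'.cons ((F.arrow y y').symm a), ?_⟩
        change (F.mapPath q').cons a = (F.mapPath q').cons (F.arrow y y' ((F.arrow y y').symm a))
        rw [Equiv.apply_symm_apply]
      · exact Or.inr ⟨u', _, Quiver.Path.nil, h, rfl⟩
    · exact Or.inr ⟨m, b, c.cons a, hm, rfl⟩

variable (k : Type w) [Field k]

/-- The span of the paths through vertices outside the image of the embedding. -/
def outer (u v : Γ.V) : Submodule k (PathCat.of k u ⟶ PathCat.of k v) :=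
  Submodule.span k {f | ∃ (m : Γ.V) (a : Quiver.Path u m) (b : Quiver.Path m v),
    m ∉ Set.range F.vertex ∧ f = pathHom k a ≫ pathHom k b}

/-- The map induced on morphism spaces of the path categories. -/
def mapHom (x y : Γ'.V) : (PathCat.of k x ⟶ PathCat.of k y) →ₗ[k]
    (PathCat.of k (F.vertex x) ⟶ PathCat.of k (F.vertex y)) :=
  pathLift fun q => pathHom k (F.mapPath q)

variable {k}

lemma mapHom_pathHom {x y : Γ'.V} (q : Quiver.Path x y) :
    F.mapHom k x y (pathHom k q) = pathHom k (F.mapPath q) :=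
  pathLift_pathHom _ _

lemma mapHom_arrowHom {x y : Γ'.V} (a : Γ'.Arrow x y) :
    F.mapHom k x y (arrowHom k a) = arrowHom k (F.arrow x y a) :=
  F.mapHom_pathHom _

lemma mapHom_comp {x y z : Γ'.V} (f : PathCat.of k x ⟶ PathCat.of k y)
    (g : PathCat.of k y ⟶ PathCat.of k z) :
    F.mapHom k x z (f ≫ g) = F.mapHom k x y f ≫ F.mapHom k y z g := by
  have h1 : ∀ q : Quiver.Path x y, F.mapHom k x z (pathHom k q ≫ g) =
      F.mapHom k x y (pathHom k q) ≫ F.mapHom k y z g := by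
    intro q
    have h2 : (F.mapHom k x z).comp (Linear.leftComp k (PathCat.of k z) (pathHom k q)) =
        (Linear.leftComp k _ (F.mapHom k x y (pathHom k q))).comp (F.mapHom k y z) := by
      refine linearMap_ext fun r => ?_
      change F.mapHom k x z (pathHom k q ≫ pathHom k r) =
        F.mapHom k x y (pathHom k q) ≫ F.mapHom k y z (pathHom k r)
      rw [← pathHom_comp, mapHom_pathHom, mapHom_pathHom, mapHom_pathHom, ← pathHom_comp]
      exact congrArg (pathHom k) (F.prefunctor.mapPath_comp q r)
    exact LinearMap.congr_fun h2 g
  have h3 : (F.mapHom k x z).comp (Linear.rightComp k (PathCat.of k x) g) =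
      (Linear.rightComp k _ (F.mapHom k y z g)).comp (F.mapHom k x y) :=
    linearMap_ext fun q => h1 q
  exact LinearMap.congr_fun h3 f

variable (k) in
/-- The functor between the path categories. -/
def functor : PathCat k Γ' ⥤ PathCat k Γ where
  obj x := PathCat.of k (F.vertex x)
  map {x y} f := F.mapHom k x y f
  map_id x := by
    have h : F.mapHom k x x (pathHom k (Quiver.Path.nil : Quiver.Path (V := Γ'.V) x x)) =
      pathHom k Quiver.Path.nil := F.mapHom_pathHom _
    exact (congrArg (F.mapHom k x x) (pathHom_nil (show Γ'.V from x)).symm).trans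
      (h.trans (pathHom_nil _))
  map_comp f g := F.mapHom_comp f g

instance : (F.functor k).Additive where
  map_add {x y f g} := (F.mapHom k x y).map_add f g

instance : (F.functor k).Linear k where
  map_smul {x y} f c := (F.mapHom k x y).map_smul c f

lemma comp_mem_outer {u m v : Γ.V} (hm : m ∉ Set.range F.vertex)
    (f : PathCat.of k u ⟶ PathCat.of k m) (g : PathCat.of k m ⟶ PathCat.of k v) :
    f ≫ g ∈ F.outer k u v :=
  mem_of_pathHom_comp_mem (F.outer k u v) (fun a => mem_of_comp_pathHom_mem (F.outer k u v)
    (fun b => Submodule.subset_span ⟨m, a, b, hm, rfl⟩) g) f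

lemma outer_comp_left {u u' v : Γ.V} (f : PathCat.of k u' ⟶ PathCat.of k u)
    {g : PathCat.of k u ⟶ PathCat.of k v} (hg : g ∈ F.outer k u v) : f ≫ g ∈ F.outer k u' v := by
  have h : F.outer k u v ≤ (F.outer k u' v).comap (Linear.leftComp k (PathCat.of k v) f) := by
    refine Submodule.span_le.2 ?_
    rintro _ ⟨m, a, b, hm, rfl⟩
    change f ≫ pathHom k a ≫ pathHom k b ∈ F.outer k u' v
    rw [← Category.assoc]
    exact F.comp_mem_outer hm _ _
  exact h hg

lemma outer_comp_right {u v v' : Γ.V} {f : PathCat.of k u ⟶ PathCat.of k v}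
    (hf : f ∈ F.outer k u v) (g : PathCat.of k v ⟶ PathCat.of k v') : f ≫ g ∈ F.outer k u v' := by
  have h : F.outer k u v ≤ (F.outer k u v').comap (Linear.rightComp k (PathCat.of k u) g) := by
    refine Submodule.span_le.2 ?_
    rintro _ ⟨m, a, b, hm, rfl⟩
    change (pathHom k a ≫ pathHom k b) ≫ g ∈ F.outer k u v'
    rw [Category.assoc]
    exact F.comp_mem_outer hm _ _
  exact h hf

/-- Up to paths through outside vertices, every morphism comes from the subquiver. -/
lemma exists_sub_mapHom_mem_outer {x y : Γ'.V}
    (f : PathCat.of k (F.vertex x) ⟶ PathCat.of k (F.vertex y)) :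
    ∃ f' : PathCat.of k x ⟶ PathCat.of k y, f - F.mapHom k x y f' ∈ F.outer k _ _ := by
  have h : f ∈ LinearMap.range (F.mapHom k x y) ⊔ F.outer k _ _ := by
    refine mem_of_pathHom_mem _ (fun q => ?_) f
    rcases F.path_cases q with ⟨y', h, q', rfl⟩ | ⟨m, a, b, hm, rfl⟩
    · obtain rfl := F.injective h
      exact Submodule.mem_sup_left ⟨pathHom k q', F.mapHom_pathHom q'⟩
    · exact Submodule.mem_sup_right (Submodule.subset_span ⟨m, a, b, hm, pathHom_comp a b⟩)
  obtain ⟨_, ⟨f', rfl⟩, d, hd, rfl⟩ := Submodule.mem_sup.1 h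
  exact ⟨f', by rwa [add_sub_cancel_left]⟩

lemma pathCoeff_mapPath_eq_zero {x y : Γ'.V} (q : Quiver.Path x y)
    {f : PathCat.of k (F.vertex x) ⟶ PathCat.of k (F.vertex y)} (hf : f ∈ F.outer k _ _) :
    pathCoeff k (F.mapPath q) f = 0 := by
  have h : F.outer k (F.vertex x) (F.vertex y) ≤ LinearMap.ker (pathCoeff k (F.mapPath q)) := by
    refine Submodule.span_le.2 ?_
    rintro _ ⟨m, a, b, hm, rfl⟩
    change pathCoeff k (F.mapPath q) (pathHom k a ≫ pathHom k b) = 0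
    rw [← pathHom_comp, pathCoeff_pathHom, if_neg]
    intro h
    refine hm (F.mem_range_of_mem_vertices q ?_)
    rw [← h, Quiver.Path.vertices_comp]
    exact List.mem_append_right _ (Quiver.Path.start_mem_vertices b)
  exact h hf

/-- The paths of the subquiver are linearly independent modulo the paths through outside
vertices. -/
lemma eq_zero_of_mapHom_mem_outer {x y : Γ'.V} {f : PathCat.of k x ⟶ PathCat.of k y}
    (hf : F.mapHom k x y f ∈ F.outer k _ _) : f = 0 := by
  classical
  have h : ∀ q : Quiver.Path x y, pathCoeff k q f = 0 := fun q => by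
    rw [← F.pathCoeff_mapPath_eq_zero q hf]
    have h1 : pathCoeff k q = (pathCoeff k (F.mapPath q)).comp (F.mapHom k x y) := by
      refine linearMap_ext fun r => ?_
      rw [LinearMap.comp_apply, mapHom_pathHom, pathCoeff_pathHom, pathCoeff_pathHom]
      exact if_congr ⟨fun h => by rw [h], F.mapPath_injective⟩ rfl rfl
    exact LinearMap.congr_fun h1 f
  exact eq_zero_of_pathCoeff h

/-- The polarizations are compatible along the embedding. The translations may differ at vertices
where no arrow ends: there the mesh elements vanish. -/
structure IsCompatible (p' : Γ'.Polarization) (p : Γ.Polarization) : Prop where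
  arrow_equiv : ∀ {z y : Γ'.V} (t' : Γ'.translate z y) (t : Γ.translate (F.vertex z) (F.vertex y))
    (x : Γ'.V) (a : Γ'.Arrow x y),
    F.arrow z x (p'.equiv t' x a) = p.equiv t (F.vertex x) (F.arrow x y a)
  isEmpty_left : ∀ {z y : Γ'.V}, Γ'.translate z y → ¬ Γ.translate (F.vertex z) (F.vertex y) →
    ∀ x, IsEmpty (Γ'.Arrow x y)
  isEmpty_right : ∀ {z y : Γ'.V}, ¬ Γ'.translate z y → Γ.translate (F.vertex z) (F.vertex y) →
    ∀ u, IsEmpty (Γ.Arrow u (F.vertex y))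

variable {p' : Γ'.Polarization} {p : Γ.Polarization}

/-- The map induced on the arrows ending at a vertex. -/
def mapArrowTo (y : Γ'.V) (a : Σ x : Γ'.V, Γ'.Arrow x y) : Σ u : Γ.V, Γ.Arrow u (F.vertex y) :=
  ⟨F.vertex a.1, F.arrow a.1 y a.2⟩

lemma mapArrowTo_injective (y : Γ'.V) : Function.Injective (F.mapArrowTo y) := by
  rintro ⟨x, a⟩ ⟨x', a'⟩ h
  obtain rfl : x = x' := F.injective (congrArg Sigma.fst h)
  exact congrArg (Sigma.mk x) ((F.arrow x y).injective (eq_of_heq (Sigma.mk.inj h).2))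

lemma finite_arrows (F : FullEmbedding Γ' Γ) [∀ y, Finite (Σ u : Γ.V, Γ.Arrow u y)] (y : Γ'.V) :
    Finite (Σ x : Γ'.V, Γ'.Arrow x y) :=
  Finite.of_injective _ (F.mapArrowTo_injective y)

/-- Up to paths through outside vertices, the mesh elements correspond to each other. -/
lemma mesh_sub_mapHom_mesh_mem_outer (hF : F.IsCompatible p' p)
    [∀ y, Finite (Σ u : Γ.V, Γ.Arrow u y)] {z y : Γ'.V} (t' : Γ'.translate z y)
    (t : Γ.translate (F.vertex z) (F.vertex y)) :
    p.mesh k t - F.mapHom k z y (p'.mesh k t') ∈ F.outer k _ _ := by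
  classical
  have := F.finite_arrows y
  have := Fintype.ofFinite (Σ x : Γ'.V, Γ'.Arrow x y)
  have := Fintype.ofFinite (Σ u : Γ.V, Γ.Arrow u (F.vertex y))
  let m : (Σ u : Γ.V, Γ.Arrow u (F.vertex y)) →
      (PathCat.of k (F.vertex z) ⟶ PathCat.of k (F.vertex y)) := fun a =>
    arrowHom k (p.equiv t a.1 a.2) ≫ arrowHom k a.2
  have h1 : F.mapHom k z y (p'.mesh k t') = ∑ a ∈ Finset.univ.map ⟨_, F.mapArrowTo_injective y⟩, m a := by
    rw [mesh_eq_sum, map_sum, Finset.sum_map]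
    refine Finset.sum_congr rfl fun a _ => ?_
    rw [mapHom_comp, mapHom_arrowHom, mapHom_arrowHom, hF.arrow_equiv t' t]
    rfl
  have h2 : p.mesh k t = ∑ a, m a := mesh_eq_sum p t
  rw [h1, h2, ← Finset.sum_add_sum_compl (Finset.univ.map ⟨_, F.mapArrowTo_injective y⟩) m, add_sub_cancel_left]
  refine Submodule.sum_mem _ fun a ha => F.comp_mem_outer (m := a.1) ?_ _ _
  rintro ⟨x, hx⟩
  obtain ⟨u, a⟩ := a
  obtain rfl : F.vertex x = u := hx
  refine (Finset.mem_compl.1 ha) (Finset.mem_map.2 ⟨⟨x, (F.arrow _ _).symm a⟩,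
    Finset.mem_univ _, ?_⟩)
  exact congrArg (Sigma.mk _) ((F.arrow _ _).apply_symm_apply a)

lemma mapHom_mem_sup_outer (hF : F.IsCompatible p' p) [∀ y, Finite (Σ u : Γ.V, Γ.Arrow u y)]
    {x y : Γ'.V} {f : PathCat.of k x ⟶ PathCat.of k y}
    (hf : f ∈ (p'.meshIdeal k).carrier (PathCat.of k x) (PathCat.of k y)) :
    F.mapHom k x y f ∈ (p.meshIdeal k).carrier (PathCat.of k (F.vertex x))
      (PathCat.of k (F.vertex y)) ⊔ F.outer k (F.vertex x) (F.vertex y) := by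
  classical
  refine meshIdeal_le p' (Submodule.comap (F.mapHom k x y)
    ((p.meshIdeal k).carrier (PathCat.of k (F.vertex x))
      (PathCat.of k (F.vertex y)) ⊔ F.outer k (F.vertex x) (F.vertex y)))
    (fun z y' t' a b => ?_) hf
  rw [Submodule.mem_comap, mapHom_comp, mapHom_comp]
  by_cases t : Γ.translate (F.vertex z) (F.vertex y')
  · have h1 := F.mesh_sub_mapHom_mesh_mem_outer (k := k) hF t' t
    rw [← sub_sub_cancel (p.mesh k t) (F.mapHom k z y' (p'.mesh k t')), Preadditive.sub_comp,
      Preadditive.comp_sub]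
    refine Submodule.sub_mem _ (Submodule.mem_sup_left ?_) (Submodule.mem_sup_right ?_)
    · exact (p.meshIdeal k).comp_left _ ((p.meshIdeal k).comp_right _ (mesh_mem_meshIdeal p t))
    · exact F.outer_comp_left _ (F.outer_comp_right h1 _)
  · have h1 := hF.isEmpty_left t' t
    have : IsEmpty (Σ x : Γ'.V, Γ'.Arrow x y') := ⟨fun a => (h1 a.1).elim a.2⟩
    have := Fintype.ofFinite (Σ x : Γ'.V, Γ'.Arrow x y')
    rw [mesh_eq_sum, Finset.univ_eq_empty, Finset.sum_empty, map_zero, zero_comp, comp_zero]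
    exact Submodule.zero_mem _

lemma mem_map_sup_outer (hF : F.IsCompatible p' p)
    [∀ y, Finite (Σ u : Γ.V, Γ.Arrow u y)] {x y : Γ'.V}
    {f : PathCat.of k (F.vertex x) ⟶ PathCat.of k (F.vertex y)}
    (hf : f ∈ (p.meshIdeal k).carrier (PathCat.of k (F.vertex x)) (PathCat.of k (F.vertex y))) :
    f ∈ ((p'.meshIdeal k).carrier (PathCat.of k x) (PathCat.of k y)).map (F.mapHom k x y) ⊔
      F.outer k (F.vertex x) (F.vertex y) := by
  classical
  refine meshIdeal_le p (((p'.meshIdeal k).carrier (PathCat.of k x) (PathCat.of k y)).map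
    (F.mapHom k x y) ⊔ F.outer k (F.vertex x) (F.vertex y)) (fun z y' t a b => ?_) hf
  rcases F.path_cases a with ⟨z, rfl, a, rfl⟩ | ⟨m, a, a', hm, rfl⟩
  swap
  · rw [pathHom_comp, Category.assoc]
    exact Submodule.mem_sup_right (F.comp_mem_outer hm _ _)
  by_cases hy' : y' ∈ Set.range F.vertex
  swap
  · rw [← Category.assoc]
    exact Submodule.mem_sup_right (F.comp_mem_outer hy' _ _)
  obtain ⟨y', rfl⟩ := hy'
  rcases F.path_cases b with ⟨y₁, h, b, rfl⟩ | ⟨m, b, b', hm, rfl⟩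
  swap
  · rw [pathHom_comp, ← Category.assoc, ← Category.assoc]
    exact Submodule.mem_sup_right (F.comp_mem_outer hm _ _)
  obtain rfl := F.injective h
  change pathHom k (F.mapPath a) ≫ p.mesh k t ≫ pathHom k (F.mapPath b) ∈ _ ⊔ F.outer k _ _
  by_cases t' : Γ'.translate z y'
  · have h1 := F.mesh_sub_mapHom_mesh_mem_outer (k := k) hF t' t
    rw [← sub_add_cancel (p.mesh k t) (F.mapHom k z y' (p'.mesh k t')), Preadditive.add_comp,
      Preadditive.comp_add]
    refine Submodule.add_mem _ (Submodule.mem_sup_right ?_) (Submodule.mem_sup_left ?_)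
    · exact F.outer_comp_left _ (F.outer_comp_right h1 _)
    · refine ⟨pathHom k a ≫ p'.mesh k t' ≫ pathHom k b, (p'.meshIdeal k).comp_left _
        ((p'.meshIdeal k).comp_right _ (mesh_mem_meshIdeal p' t')), ?_⟩
      rw [mapHom_comp, mapHom_comp, mapHom_pathHom, mapHom_pathHom]
  · have h1 := hF.isEmpty_right t' t
    have : IsEmpty (Σ u : Γ.V, Γ.Arrow u (F.vertex y')) := ⟨fun a => (h1 a.1).elim a.2⟩
    have := Fintype.ofFinite (Σ u : Γ.V, Γ.Arrow u (F.vertex y'))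
    rw [mesh_eq_sum, Finset.univ_eq_empty, Finset.sum_empty, zero_comp, comp_zero]
    exact Submodule.zero_mem _

/-- The mesh ideal of the subquiver is the preimage of the ideal generated by the mesh ideal and
by the vertices outside the image. -/
lemma mem_meshIdeal_iff (hF : F.IsCompatible p' p) [∀ y, Finite (Σ u : Γ.V, Γ.Arrow u y)]
    {x y : Γ'.V} (f : PathCat.of k x ⟶ PathCat.of k y) :
    f ∈ (p'.meshIdeal k).carrier (PathCat.of k x) (PathCat.of k y) ↔
      F.mapHom k x y f ∈ (p.meshIdeal k).carrier (PathCat.of k (F.vertex x))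
        (PathCat.of k (F.vertex y)) ⊔ F.outer k (F.vertex x) (F.vertex y) := by
  refine ⟨F.mapHom_mem_sup_outer hF, fun h => ?_⟩
  have h1 : F.mapHom k x y f ∈ ((p'.meshIdeal k).carrier (PathCat.of k x) (PathCat.of k y)).map
      (F.mapHom k x y) ⊔ F.outer k (F.vertex x) (F.vertex y) :=
    (sup_le (fun _ h => F.mem_map_sup_outer hF h) le_sup_right :
      (p.meshIdeal k).carrier _ _ ⊔ F.outer k _ _ ≤ _) h
  obtain ⟨_, ⟨c, hc, rfl⟩, d, hd, hcd⟩ := Submodule.mem_sup.1 h1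
  have h2 : F.mapHom k x y (f - c) ∈ F.outer k _ _ := by
    rw [map_sub, ← hcd, add_sub_cancel_left]
    exact hd
  rwa [sub_eq_zero.1 (F.eq_zero_of_mapHom_mem_outer h2)]

variable (p) in
open Classical in
/-- A polarization restricts to a full subquiver, if no arrow leaves `z` or enters `y` whenever
`z = τ y` in the subquiver only. -/
lemma exists_isCompatible
    (h₁ : ∀ {z y : Γ'.V}, Γ'.translate z y → ¬ Γ.translate (F.vertex z) (F.vertex y) →
      ∀ x, IsEmpty (Γ'.Arrow x y) ∧ IsEmpty (Γ'.Arrow z x))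
    (h₂ : ∀ {z y : Γ'.V}, ¬ Γ'.translate z y → Γ.translate (F.vertex z) (F.vertex y) →
      ∀ u, IsEmpty (Γ.Arrow u (F.vertex y))) :
    ∃ p' : Γ'.Polarization, F.IsCompatible p' p := by
  refine ⟨⟨fun {z y} t' x => if t : Γ.translate (F.vertex z) (F.vertex y) then
      (F.arrow x y).trans ((p.equiv t (F.vertex x)).trans (F.arrow z x).symm)
    else
      have := (h₁ t' t x).1
      have := (h₁ t' t x).2
      Equiv.equivOfIsEmpty _ _⟩, ?_, fun t' t x => (h₁ t' t x).1, h₂⟩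
  intro z y t' t x a
  change F.arrow z x ((dite _ _ _ : Γ'.Arrow x y ≃ Γ'.Arrow z x) a) = _
  rw [dif_pos t]
  exact (F.arrow z x).apply_symm_apply _

end FullEmbedding

end TranslationQuiver
/-! ### Presentations of the quotient category -/

open TranslationQuiver

section

variable {k : Type w} [Field k] {Γ : TranslationQuiver.{u'}} {p : Γ.Polarization}
  {Γ' : TranslationQuiver.{v'}} (F : FullEmbedding Γ' Γ) {p' : Γ'.Polarization}
  {T : Type u} [Category.{v} T] [Preadditive T] [HasZeroObject T] [HasShift T ℤ]
  [∀ n : ℤ, (shiftFunctor T n).Additive] [Pretriangulated T] [Linear k T]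
  {X : ObjectProperty T} [X.IsStableUnderRetracts] [X.IsClosedUnderFiniteCoproducts]
  {G : PathCat k Γ ⥤ T}

/-- A morphism between vertices factors through `X` if and only if it is represented by a
combination of paths through vertices in `X`. -/
lemma IsPresentation.factorsThrough_map_iff (hG : IsPresentation p G)
    (hF : ∀ m : Γ.V, X (G.obj (PathCat.of k m)) ↔ m ∉ Set.range F.vertex) {x y : Γ.V}
    (f : PathCat.of k x ⟶ PathCat.of k y) :
    FactorsThrough X (G.map f) ↔
      f ∈ (p.meshIdeal k).carrier (PathCat.of k x) (PathCat.of k y) ⊔ F.outer k x y := by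
  have := hG.additive
  have := hG.linear
  constructor
  · rintro ⟨Z, a, b, hZ, hab⟩
    suffices H : ∃ d ∈ F.outer k x y, G.map d = a ≫ b by
      obtain ⟨d, hd, h⟩ := H
      rw [← sub_add_cancel f d]
      exact Submodule.add_mem _
        (Submodule.mem_sup_left (hG.map_eq_map_iff.1 (hab.symm.trans h.symm)))
        (Submodule.mem_sup_right hd)
    clear hab
    revert hZ a b
    refine hG.induction (P := fun Z => ∀ (a : G.obj (PathCat.of k x) ⟶ Z)
      (b : Z ⟶ G.obj (PathCat.of k y)), X Z → ∃ d ∈ F.outer k x y, G.map d = a ≫ b)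
      ?_ ?_ ?_ ?_ Z
    · intro A B e h a b hB
      obtain ⟨d, hd, h⟩ := h (a ≫ e.inv) (e.hom ≫ b) (X.prop_of_iso e.symm hB)
      exact ⟨d, hd, by rw [h]; simp⟩
    · intro A hA a b _
      exact ⟨0, Submodule.zero_mem _, by rw [hA.eq_of_tgt a 0, zero_comp, Functor.map_zero]⟩
    · intro m a b hm
      obtain ⟨a, rfl⟩ := hG.exists_map a
      obtain ⟨b, rfl⟩ := hG.exists_map b
      exact ⟨a ≫ b, F.comp_mem_outer ((hF m).1 hm) a b, G.map_comp _ _⟩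
    · intro A B hA hB a b hAB
      obtain ⟨d, hd, h⟩ := hA (a ≫ biprod.fst) (biprod.inl ≫ b)
        (X.prop_of_retract ⟨biprod.inl, biprod.fst, by simp⟩ hAB)
      obtain ⟨d', hd', h'⟩ := hB (a ≫ biprod.snd) (biprod.inr ≫ b)
        (X.prop_of_retract ⟨biprod.inr, biprod.snd, by simp⟩ hAB)
      refine ⟨d + d', Submodule.add_mem _ hd hd', ?_⟩
      rw [Functor.map_add, h, h']
      calc _ = a ≫ (biprod.fst ≫ biprod.inl + biprod.snd ≫ biprod.inr) ≫ b := by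
              simp only [Preadditive.add_comp, Preadditive.comp_add, Category.assoc]
        _ = a ≫ b := by rw [biprod.total, Category.id_comp]
  · intro hf
    have h1 : (p.meshIdeal k).carrier (PathCat.of k x) (PathCat.of k y) ⊔ F.outer k x y ≤
        ((factorIdeal k X).carrier _ _).comap (G.mapLinearMap k) := by
      refine sup_le (fun c hc => ?_) (Submodule.span_le.2 ?_)
      · change G.map c ∈ (factorIdeal k X).carrier (G.obj (PathCat.of k x)) (G.obj (PathCat.of k y))
        rw [(hG.map_eq_zero_iff c).2 hc]
        exact Submodule.zero_mem _
      · rintro _ ⟨m, a, b, hm, rfl⟩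
        exact ⟨_, G.map (pathHom k a), G.map (pathHom k b), (hF m).2 hm, (G.map_comp _ _).symm⟩
    exact h1 hf

/-- A presentation of `T` restricts to a presentation of the quotient category by the subquiver of
the vertices not in `X`. -/
lemma IsPresentation.quot (hG : IsPresentation p G)
    (hF : ∀ m : Γ.V, X (G.obj (PathCat.of k m)) ↔ m ∉ Set.range F.vertex)
    (hp : F.IsCompatible p' p) [∀ y, Finite (Σ u : Γ.V, Γ.Arrow u y)] :
    IsPresentation p' (F.functor k ⋙ G ⋙ quot k X) := by
  have := hG.additive
  have := hG.linear
  have hmap : ∀ {x y : Γ'.V} (f : PathCat.of k x ⟶ PathCat.of k y),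
      (F.functor k ⋙ G ⋙ ARQuot.quot k X).map f =
        (ARQuot.quot k X).map (G.map (F.mapHom k x y f)) := fun f => rfl
  have hfull : ∀ {x y : Γ'.V} (g : (ARQuot.quot k X).obj (G.obj (PathCat.of k (F.vertex x))) ⟶
      (ARQuot.quot k X).obj (G.obj (PathCat.of k (F.vertex y)))),
      ∃ f : PathCat.of k x ⟶ PathCat.of k y, (F.functor k ⋙ G ⋙ ARQuot.quot k X).map f = g := by
    intro x y g
    obtain ⟨g, rfl⟩ := (ARQuot.quot k X).map_surjective g
    obtain ⟨g, rfl⟩ := hG.exists_map g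
    obtain ⟨f, hf⟩ := F.exists_sub_mapHom_mem_outer g
    refine ⟨f, ?_⟩
    have h : FactorsThrough X (G.map g - G.map (F.mapHom k x y f)) := by
      rw [← Functor.map_sub, hG.factorsThrough_map_iff F hF]
      exact Submodule.mem_sup_right hf
    exact (quot_map_eq_iff.2 h).symm
  have hzero : ∀ {x y : Γ'.V} (f : PathCat.of k x ⟶ PathCat.of k y),
      (F.functor k ⋙ G ⋙ ARQuot.quot k X).map f = 0 ↔ f ∈ (p'.meshIdeal k).carrier _ _ := by
    intro x y f
    rw [hmap, F.mem_meshIdeal_iff hp, ← hG.factorsThrough_map_iff F hF]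
    exact quot_map_eq_zero_iff
  refine ⟨inferInstance, inferInstance, ⟨fun g => hfull g⟩, fun f => hzero f, ?_⟩
  intro P hiso hz hgen hbiprod A
  refine hG.induction (P := fun A => P ((ARQuot.quot k X).obj A)) ?_ ?_ ?_ ?_ A.as
  · exact fun e h => hiso ((ARQuot.quot k X).mapIso e) h
  · exact fun A hA => hz _ ((ARQuot.quot k X).map_isZero hA)
  · intro m
    by_cases hm : m ∈ Set.range F.vertex
    · obtain ⟨x, rfl⟩ := hm
      exact hgen x
    · exact hz _ (isZero_quot_iff.2 ((hF m).2 hm))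
  · intro A B hA hB
    have := preservesBinaryBiproduct_of_preservesBinaryProduct (ARQuot.quot k X) (X := A) (Y := B)
    exact hiso ((ARQuot.quot k X).mapBiprod A B).symm (hbiprod _ _ hA hB)

variable [∀ A B : T, Module.Finite k (A ⟶ B)] [IsIdempotentComplete T]

/-- The vertices of the AR quiver of the quotient category, as a full subquiver. -/
lemma exists_fullEmbedding [∀ x y : Γ.V, Fintype (Γ.Arrow x y)] (E : EnvelopeChoice X)
    (hG : IsPresentation p G)
    (harr : ∀ x y : Γ.V, Module.finrank k (Irr k (G.obj (PathCat.of k x)) (G.obj (PathCat.of k y))) =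
      Fintype.card (Γ.Arrow x y)) :
    ∃ F : FullEmbedding (ARQuiver k (E.quotData k)) Γ,
      (∀ m : Γ.V, X (G.obj (PathCat.of k m)) ↔ m ∉ Set.range F.vertex) ∧
      ∀ x : IndecClass (QuotCat k X),
        Nonempty ((ARQuot.quot k X).obj (G.obj (PathCat.of k (F.vertex x))) ≅ x.rep) := by
  have h : ∀ x : IndecClass (QuotCat k X), ∃ m : Γ.V, ¬ X (G.obj (PathCat.of k m)) ∧
      Nonempty ((ARQuot.quot k X).obj (G.obj (PathCat.of k m)) ≅ x.rep) := by
    intro x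
    obtain ⟨M, hM, hMX, ⟨e⟩⟩ := exists_indecomposable_of_quot x.rep x.indecomposable
    obtain ⟨m, ⟨i⟩⟩ := hG.exists_iso_of_isLocalObj (hM.isLocalObj k)
    exact ⟨m, fun h => hMX (X.prop_of_iso i h), ⟨(ARQuot.quot k X).mapIso i ≪≫ e⟩⟩
  choose ι hι e using h
  have hinj : Function.Injective ι := by
    intro x y hxy
    obtain ⟨i⟩ := e x
    obtain ⟨j⟩ := e y
    rw [hxy] at i
    exact IndecClass.ext (i.symm ≪≫ j)
  have hcard : ∀ x y : IndecClass (QuotCat k X),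
      Module.finrank k (Irr k x.rep y.rep) = Fintype.card (Γ.Arrow (ι x) (ι y)) := by
    intro x y
    obtain ⟨i⟩ := e x
    obtain ⟨j⟩ := e y
    rw [← finrank_irr_congr k i j, ← finrank_irr_quot (hG.isLocalObj _) (hG.isLocalObj _) (hι x)
      (hι y), harr]
  refine ⟨⟨ι, hinj, fun x y => (finCongr (hcard x y)).trans (Fintype.equivFin _).symm⟩,
    fun m => ⟨?_, fun hm => ?_⟩, e⟩
  · rintro hm ⟨x, rfl⟩
    exact hι x hm
  · by_contra hmX
    have hloc := isLocalObj_quot (k := k) (hG.isLocalObj m) hmX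
    obtain ⟨i⟩ := IndecClass.nonempty_rep_mk_iso _ hloc.indecomposable
    obtain ⟨j⟩ := e (IndecClass.mk _ hloc.indecomposable)
    obtain ⟨l⟩ := nonempty_iso_of_quot_iso (hG.isLocalObj _) (hG.isLocalObj m) (hι _) (j ≪≫ i)
    exact hm ⟨_, hG.eq_of_iso l⟩

/-- If `T` is standard, so is the quotient category. -/
theorem EnvelopeChoice.isStandard {S : SerreFunctor k T} (E : EnvelopeChoice X)
    (hτ : X.map S.translation = X) (h : IsStandard k (triangulatedData T)) :
    IsStandard k (E.quotData k) := by
  obtain ⟨p, Θ, _, _, _⟩ := h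
  obtain ⟨G, hG⟩ := exists_isPresentation p Θ
  have : ∀ x y : (ARQuiver k (triangulatedData T)).V,
      Fintype ((ARQuiver k (triangulatedData T)).Arrow x y) := fun x y =>
    inferInstanceAs (Fintype (Fin _))
  obtain ⟨F, hF, e⟩ := exists_fullEmbedding E hG fun x y => hG.finrank_irr x y
  have hshift : ∀ {A : T}, IsLocalObj A → IsLocalObj (A⟦(1 : ℤ)⟧) := fun hA =>
    hA.map_of_fullyFaithful k _
  have hD := triangulatedData_isWeaklyExact (T := T)
  -- for each vertex there is an AR triangle ending there
  have hpair : ∀ Z : T, IsLocalObj Z → ∃ A : T, IsLocalObj A ∧ (triangulatedData T).IsARPair A Z :=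
    fun _ hZ => ⟨_, S.isLocalObj_translation hZ, S.isARPair_translation hZ⟩
  have hfin : ∀ y, Finite (Σ x, (ARQuiver k (triangulatedData T)).Arrow x y) := fun y => by
    obtain ⟨A, _, h⟩ := hpair _ (hG.isLocalObj y)
    exact hG.finite_arrows h
  have htranslate : ∀ y : IndecClass T, ∃ z : IndecClass T,
      (triangulatedData T).IsARPair z.rep y.rep := fun y => by
    obtain ⟨A, hA, h⟩ := hpair _ (y.isLocalObj k)
    obtain ⟨i⟩ := IndecClass.nonempty_rep_mk_iso A hA.indecomposable
    exact ⟨_, h.of_iso hD i.symm (Iso.refl _)⟩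
  have huniq : ∀ z z' y : IndecClass T, (triangulatedData T).IsARPair z.rep y.rep →
      (triangulatedData T).IsARPair z'.rep y.rep → z' = z := fun z z' y h h' => by
    obtain ⟨i⟩ := h'.nonempty_iso hD h (z'.isLocalObj k) (z.isLocalObj k)
    exact IndecClass.ext i
  -- the translation of the quiver is the AR translation of the vertices
  have hiff : ∀ {z y : (ARQuiver k (triangulatedData T)).V},
      Nonempty (Σ x, (ARQuiver k (triangulatedData T)).Arrow x y) →
      ((ARQuiver k (triangulatedData T)).translate z y ↔
        (triangulatedData T).IsARPair (G.obj (PathCat.of k z)) (G.obj (PathCat.of k y))) := by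
    intro z y hy
    obtain ⟨A, hA, hAy⟩ := hpair _ (hG.isLocalObj y)
    have h1 : ∀ z, (ARQuiver k (triangulatedData T)).translate z y →
        (triangulatedData T).IsARPair (G.obj (PathCat.of k z)) (G.obj (PathCat.of k y)) :=
      fun z t => hG.isARPair_of_translate t (fun z' t' => huniq z z' y t t') hy hA (hshift hA) hAy
    refine ⟨h1 z, fun H => ?_⟩
    obtain ⟨z₀, t₀⟩ := htranslate y
    obtain ⟨i⟩ := H.nonempty_iso hD (h1 z₀ t₀) (hG.isLocalObj z) (hG.isLocalObj z₀)
    obtain rfl := hG.eq_of_iso i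
    exact t₀
  have hX : ∀ x, ¬ X (G.obj (PathCat.of k (F.vertex x))) := fun x h => (hF _).1 h ⟨x, rfl⟩
  have hiff' : ∀ z y : (ARQuiver k (E.quotData k)).V,
      (ARQuiver k (E.quotData k)).translate z y ↔ (triangulatedData T).IsARPair
        (G.obj (PathCat.of k (F.vertex z))) (G.obj (PathCat.of k (F.vertex y))) := by
    intro z y
    rw [← E.isARPair_quot_iff hτ (hG.isLocalObj _) (hG.isLocalObj _) (hX z) (hX y)]
    obtain ⟨i⟩ := e z
    obtain ⟨j⟩ := e y
    exact ⟨fun h => TriangleData.IsARPair.of_iso (E.quotData_isWeaklyExact hτ) h i.symm j.symm,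
      fun h => TriangleData.IsARPair.of_iso (E.quotData_isWeaklyExact hτ) h i j⟩
  obtain ⟨p', hp'⟩ := F.exists_isCompatible p (fun {z y} t' t x => by
    have hy : ∀ u, IsEmpty ((ARQuiver k (triangulatedData T)).Arrow u (F.vertex y)) := fun u =>
      ⟨fun a => t ((hiff ⟨⟨u, a⟩⟩).2 ((hiff' z y).1 t'))⟩
    have hz := hG.isEmpty_arrow_of_isARPair ((hiff' z y).1 t') (hshift (hG.isLocalObj _)) hy
    exact ⟨⟨fun a => (hy _).elim (F.arrow x y a)⟩, ⟨fun a => (hz _).elim (F.arrow z x a)⟩⟩)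
    (fun {z y} t' t u => ⟨fun a => t' ((hiff' z y).2 ((hiff ⟨⟨u, a⟩⟩).1 t))⟩)
  have hZ : HasZeroObject (QuotCat k X) := by
    obtain ⟨Z, hZ⟩ := HasZeroObject.zero (C := T)
    exact ⟨⟨_, (ARQuot.quot k X).map_isZero hZ⟩⟩
  obtain ⟨Ψ, h₁, h₂, h₃⟩ := (hG.quot F hF hp').exists_equivalence
  exact ⟨p', Ψ, h₁, h₂, h₃⟩

end
end ARQuot

end

theorem mainTheorem2 {k : Type*} [Field k] [IsAlgClosed k]
    {T : Type*} [Category* T] [Preadditive T] [HasZeroObject T] [HasShift T ℤ]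
    [∀ n : ℤ, (shiftFunctor T n).Additive] [Pretriangulated T] [IsTriangulated T]
    [Linear k T] [∀ n : ℤ, (shiftFunctor T n).Linear k]
    [∀ A B : T, Module.Finite k (A ⟶ B)] [IsIdempotentComplete T]
    (S : ARQuot.SerreFunctor k T)
    (X : ObjectProperty T) [X.IsStableUnderRetracts] [X.IsClosedUnderFiniteCoproducts]
    (_hcov : ARQuot.IsPrecovering X) (_henv : ARQuot.IsPreenveloping X)
    (_hτ : X.map S.translation = X)
    (E : ARQuot.EnvelopeChoice X) :
    ((E.susp k).IsEquivalence ∧ (E.quotData k).HasARTriangles) ∧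
    (∃ e : ((ARQuot.ARQuiver k (ARQuot.triangulatedData T)).delete
          fun x : ARQuot.IndecClass T => X x.rep).Iso (ARQuot.ARQuiver k (E.quotData k)),
        ∀ x : {x : ARQuot.IndecClass T // ¬ X x.rep},
          Nonempty (ARQuot.IndecClass.rep (C := ARQuot.QuotCat k X) (e.vertex x) ≅
            (ARQuot.quot k X).obj x.1.rep)) ∧
    (ARQuot.IsStandard k (ARQuot.triangulatedData T) → ARQuot.IsStandard k (E.quotData k)) := by
  exact ⟨⟨E.susp_isEquivalence _hτ _hcov, E.hasARTriangles _hτ⟩, E.exists_iso_delete _hτ,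
    E.isStandard _hτ⟩
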